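/- Let $(M^{2n},\omega)$ be a (smooth, Hausdorff) symplectic manifold of dimension $2n$, let $k<n$, and let $F_1,\dots,F_k:M\to\mathbb R$ be smooth functions whose differentials are linearly independent at every point of $M$. Let $J$ be the isomorphism $T_m^*M\to T_mM$ given by $\omega(x,Ja)=a(x)$, and assume that the $F_j$ are in involution, $[F_i,F_j]=\omega(J\,dF_i,J\,dF_j)=0$, and that the Hamiltonian vector fields $J\,dF_j$ have global phase flows $g_j^t$ $(t\in\mathbb R)$. Let $\Lambda^k\subset M$ be a smoothly embedded $k$-dimensional torus $S^1\times\dots\times S^1$ which is isotropic ($\omega|_{\Lambda^k}=0$) and invariant ($J\,dF_j(m)\in T_m\Lambda^k$ for all $m\in\Lambda^k$ and all $j$). For $t=(t_1,\dots,t_k)\in\mathbb R^k$ put $g^{t}=g_1^{t_1}\circ\dots\circ g_k^{t_k}$. Fix $m\in\Lambda^k$ and let $G=\{t\in\mathbb R^k: g^{t}m=m\}$. The additive group $G$ is generated by $k$ linearly independent vectors. Let $T_1,\dots,T_k\in\mathbb R^k$ be any linearly independent vectors generating $G$. Let $T_m\Sigma=\bigcap_j\ker dF_j(m)$ be the tangent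 space of the joint level set of $F_1,\dots,F_k$ through $m$, and let $\Gamma_m=T_m\Sigma/T_m\Lambda^k$. The derivative $G_j=(g^{T_j})_{*,m}:T_mM\to T_mM$ maps $T_m\Sigma$ into itself and induces a unique linear operator $\Xi_j:\Gamma_m\to\Gamma_m$, $\Xi_j[v]=[G_jv]$ (the reduced monodromy operator). Suppose that all $\Xi_1,\dots,\Xi_k$ are stable, i.e. for every $\varepsilon>0$ there is $\delta>0$ such that $|x|<\delta$ implies $|\Xi_j^Nx|<\varepsilon$ for all integers $N>0$. Then there exists a complex germ on $\Lambda^k$ invariant under the Hamiltonian flows of $F_1,\dots,F_k$. That is, writing $[\cdot,\cdot]$ for the complex bilinear extension of $\omega$, there is a smooth family $r(p)\subset (T_pM)^{\mathbb C}$, $p\in\Lambda^k$, of $n$-dimensional complex subspaces (locally spanned by $n$ smooth complex vector fields along $\Lambda^k$) such that for all $p\in\Lambda^k$: (i) $[x,y]=0$ for all $x,y\in r(p)$; (ii) $(T_p\Lambda^k)^{\mathbb C}\subset r(p)$; (iii) $\frac1{2i}[x,\bar x]>0$ for all $x\in r(p)\setminus (T_p\Lambda^k)^{\mathbb C}$;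 (iv) $\big((g_j^t)_{*,p}\big)^{\mathbb C}\,r(p)=r(g_j^tp)$ for all $t\in\mathbb R$ and $j=1,\dots,k$. -/

import Mathlib

open Set Topology Manifold
open scoped ContDiff TensorProduct

noncomputable section

namespace ComplexGerm

variable {n k : ℕ} {M : Type*} [TopologicalSpace M]
  [ChartedSpace (EuclideanSpace ℝ (Fin (2 * n))) M]

/-! ### Symplectic manifolds -/

/-- The local expression of a field `σ` of alternating two-forms in the chart centred at `x₀`,
i.e. its pull-back to the model space under the inverse of that chart. It is meaningful on the
target of the chart. -/
def chartForm (σ : ∀ m : M, TangentSpace (𝓡 (2 * n)) m [⋀^Fin 2]→L[ℝ] ℝ) (x₀ : M)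
    (y : EuclideanSpace ℝ (Fin (2 * n))) : EuclideanSpace ℝ (Fin (2 * n)) [⋀^Fin 2]→L[ℝ] ℝ :=
  (σ ((extChartAt (𝓡 (2 * n)) x₀).symm y)).compContinuousLinearMap
    (mfderiv 𝓘(ℝ, EuclideanSpace ℝ (Fin (2 * n))) (𝓡 (2 * n))
      (extChartAt (𝓡 (2 * n)) x₀).symm y)

variable (n M) in
/-- A symplectic structure: a smooth, closed, nondegenerate two-form. Smoothness and closedness are
expressed in the charts `chartAt x₀`, which cover the manifold. -/
structure SymplecticForm where
  toForm : ∀ m : M, TangentSpace (𝓡 (2 * n)) m [⋀^Fin 2]→L[ℝ] ℝ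
  smooth : ∀ x₀ : M,
    ContDiffOn ℝ ∞ (chartForm toForm x₀) (extChartAt (𝓡 (2 * n)) x₀).target
  closed : ∀ x₀ : M, ∀ y ∈ (extChartAt (𝓡 (2 * n)) x₀).target,
    extDeriv (chartForm toForm x₀) y = 0
  nondegenerate : ∀ (m : M) (y : TangentSpace (𝓡 (2 * n)) m),
    (∀ x : TangentSpace (𝓡 (2 * n)) m, toForm m ![x, y] = 0) → y = 0

/-- The symplectic structure at `m`, as a bilinear form on the tangent space. -/
def SymplecticForm.bilin (σ : SymplecticForm n M) (m : M) :
    LinearMap.BilinForm ℝ (TangentSpace (𝓡 (2 * n)) m) :=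
  have h0 (x y z : TangentSpace (𝓡 (2 * n)) m) : Function.update ![x, y] 0 z = ![z, y] := by
    ext i; fin_cases i <;> rfl
  have h1 (x y z : TangentSpace (𝓡 (2 * n)) m) : Function.update ![x, y] 1 z = ![x, z] := by
    ext i; fin_cases i <;> rfl
  LinearMap.mk₂ ℝ (fun x y => σ.toForm m ![x, y])
    (fun x x' y => by simpa only [h0] using (σ.toForm m).map_update_add ![x, y] 0 x x')
    (fun c x y => by simpa only [h0] using (σ.toForm m).map_update_smul ![x, y] 0 c x)
    (fun x y y' => by simpa only [h1] using (σ.toForm m).map_update_add ![x, y] 1 y y')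
    (fun c x y => by simpa only [h1] using (σ.toForm m).map_update_smul ![x, y] 1 c y)

@[simp]
theorem SymplecticForm.bilin_apply (σ : SymplecticForm n M) (m : M)
    (x y : TangentSpace (𝓡 (2 * n)) m) : σ.bilin m x y = σ.toForm m ![x, y] := rfl

instance finiteDimensional_tangentSpace (m : M) :
    FiniteDimensional ℝ (TangentSpace (𝓡 (2 * n)) m) :=
  inferInstanceAs (FiniteDimensional ℝ (EuclideanSpace ℝ (Fin (2 * n))))

/-- The isomorphism `y ↦ σ(·, y)` from the tangent space to its dual. -/
def SymplecticForm.toDual (σ : SymplecticForm n M) (m : M) :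
    TangentSpace (𝓡 (2 * n)) m ≃ₗ[ℝ] Module.Dual ℝ (TangentSpace (𝓡 (2 * n)) m) :=
  LinearMap.linearEquivOfInjective (σ.bilin m).flip
    (by
      rw [← LinearMap.ker_eq_bot, LinearMap.ker_eq_bot']
      intro y hy
      exact σ.nondegenerate m y fun x => by simpa using LinearMap.congr_fun hy x)
    Subspace.dual_finrank_eq.symm

/-- The isomorphism `J` from the cotangent space to the tangent space at `m`. -/
def SymplecticForm.J (σ : SymplecticForm n M) (m : M) :
    Module.Dual ℝ (TangentSpace (𝓡 (2 * n)) m) ≃ₗ[ℝ] TangentSpace (𝓡 (2 * n)) m :=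
  (σ.toDual m).symm

/-- `J` is characterised by `σ(x, J a) = a(x)`. -/
theorem SymplecticForm.bilin_J (σ : SymplecticForm n M) (m : M)
    (a : Module.Dual ℝ (TangentSpace (𝓡 (2 * n)) m)) (x : TangentSpace (𝓡 (2 * n)) m) :
    σ.bilin m x (σ.J m a) = a x :=
  LinearMap.congr_fun ((σ.toDual m).apply_symm_apply a) x

/-- The differential of a function at `m`. -/
def differential (F : M → ℝ) (m : M) : Module.Dual ℝ (TangentSpace (𝓡 (2 * n)) m) :=
  (mvfderiv (𝓡 (2 * n)) F m : TangentSpace (𝓡 (2 * n)) m →L[ℝ] ℝ)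

/-- The Hamiltonian vector field `J dF`. -/
def SymplecticForm.hamiltonianField (σ : SymplecticForm n M) (F : M → ℝ) (m : M) :
    TangentSpace (𝓡 (2 * n)) m :=
  σ.J m (differential F m)

/-- The Poisson bracket `[F, G] = σ(J dF, J dG)`. -/
def SymplecticForm.poisson (σ : SymplecticForm n M) (F G : M → ℝ) (m : M) : ℝ :=
  σ.bilin m (σ.hamiltonianField F m) (σ.hamiltonianField G m)

/-- `g t m` (`t` any real number) is the global phase flow of the Hamiltonian system with
Hamilton function `F`. -/
structure SymplecticForm.IsHamiltonianFlow (σ : SymplecticForm n M) (F : M → ℝ)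
    (g : ℝ → M → M) : Prop where
  smooth : ContMDiff (𝓘(ℝ, ℝ).prod (𝓡 (2 * n))) (𝓡 (2 * n)) ∞ fun p : ℝ × M => g p.1 p.2
  zero : ∀ m, g 0 m = m
  integralCurve : ∀ m, IsMIntegralCurve (I := 𝓡 (2 * n)) (fun t => g t m) (σ.hamiltonianField F)

/-- The action `g₁^{t₁} ∘ ⋯ ∘ g_k^{t_k}` of a vector `t` of times. -/
def multiFlow (g : Fin k → ℝ → M → M) (t : Fin k → ℝ) : M → M :=
  (List.ofFn fun j => g j (t j)).foldr (fun f h => f ∘ h) id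

/-! ### Tori -/

/-- The torus `S¹ × ⋯ × S¹` (`k` factors). -/
abbrev Torus (k : ℕ) : Type := Fin k → Circle

/-- The model with corners of the product manifold `S¹ × ⋯ × S¹`. -/
abbrev torusModel (k : ℕ) :
    ModelWithCorners ℝ (Fin k → EuclideanSpace ℝ (Fin 1))
      (ModelPi fun _ : Fin k => EuclideanSpace ℝ (Fin 1)) :=
  ModelWithCorners.pi fun _ : Fin k => 𝓡 1

/-- The tangent space, at the point `ι θ`, of the torus embedded in `M` by `ι`. -/
def torusTangent (ι : Torus k → M) (θ : Torus k) :
    Submodule ℝ (TangentSpace (𝓡 (2 * n)) (ι θ)) :=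
  LinearMap.range (mfderiv (torusModel k) (𝓡 (2 * n)) ι θ).toLinearMap

/-- The torus embedded by `ι` is isotropic. -/
def IsIsotropicTorus (σ : SymplecticForm n M) (ι : Torus k → M) : Prop :=
  ∀ θ, ∀ x ∈ torusTangent (n := n) ι θ, ∀ y ∈ torusTangent (n := n) ι θ, σ.bilin (ι θ) x y = 0

/-- The torus embedded by `ι` is invariant with respect to the Hamiltonian system of `F`: the
Hamiltonian vector field is tangent to it. -/
def IsInvariantTorus (σ : SymplecticForm n M) (F : M → ℝ) (ι : Torus k → M) : Prop :=
  ∀ θ, σ.hamiltonianField F (ι θ) ∈ torusTangent (n := n) ι θ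

/-! ### Monodromy -/

/-- The tangent space at `m` of the joint level set `Σ` of `F₁, …, F_k` through `m` (for functions
with independent differentials). -/
def levelTangent (F : Fin k → M → ℝ) (m : M) : Submodule ℝ (TangentSpace (𝓡 (2 * n)) m) :=
  ⨅ j, LinearMap.ker (differential (n := n) (F j) m)

/-- The vectors `T₁, …, T_k` are linearly independent generators of the period group
`{t ∈ ℝᵏ : g^t m = m}`. -/
structure IsPeriodBasis {N : Type*} (g : Fin k → ℝ → N → N) (m : N) (T : Fin k → Fin k → ℝ) : Prop where
  linearIndependent : LinearIndependent ℝ T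
  generates : (AddSubgroup.closure (range T) : Set (Fin k → ℝ)) = {t | multiFlow g t m = m}

theorem IsPeriodBasis.multiFlow_eq {N : Type*} {g : Fin k → ℝ → N → N} {m : N} {T : Fin k → Fin k → ℝ}
    (hT : IsPeriodBasis g m T) (j : Fin k) : multiFlow g (T j) m = m :=
  hT.generates.subset (AddSubgroup.subset_closure (mem_range_self j))

variable (n) in
/-- The identification of the tangent spaces at two equal points. -/
def tangentCast {m m' : M} (h : m' = m) :
    TangentSpace (𝓡 (2 * n)) m' →ₗ[ℝ] TangentSpace (𝓡 (2 * n)) m :=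
  h ▸ LinearMap.id

variable (n) in
/-- The monodromy operator of a period `t`: the derivative at `m` of the action of `t`, as an
endomorphism of the tangent space at `m`. -/
def monodromy (g : Fin k → ℝ → M → M) {m : M} (t : Fin k → ℝ) (ht : multiFlow g t m = m) :
    TangentSpace (𝓡 (2 * n)) m →ₗ[ℝ] TangentSpace (𝓡 (2 * n)) m :=
  tangentCast n ht ∘ₗ (mfderiv (𝓡 (2 * n)) (𝓡 (2 * n)) (multiFlow g t) m).toLinearMap

variable (n) in
/-- The quotient `Γ = T Σ / T Λ` at the point `ι θ` of the torus. -/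
abbrev ReducedSpace (F : Fin k → M → ℝ) (ι : Torus k → M) (θ : Torus k) : Type :=
  levelTangent (n := n) F (ι θ) ⧸
    (torusTangent (n := n) ι θ).submoduleOf (levelTangent (n := n) F (ι θ))

/-- `Ξ` is the operator induced on `Γ` by the endomorphism `G` of the tangent space:
`Ξ [v] = [G v]` for every `v ∈ T Σ` (in particular `G v ∈ T Σ`). -/
def IsReduction (F : Fin k → M → ℝ) (ι : Torus k → M) (θ : Torus k)
    (G : TangentSpace (𝓡 (2 * n)) (ι θ) →ₗ[ℝ] TangentSpace (𝓡 (2 * n)) (ι θ))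
    (Ξ : ReducedSpace n F ι θ →ₗ[ℝ] ReducedSpace n F ι θ) : Prop :=
  ∀ v : levelTangent (n := n) F (ι θ), ∃ w : levelTangent (n := n) F (ι θ),
    (w : TangentSpace (𝓡 (2 * n)) (ι θ)) = G v ∧
      Ξ (Submodule.Quotient.mk v) = Submodule.Quotient.mk w

/-- Stability of a linear operator: iterates of small vectors stay small. On a finite-dimensional
space all norms define the same topology, and this is the `ε`-`δ` condition for any of them. -/
def IsStable {V : Type*} [AddCommGroup V] [Module ℝ V] [TopologicalSpace V]
    (S : V →ₗ[ℝ] V) : Prop :=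
  ∀ U ∈ 𝓝 (0 : V), ∃ W ∈ 𝓝 (0 : V), ∀ x ∈ W, ∀ N : ℕ, 0 < N → (S ^ N) x ∈ U

/-! ### Complex germs -/

variable (n) in
/-- The complexification of the tangent space at `m`. -/
abbrev ComplexTangent (m : M) : Type := ℂ ⊗[ℝ] TangentSpace (𝓡 (2 * n)) m

/-- The vector `u + i v` of the complexified tangent space. -/
def complexVector {m : M} (u v : TangentSpace (𝓡 (2 * n)) m) : ComplexTangent n m :=
  (1 : ℂ) ⊗ₜ[ℝ] u + Complex.I ⊗ₜ[ℝ] v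

/-- The conjugation `u + i v ↦ u - i v`. -/
def conjugation (m : M) : ComplexTangent n m →ₗ[ℝ] ComplexTangent n m :=
  TensorProduct.map Complex.conjAe.toLinearMap LinearMap.id

/-- The complexified symplectic form `[·, ·]`. -/
def SymplecticForm.complexBilin (σ : SymplecticForm n M) (m : M) :
    LinearMap.BilinForm ℂ (ComplexTangent n m) :=
  LinearMap.BilinForm.baseChange ℂ (σ.bilin m)

/-- A field `r` of complex subspaces of the complexified tangent spaces of `M`, given at the points
of the torus embedded by `ι`, is smooth of rank `n`: near each point of the torus it is spanned by
`n` smooth complex vector fields `u j + i v j` along the torus. Values of `r` outside the torus play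
no role. -/
def IsSmoothAlong [IsManifold (𝓡 (2 * n)) ∞ M] (ι : Torus k → M) (r : ∀ m : M, Submodule ℂ (ComplexTangent n m)) : Prop :=
  ∀ θ₀ : Torus k, ∃ U ∈ 𝓝 θ₀, ∃ u v : Fin n → ∀ θ : Torus k, TangentSpace (𝓡 (2 * n)) (ι θ),
    (∀ j, ContMDiffOn (torusModel k) (𝓡 (2 * n)).tangent ∞
      (fun θ => (⟨ι θ, u j θ⟩ : TangentBundle (𝓡 (2 * n)) M)) U) ∧
    (∀ j, ContMDiffOn (torusModel k) (𝓡 (2 * n)).tangent ∞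
      (fun θ => (⟨ι θ, v j θ⟩ : TangentBundle (𝓡 (2 * n)) M)) U) ∧
    ∀ θ ∈ U, r (ι θ) = Submodule.span ℂ (range fun j => complexVector (u j θ) (v j θ))

open scoped ComplexOrder in
/-- `r` is a complex germ on the torus embedded by `ι`, invariant with respect to the flows
`g₁, …, g_k`. -/
structure IsComplexGerm [IsManifold (𝓡 (2 * n)) ∞ M] (σ : SymplecticForm n M) (ι : Torus k → M) (g : Fin k → ℝ → M → M)
    (r : ∀ m : M, Submodule ℂ (ComplexTangent n m)) : Prop where
  smooth : IsSmoothAlong ι r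
  finrank_eq : ∀ θ, Module.finrank ℂ (r (ι θ)) = n
  isotropic : ∀ θ, ∀ x ∈ r (ι θ), ∀ y ∈ r (ι θ), σ.complexBilin (ι θ) x y = 0
  tangent_le : ∀ θ, (torusTangent (n := n) ι θ).baseChange ℂ ≤ r (ι θ)
  dissipative : ∀ θ, ∀ x ∈ r (ι θ), x ∉ (torusTangent (n := n) ι θ).baseChange ℂ →
    0 < 1 / (2 * Complex.I) * σ.complexBilin (ι θ) x (conjugation (ι θ) x)
  invariant : ∀ θ j t,
    (r (ι θ)).map
        ((mfderiv (𝓡 (2 * n)) (𝓡 (2 * n)) (g j t) (ι θ)).toLinearMap.baseChange ℂ) =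
      r (g j t (ι θ))

end ComplexGerm

end

open Set Topology Manifold
open scoped ContDiff TensorProduct

noncomputable section

namespace ComplexGerm

variable {n k : ℕ} {M : Type*} [TopologicalSpace M]
  [ChartedSpace (EuclideanSpace ℝ (Fin (2 * n))) M]

/-! ### Invariant compatible complex structures -/

section LinearAlgebra

open Module

/-! The germ is built at one point of the torus and carried to the other points by the flows.

Involution makes the flows commute, so together they form a symplectic action of `ℝᵏ` that preserves
every Hamiltonian field (`isHamiltonianAction_multiFlow`). These fields are k independent tangent
vectors of a k-dimensional torus, hence span TΛ. Flow boxes (`exists_flowBox`) then show that the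
torus is locally an orbit, and connectedness makes it one orbit. The periods are discrete because
the action is locally free, and they span `ℝᵏ` because the orbit is compact; so they form a lattice
of full rank.

Since ω(v, J dF_j) = dF_j(v), the space TΣ is the symplectic complement of TΛ. Hence Γ = TΣ/TΛ is
symplectic, and the reduced monodromies are commuting symplectic operators on it. Stability bounds
their powers from above, and symplecticity then bounds them from below, so averaging a scalar
product over the powers of one operator after another yields a common invariant scalar product. The
polar decomposition of the operator that represents ω in this scalar product gives a complex
structure `J` on Γ that commutes with all Ξ_j and satisfies ω(x, Jx) > 0 for x ≠ 0
(`exists_complexStructure`).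

The vectors of (TΣ)^ℂ whose class in Γ^ℂ has the form x - iJx, i.e. lies in the +i eigenspace of
`J`, form an n-dimensional isotropic subspace. It contains (TΛ)^ℂ, is positive outside it, and is
invariant under the generating monodromies (`exists_invariant_positiveSubspace`), hence under all
periods (`map_transport_eq_of_mem_closure`). Transport along the orbit is therefore independent of
the chosen time, and all conditions on a germ spread from the base point to the whole torus
(`exists_isComplexGerm`). -/

/-- The square root of a positive definite symmetric operator, as a polynomial in it. -/
theorem exists_aeval_sqrt {V : Type*} [NormedAddCommGroup V] [InnerProductSpace ℝ V]
    [FiniteDimensional ℝ V] (Q : V →ₗ[ℝ] V) (hQ : Q.IsSymmetric)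
    (hpos : ∀ x, x ≠ 0 → 0 < inner ℝ (Q x) x) :
    ∃ q : Polynomial ℝ, (Polynomial.aeval Q q) * (Polynomial.aeval Q q) = Q ∧
      (Polynomial.aeval Q q).IsSymmetric ∧
      ∀ x, x ≠ 0 → 0 < inner ℝ (Polynomial.aeval Q q x) x := by
  classical
  set d := finrank ℝ V
  let b := hQ.eigenvectorBasis rfl
  let μ := hQ.eigenvalues rfl
  have hb : ∀ i, Q (b i) = μ i • b i := fun i => hQ.apply_eigenvectorBasis rfl i
  have hμ : ∀ i, 0 < μ i := by
    intro i
    have := hpos (b i) (b.orthonormal.ne_zero i)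
    rw [hb, real_inner_smul_left, real_inner_self_eq_norm_sq, b.orthonormal.norm_eq_one] at this
    simpa using this
  -- Interpolating the square root at the eigenvalues makes the root a polynomial in `Q`, so it
  -- commutes with every operator that commutes with `Q`.
  let s : Finset ℝ := Finset.univ.image μ
  let q : Polynomial ℝ := Lagrange.interpolate s id Real.sqrt
  have hq : ∀ i, q.eval (μ i) = √(μ i) := fun i =>
    Lagrange.eval_interpolate_at_node (v := id) Real.sqrt (Set.injOn_id _)
      (Finset.mem_image_of_mem μ (Finset.mem_univ i))
  have hP : ∀ i, Polynomial.aeval Q q (b i) = √(μ i) • b i := by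
    intro i
    have : Module.End.HasEigenvector Q (μ i) (b i) :=
      ⟨Module.End.mem_eigenspace_iff.2 (hb i), b.orthonormal.ne_zero i⟩
    rw [Module.End.aeval_apply_of_hasEigenvector this, hq]
  have hsym : (Polynomial.aeval Q q).IsSymmetric := by
    intro x y
    rw [← b.sum_repr x, ← b.sum_repr y]
    simp only [map_sum, map_smul, hP, sum_inner, inner_sum, real_inner_smul_left,
      real_inner_smul_right, b.inner_eq_ite]
    refine Finset.sum_congr rfl fun i _ => Finset.sum_congr rfl fun j _ => ?_
    rcases eq_or_ne i j with h | h
    · subst h; simp only [if_true]; ring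
    · simp [h.symm]
  refine ⟨q, ?_, hsym, ?_⟩
  · refine b.toBasis.ext fun i => ?_
    simp only [OrthonormalBasis.coe_toBasis, Module.End.mul_apply, hP, map_smul, smul_smul,
      Real.mul_self_sqrt (hμ i).le, hb]
  · intro x hx
    have hsum : inner ℝ (Polynomial.aeval Q q x) x = ∑ i, √(μ i) * (b.repr x i) ^ 2 := by
      conv_lhs => rw [← b.sum_repr x]
      simp only [map_sum, map_smul, hP, sum_inner, inner_sum, real_inner_smul_left,
        real_inner_smul_right, b.inner_eq_ite]
      refine Finset.sum_congr rfl fun i _ => ?_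
      simp; ring
    rw [hsum]
    obtain ⟨i, hi⟩ : ∃ i, b.repr x i ≠ 0 := by
      by_contra! h
      exact hx (by rw [← b.sum_repr x]; simp [h])
    refine Finset.sum_pos' (fun j _ => by positivity) ⟨i, Finset.mem_univ i, ?_⟩
    have := Real.sqrt_pos.2 (hμ i)
    positivity

/-- Polar decomposition: if `A` is the skew operator with ⟨Ax, y⟩ = σ(x, y), then J = A(-A²)^(-1/2).
Each `S i` preserves both forms, hence commutes with `A` and with the root `P` of -A², hence with
`J`. Positivity reduces to that of `P`, since σ(Pa, Aa) = ⟨P(Aa), Aa⟩. -/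
theorem exists_complexStructure_of_inner {V : Type*} [NormedAddCommGroup V]
    [InnerProductSpace ℝ V] [FiniteDimensional ℝ V] (σ : LinearMap.BilinForm ℝ V)
    (halt : ∀ x, σ x x = 0) (hnd : ∀ x, (∀ y, σ x y = 0) → x = 0) {κ : Type*}
    (S : κ → V →ₗ[ℝ] V) (hω : ∀ i x y, σ (S i x) (S i y) = σ x y)
    (hS : ∀ i x y, (inner ℝ (S i x) (S i y) : ℝ) = inner ℝ x y) :
    ∃ J : V →ₗ[ℝ] V, (∀ x, J (J x) = -x) ∧ (∀ x y, σ (J x) (J y) = σ x y) ∧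
      (∀ x, x ≠ 0 → 0 < σ x (J x)) ∧ ∀ i x, J (S i x) = S i (J x) := by
  have hskew : ∀ x y, σ x y = -σ y x := by
    intro x y
    have := halt (x + y)
    simp only [map_add, LinearMap.add_apply, halt, zero_add, add_zero] at this
    linarith
  obtain ⟨A, hA⟩ : ∃ A : V →ₗ[ℝ] V, ∀ x y, inner ℝ (A x) y = σ x y := by
    refine ⟨(InnerProductSpace.toDual ℝ V).symm.toLinearEquiv.toLinearMap ∘ₗ
      LinearMap.toContinuousLinearMap.toLinearMap ∘ₗ σ, fun x y => ?_⟩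
    simp
  have hAskew : ∀ x y, (inner ℝ (A x) y : ℝ) = -inner ℝ x (A y) := by
    intro x y
    rw [real_inner_comm (A y) x, hA, hA, hskew]
  have hAinj : ∀ x, A x = 0 → x = 0 := fun x hx => hnd x fun y => by rw [← hA, hx, inner_zero_left]
  have hSsurj : ∀ i, Function.Surjective (S i) := by
    intro i
    refine LinearMap.surjective_of_injective ((injective_iff_map_eq_zero _).2 fun x hx => ?_)
    rw [← inner_self_eq_zero (𝕜 := ℝ), ← hS i, hx, inner_zero_left]
  have hAS : ∀ i, Commute A (S i) := by
    intro i
    ext x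
    refine ext_inner_right ℝ fun y => ?_
    obtain ⟨z, rfl⟩ := hSsurj i y
    simp only [Module.End.mul_apply]
    rw [hA, hω, hS, hA]
  set Q : V →ₗ[ℝ] V := -(A * A) with hQdef
  have hQA : ∀ x y, (inner ℝ (Q x) y : ℝ) = inner ℝ (A x) (A y) := by
    intro x y
    simp only [hQdef, LinearMap.neg_apply, Module.End.mul_apply, inner_neg_left]
    rw [hAskew, neg_neg]
  have hQsym : Q.IsSymmetric := by
    intro x y
    rw [hQA, real_inner_comm, ← hQA, real_inner_comm]
  have hQpos : ∀ x, x ≠ 0 → 0 < inner ℝ (Q x) x := by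
    intro x hx
    rw [hQA]
    exact real_inner_self_pos.2 fun h => hx (hAinj x h)
  obtain ⟨q, hq, hPsym, hPpos⟩ := exists_aeval_sqrt Q hQsym hQpos
  set P := Polynomial.aeval Q q
  have hPinj : ∀ x, P x = 0 → x = 0 := by
    intro x hx
    by_contra h
    have := hPpos x h
    rw [hx, inner_zero_left] at this
    exact this.false
  let e : V ≃ₗ[ℝ] V := LinearEquiv.ofInjectiveEndo P ((injective_iff_map_eq_zero _).2 hPinj)
  have he : ∀ x, P (e.symm x) = x := fun x => e.apply_symm_apply x
  have hcommP : ∀ T : V →ₗ[ℝ] V, Commute A T → Commute P T := by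
    intro T hT
    have hQT : Commute Q T := (hT.mul_left hT).neg_left
    exact Algebra.commute_of_mem_adjoin_singleton_of_commute (Polynomial.aeval_mem_adjoin_singleton ℝ Q) hQT.symm |>.symm
  have hcomme : ∀ T : V →ₗ[ℝ] V, Commute A T → ∀ x, e.symm (T x) = T (e.symm x) := by
    intro T hT x
    rw [LinearEquiv.symm_apply_eq]
    change T x = P (T (e.symm x))
    have := LinearMap.congr_fun (hcommP T hT) (e.symm x)
    simp only [Module.End.mul_apply] at this
    rw [this, he]
  have hPP : ∀ x, P (P x) = -A (A x) := fun x => LinearMap.congr_fun hq x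
  have hAA : ∀ x, A (A (e.symm (e.symm x))) = -x := by
    intro x
    rw [← neg_eq_iff_eq_neg.2 (hPP (e.symm (e.symm x))).symm.symm, he, he]
  have hJJ : ∀ x, A (e.symm (A (e.symm x))) = -x := by
    intro x
    rw [hcomme A (Commute.refl A), hAA]
  have hAP : ∀ x, A (P x) = P (A x) := fun x =>
    (LinearMap.congr_fun (hcommP A (Commute.refl A)) x).symm
  refine ⟨A ∘ₗ e.symm.toLinearMap, hJJ, fun x y => ?_, fun x hx => ?_, fun i x => ?_⟩
  · obtain ⟨a, rfl⟩ := e.surjective x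
    obtain ⟨b, rfl⟩ := e.surjective y
    simp only [LinearMap.comp_apply, LinearEquiv.coe_coe, LinearEquiv.symm_apply_apply]
    change σ (A a) (A b) = σ (P a) (P b)
    rw [← hA, ← hA, hAP, hPsym, hPP, inner_neg_right, hAskew (A a), hAskew a]
  · obtain ⟨a, rfl⟩ := e.surjective x
    simp only [LinearMap.comp_apply, LinearEquiv.coe_coe, LinearEquiv.symm_apply_apply]
    change 0 < σ (P a) (A a)
    rw [← hA, hAP]
    exact hPpos _ fun h => hx (by rw [hAinj a h, map_zero])
  · simp only [LinearMap.comp_apply, LinearEquiv.coe_coe]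
    rw [hcomme _ (hAS i)]
    exact LinearMap.congr_fun (hAS i) (e.symm x)

/-- Averaging a positive definite form over the powers of an operator. -/
theorem exists_form_invariant_step {V : Type*} [NormedAddCommGroup V] [InnerProductSpace ℝ V]
    [FiniteDimensional ℝ V] (S : V →L[ℝ] V)
    (hC : ∃ C, ∀ (N : ℕ) x, ‖(S ^ N) x‖ ≤ C * ‖x‖)
    (hc : ∃ c > 0, ∀ (N : ℕ) x, c * ‖x‖ ≤ ‖(S ^ N) x‖)
    (B : V →L[ℝ] V →L[ℝ] ℝ) (hsym : ∀ x y, B x y = B y x)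
    (hpos : ∃ c > 0, ∀ x, c * ‖x‖ ^ 2 ≤ B x x) :
    ∃ B' : V →L[ℝ] V →L[ℝ] ℝ, (∀ x y, B' x y = B' y x) ∧
      (∃ c > 0, ∀ x, c * ‖x‖ ^ 2 ≤ B' x x) ∧ (∀ x y, B' (S x) (S y) = B' x y) ∧
      ∀ T : V →L[ℝ] V, Commute T S → (∀ x y, B (T x) (T y) = B x y) →
        ∀ x y, B' (T x) (T y) = B' x y := by
  obtain ⟨C, hC⟩ := hC
  obtain ⟨c, hc0, hc⟩ := hc
  obtain ⟨b, hb0, hb⟩ := hpos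
  -- Cesàro means of the pull-backs of `B` under the powers of `S`. They stay bounded in a
  -- finite-dimensional space of forms, so a convergent subsequence exists, and that is enough.
  let A : ℕ → V →L[ℝ] V →L[ℝ] ℝ := fun N =>
    ((N : ℝ) + 1)⁻¹ • ∑ i ∈ Finset.range (N + 1), B.bilinearComp (S ^ i) (S ^ i)
  have hA : ∀ N x y, A N x y =
      ((N : ℝ) + 1)⁻¹ * ∑ i ∈ Finset.range (N + 1), B ((S ^ i) x) ((S ^ i) y) := by
    intro N x y
    simp [A]
  have hBle : ∀ i x y, |B ((S ^ i) x) ((S ^ i) y)| ≤ ‖B‖ * C ^ 2 * ‖x‖ * ‖y‖ := by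
    intro i x y
    have h1 := B.le_opNorm₂ ((S ^ i) x) ((S ^ i) y)
    have h2 : ‖B‖ * ‖(S ^ i) x‖ * ‖(S ^ i) y‖ ≤ ‖B‖ * (C * ‖x‖) * (C * ‖y‖) := by
      have := hC i x
      have := hC i y
      have h0 : 0 ≤ C * ‖x‖ := (norm_nonneg _).trans (hC i x)
      gcongr
    calc _ ≤ _ := h1
      _ ≤ _ := h2
      _ = _ := by ring
  have hAnorm : ∀ N, ‖A N‖ ≤ ‖B‖ * C ^ 2 := by
    intro N
    refine ContinuousLinearMap.opNorm_le_bound₂ _ (by positivity) fun x y => ?_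
    rw [hA, Real.norm_eq_abs, abs_mul, abs_of_pos (by positivity : (0 : ℝ) < ((N : ℝ) + 1)⁻¹),
      inv_mul_le_iff₀ (by positivity)]
    refine (Finset.abs_sum_le_sum_abs _ _).trans ?_
    refine (Finset.sum_le_card_nsmul _ _ _ fun i _ => hBle i x y).trans ?_
    simp [nsmul_eq_mul]
  have : ProperSpace (V →L[ℝ] V →L[ℝ] ℝ) :=
    FiniteDimensional.proper ℝ (V →L[ℝ] V →L[ℝ] ℝ)
  obtain ⟨B', -, φ, hφ, hlim⟩ := tendsto_subseq_of_bounded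
    (Metric.isBounded_closedBall (x := (0 : V →L[ℝ] V →L[ℝ] ℝ)) (r := ‖B‖ * C ^ 2))
    (x := A) fun N => (dist_zero_right (A N)).le.trans (hAnorm N)
  have hlim' : ∀ x y, Filter.Tendsto (fun N => A (φ N) x y) Filter.atTop (𝓝 (B' x y)) := by
    intro x y
    have : Continuous fun D : V →L[ℝ] V →L[ℝ] ℝ => D x y := by fun_prop
    exact (this.tendsto B').comp hlim
  refine ⟨B', ?_, ⟨b * c ^ 2, by positivity, ?_⟩, ?_, ?_⟩
  · intro x y
    refine tendsto_nhds_unique (hlim' x y) ((hlim' y x).congr fun N => ?_)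
    rw [hA, hA]
    simp only [hsym ((S ^ _) y)]
  · intro x
    refine ge_of_tendsto' (hlim' x x) fun N => ?_
    rw [hA, le_inv_mul_iff₀ (by positivity)]
    have : ∀ i ∈ Finset.range (φ N + 1), b * c ^ 2 * ‖x‖ ^ 2 ≤ B ((S ^ i) x) ((S ^ i) x) := by
      intro i _
      refine le_trans ?_ (hb _)
      have := hc i x
      calc b * c ^ 2 * ‖x‖ ^ 2 = b * (c * ‖x‖) ^ 2 := by ring
        _ ≤ _ := by gcongr
    refine le_trans ?_ (Finset.card_nsmul_le_sum _ _ _ this)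
    simp [nsmul_eq_mul]
  · intro x y
    -- The sum telescopes: applying `S` changes the mean by two boundary terms only, which are
    -- O(1/N).
    have hdiff : ∀ N, A N (S x) (S y) - A N x y =
        ((N : ℝ) + 1)⁻¹ * (B ((S ^ (N + 1)) x) ((S ^ (N + 1)) y) - B x y) := by
      intro N
      rw [hA, hA, ← mul_sub, ← Finset.sum_sub_distrib]
      congr 1
      have := Finset.sum_range_sub (fun i => B ((S ^ i) x) ((S ^ i) y)) (N + 1)
      simp only [pow_zero, one_apply_eq_self] at this
      rw [← this]
      refine Finset.sum_congr rfl fun i _ => ?_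
      simp only [pow_succ, mul_apply_eq_comp]
    have h0 : Filter.Tendsto (fun N : ℕ => A N (S x) (S y) - A N x y) Filter.atTop (𝓝 0) := by
      refine squeeze_zero_norm (a := fun N : ℕ => ((N : ℝ) + 1)⁻¹ *
        (‖B‖ * C ^ 2 * ‖x‖ * ‖y‖ + |B x y|)) (fun N => ?_) ?_
      · rw [hdiff, norm_mul, Real.norm_eq_abs, Real.norm_eq_abs,
          abs_of_pos (by positivity : (0 : ℝ) < ((N : ℝ) + 1)⁻¹)]
        gcongr
        exact (abs_sub _ _).trans (by gcongr; exact hBle _ x y)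
      · have := (tendsto_one_div_add_atTop_nhds_zero_nat (𝕜 := ℝ)).mul_const
          (‖B‖ * C ^ 2 * ‖x‖ * ‖y‖ + |B x y|)
        simpa using this
    have h1 := ((hlim' (S x) (S y)).sub (hlim' x y))
    have h2 := tendsto_nhds_unique h1 (h0.comp hφ.tendsto_atTop)
    exact sub_eq_zero.1 h2
  -- `T` moves past the powers of `S`, so every term of the mean is already invariant under `T`;
  -- this is what lets the averagings be done successively.
  · intro T hT hBT x y
    refine tendsto_nhds_unique (hlim' (T x) (T y)) ((hlim' x y).congr fun N => ?_)
    rw [hA, hA]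
    congr 1
    refine Finset.sum_congr rfl fun i _ => ?_
    have h := fun z => DFunLike.congr_fun (hT.pow_right i) z
    simp only [mul_apply_eq_comp] at h
    rw [← h x, ← h y, hBT]

/-- The operators are averaged over one at a time, starting from the scalar product. Commutativity
ensures that a later averaging keeps the invariance gained earlier. -/
theorem exists_form_invariant {V : Type*} [NormedAddCommGroup V] [InnerProductSpace ℝ V]
    [FiniteDimensional ℝ V] {κ : Type*} [Finite κ] (S : κ → V →L[ℝ] V)
    (hcomm : ∀ i j, Commute (S i) (S j))
    (hC : ∀ i, ∃ C, ∀ (N : ℕ) x, ‖(S i ^ N) x‖ ≤ C * ‖x‖)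
    (hc : ∀ i, ∃ c > 0, ∀ (N : ℕ) x, c * ‖x‖ ≤ ‖(S i ^ N) x‖) :
    ∃ B : V →L[ℝ] V →L[ℝ] ℝ, (∀ x y, B x y = B y x) ∧ (∃ c > 0, ∀ x, c * ‖x‖ ^ 2 ≤ B x x) ∧
      ∀ i x y, B (S i x) (S i y) = B x y := by
  classical
  cases nonempty_fintype κ
  suffices ∀ s : Finset κ, ∃ B : V →L[ℝ] V →L[ℝ] ℝ, (∀ x y, B x y = B y x) ∧
      (∃ c > 0, ∀ x, c * ‖x‖ ^ 2 ≤ B x x) ∧ ∀ i ∈ s, ∀ x y, B (S i x) (S i y) = B x y by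
    obtain ⟨B, h1, h2, h3⟩ := this Finset.univ
    exact ⟨B, h1, h2, fun i => h3 i (Finset.mem_univ i)⟩
  intro s
  induction s using Finset.induction_on with
  | empty =>
    refine ⟨innerSL ℝ, fun x y => real_inner_comm y x, ⟨1, one_pos, fun x => ?_⟩, by simp⟩
    rw [innerSL_apply_apply, real_inner_self_eq_norm_sq, one_mul]
  | insert i s his ih =>
    obtain ⟨B, h1, h2, h3⟩ := ih
    obtain ⟨B', h1', h2', h3', h4'⟩ := exists_form_invariant_step (S i) (hC i) (hc i) B h1 h2
    refine ⟨B', h1', h2', fun j hj => ?_⟩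
    rcases Finset.mem_insert.1 hj with rfl | hj
    · exact h3'
    · exact h4' (S j) (hcomm j i) (h3 j hj)

/-- The compatible complex structure attached to a positive definite invariant form. -/
theorem exists_complexStructure_of_form {V : Type*} [AddCommGroup V] [Module ℝ V]
    [FiniteDimensional ℝ V] (σ B : LinearMap.BilinForm ℝ V)
    (halt : ∀ x, σ x x = 0) (hnd : ∀ x, (∀ y, σ x y = 0) → x = 0)
    (hsym : ∀ x y, B x y = B y x) (hpos : ∀ x, x ≠ 0 → 0 < B x x) {κ : Type*}
    (S : κ → V →ₗ[ℝ] V) (hω : ∀ i x y, σ (S i x) (S i y) = σ x y)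
    (hS : ∀ i x y, B (S i x) (S i y) = B x y) :
    ∃ J : V →ₗ[ℝ] V, (∀ x, J (J x) = -x) ∧ (∀ x y, σ (J x) (J y) = σ x y) ∧
      (∀ x, x ≠ 0 → 0 < σ x (J x)) ∧ ∀ i x, J (S i x) = S i (J x) := by
  let core : InnerProductSpace.Core ℝ V :=
    { inner := fun x y => B x y
      conj_inner_symm := fun x y => by simpa using hsym y x
      re_inner_nonneg := fun x => by
        rcases eq_or_ne x 0 with rfl | hx
        · simp
        · simpa using (hpos x hx).le
      add_left := fun x y z => by simp
      smul_left := fun x y r => by simp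
      definite := fun x hx => by
        by_contra h
        exact (hpos x h).ne' hx }
  let : NormedAddCommGroup V := core.toNormedAddCommGroup
  let : InnerProductSpace ℝ V := InnerProductSpace.ofCore core.toCore
  exact exists_complexStructure_of_inner σ halt hnd S hω hS

/-- Commuting stable symplectic operators have a common compatible complex structure. -/
theorem exists_complexStructure_of_bounded {V : Type*} [NormedAddCommGroup V]
    [InnerProductSpace ℝ V] [FiniteDimensional ℝ V] (σ : LinearMap.BilinForm ℝ V)
    (halt : ∀ x, σ x x = 0) (hnd : ∀ x, (∀ y, σ x y = 0) → x = 0)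
    {κ : Type*} [Finite κ] (S : κ → V →ₗ[ℝ] V) (hcomm : ∀ i j, Commute (S i) (S j))
    (hω : ∀ i x y, σ (S i x) (S i y) = σ x y)
    (hC : ∀ i, ∃ C > 0, ∀ (N : ℕ) x, ‖(S i ^ N) x‖ ≤ C * ‖x‖) :
    ∃ J : V →ₗ[ℝ] V, (∀ x, J (J x) = -x) ∧ (∀ x y, σ (J x) (J y) = σ x y) ∧
      (∀ x, x ≠ 0 → 0 < σ x (J x)) ∧ ∀ i x, J (S i x) = S i (J x) := by
  have hωN : ∀ i (N : ℕ) x y, σ ((S i ^ N) x) ((S i ^ N) y) = σ x y := by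
    intro i N
    induction N with
    | zero => simp
    | succ N ih => intro x y; rw [pow_succ', Module.End.mul_apply, Module.End.mul_apply, hω, ih]
  let Ω : V →L[ℝ] V →L[ℝ] ℝ := LinearMap.toContinuousLinearMap
    (LinearMap.toContinuousLinearMap.toLinearMap ∘ₗ σ)
  have hΩ : ∀ x y, Ω x y = σ x y := fun x y => rfl
  obtain ⟨c, hc0, hc⟩ : ∃ c > 0, ∀ x, c * ‖x‖ ≤ ‖Ω x‖ := by
    obtain ⟨K, hK, hK'⟩ := Ω.toLinearMap.exists_antilipschitzWith
      (LinearMap.ker_eq_bot'.2 fun x hx => hnd x fun y => by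
        rw [← hΩ]; exact DFunLike.congr_fun hx y)
    refine ⟨(K : ℝ)⁻¹, by positivity, fun x => ?_⟩
    rw [inv_mul_le_iff₀ (by positivity)]
    exact ZeroHomClass.bound_of_antilipschitz Ω.toLinearMap hK' x
  have hpow : ∀ i (N : ℕ) x, ((LinearMap.toContinuousLinearMap (S i)) ^ N) x = (S i ^ N) x := by
    intro i N x
    rw [FunLike.coe_pow_eq_iterate, Module.End.coe_pow]
    rfl
  obtain ⟨B, hB1, ⟨b, hb0, hb⟩, hB3⟩ := exists_form_invariant
    (fun i => LinearMap.toContinuousLinearMap (S i))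
    (fun i j => ContinuousLinearMap.ext fun x => LinearMap.congr_fun (hcomm i j) x)
    (fun i => by
      obtain ⟨C, -, hC⟩ := hC i
      exact ⟨C, fun N x => by rw [hpow]; exact hC N x⟩)
    (fun i => by
      obtain ⟨C, hC0, hC⟩ := hC i
      -- The lower bound comes from symplecticity: |σ(x, y)| = |σ(Sᴺx, Sᴺy)| ≤ ‖Ω‖ C ‖Sᴺx‖ ‖y‖,
      -- whereas ‖Ω x‖ ≥ c‖x‖ by nondegeneracy. The summand 1 keeps the denominator positive when Ω
      -- = 0, i.e. when the space is trivial.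
      refine ⟨c / (‖Ω‖ * C + 1), by positivity, fun N x => ?_⟩
      rw [hpow, div_mul_eq_mul_div, div_le_iff₀ (by positivity)]
      have h1 : ‖Ω x‖ ≤ ‖Ω‖ * ‖(S i ^ N) x‖ * C := by
        refine ContinuousLinearMap.opNorm_le_bound _ (by positivity) fun y => ?_
        rw [hΩ, ← hωN i N, ← hΩ, mul_assoc _ C]
        refine (Ω.le_opNorm₂ _ _).trans ?_
        gcongr
        exact hC N y
      nlinarith [hc x, norm_nonneg ((S i ^ N) x)])
  refine exists_complexStructure_of_form σ
    (ContinuousLinearMap.coeLM ℝ ∘ₗ B.toLinearMap) halt hnd hB1 (fun x hx => ?_) S hω hB3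
  have : 0 < ‖x‖ := norm_pos_iff.2 hx
  exact lt_of_lt_of_le (by positivity) (hb x)

/-- By homogeneity, the δ belonging to ε = 1 gives the bound 2/δ for all positive powers. The
additional 1 in the constant covers N = 0, about which stability says nothing. -/
theorem IsStable.exists_norm_pow_le {V : Type*} [NormedAddCommGroup V] [NormedSpace ℝ V]
    {S : V →ₗ[ℝ] V} (hS : IsStable S) : ∃ C > 0, ∀ (N : ℕ) x, ‖(S ^ N) x‖ ≤ C * ‖x‖ := by
  obtain ⟨W, hW, hWS⟩ := hS _ (Metric.ball_mem_nhds 0 one_pos)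
  obtain ⟨δ, hδ, hδW⟩ := Metric.mem_nhds_iff.1 hW
  refine ⟨2 / δ + 1, by positivity, fun N x => ?_⟩
  rcases Nat.eq_zero_or_pos N with rfl | hN
  · simp only [pow_zero, Module.End.one_apply]
    nlinarith [norm_nonneg x, div_pos two_pos hδ]
  rcases eq_or_ne x 0 with rfl | hx
  · simp
  have hx' : 0 < ‖x‖ := norm_pos_iff.2 hx
  have h := hWS ((δ / (2 * ‖x‖)) • x) (hδW (by
    rw [mem_ball_zero_iff, norm_smul, Real.norm_of_nonneg (by positivity)]
    field_simp
    linarith)) N hN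
  rw [map_smul, mem_ball_zero_iff, norm_smul, Real.norm_of_nonneg (by positivity),
    div_mul_eq_mul_div, div_lt_one (by positivity)] at h
  have : ‖(S ^ N) x‖ ≤ 2 / δ * ‖x‖ := by
    rw [div_mul_eq_mul_div, le_div_iff₀ hδ]
    linarith
  linarith

theorem IsStable.conj {V W : Type*} [AddCommGroup V] [Module ℝ V] [TopologicalSpace V]
    [AddCommGroup W] [Module ℝ W] [TopologicalSpace W] {S : V →ₗ[ℝ] V} (hS : IsStable S)
    (e : V ≃L[ℝ] W) : IsStable (e.toLinearEquiv.conj S) := by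
  intro U hU
  have hU' : e ⁻¹' U ∈ 𝓝 (0 : V) := e.continuous.continuousAt.preimage_mem_nhds (by simpa using hU)
  obtain ⟨X, hX, h⟩ := hS _ hU'
  refine ⟨e.symm ⁻¹' X, e.symm.continuous.continuousAt.preimage_mem_nhds (by simpa using hX),
    fun x hx N hN => ?_⟩
  have hpow : (e.toLinearEquiv.conj S) ^ N = e.toLinearEquiv.conj (S ^ N) := by
    induction N with
    | zero => ext; simp
    | succ N ih =>
      rcases Nat.eq_zero_or_pos N with rfl | hN'
      · simp
      · rw [pow_succ, ih hN', pow_succ, Module.End.mul_eq_comp, Module.End.mul_eq_comp,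
          LinearEquiv.conj_comp]
  rw [hpow, LinearEquiv.conj_apply_apply]
  exact h _ hx N hN

/-- Commuting stable symplectic operators have a common compatible complex structure. -/
theorem exists_complexStructure {V : Type*} [AddCommGroup V] [Module ℝ V] [TopologicalSpace V]
    [IsTopologicalAddGroup V] [ContinuousSMul ℝ V] [T2Space V] [FiniteDimensional ℝ V]
    (σ : LinearMap.BilinForm ℝ V)
    (halt : ∀ x, σ x x = 0) (hnd : ∀ x, (∀ y, σ x y = 0) → x = 0)
    {κ : Type*} [Finite κ] (S : κ → V →ₗ[ℝ] V) (hcomm : ∀ i j, Commute (S i) (S j))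
    (hω : ∀ i x y, σ (S i x) (S i y) = σ x y) (hS : ∀ i, IsStable (S i)) :
    ∃ J : V →ₗ[ℝ] V, (∀ x, J (J x) = -x) ∧ (∀ x y, σ (J x) (J y) = σ x y) ∧
      (∀ x, x ≠ 0 → 0 < σ x (J x)) ∧ ∀ i x, J (S i x) = S i (J x) := by
  -- The space to which this is applied is a quotient with only a topology; the norm estimates are
  -- made in Euclidean coordinates.
  let e : V ≃L[ℝ] EuclideanSpace ℝ (Fin (finrank ℝ V)) :=
    ContinuousLinearEquiv.ofFinrankEq (by simp)
  let f := e.toLinearEquiv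
  obtain ⟨J, h1, h2, h3, h4⟩ := exists_complexStructure_of_bounded
    (σ.compl₁₂ f.symm.toLinearMap f.symm.toLinearMap) (fun x => halt _)
    (fun x hx => f.symm.map_eq_zero_iff.1 (hnd _ fun y => by simpa using hx (f y)))
    (fun i => f.conj (S i)) (fun i j => by
      have := congrArg f.conj (hcomm i j).eq
      rw [Module.End.mul_eq_comp, Module.End.mul_eq_comp, LinearEquiv.conj_comp,
        LinearEquiv.conj_comp] at this
      exact this)
    (fun i x y => by simp [LinearEquiv.conj_apply_apply, hω])
    (fun i => ((hS i).conj e).exists_norm_pow_le)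
  refine ⟨f.symm.conj J, fun x => ?_, fun x y => ?_, fun x hx => ?_, fun i x => ?_⟩
  · simp [LinearEquiv.conj_apply_apply, h1]
  · simpa [LinearEquiv.conj_apply_apply] using h2 (f x) (f y)
  · simpa [LinearEquiv.conj_apply_apply] using h3 (f x) (by simpa using hx)
  · simpa [LinearEquiv.conj_apply_apply] using congrArg f.symm (h4 i (f x))

end LinearAlgebra

/-! ### Pull-backs of the symplectic form -/

section Pullback

variable {N : Type*} [NormedAddCommGroup N] [NormedSpace ℝ N]

/-- The pull-back of the symplectic form under a map from a normed space. -/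
def SymplecticForm.pullback (σ : SymplecticForm n M) (f : N → M) (z : N) : N [⋀^Fin 2]→L[ℝ] ℝ :=
  (σ.toForm (f z)).compContinuousLinearMap (mfderiv 𝓘(ℝ, N) (𝓡 (2 * n)) f z)

theorem SymplecticForm.pullback_apply (σ : SymplecticForm n M) (f : N → M) (z u v : N) :
    σ.pullback f z ![u, v] = σ.bilin (f z) (mfderiv 𝓘(ℝ, N) (𝓡 (2 * n)) f z u)
      (mfderiv 𝓘(ℝ, N) (𝓡 (2 * n)) f z v) := by
  rw [SymplecticForm.bilin_apply, SymplecticForm.pullback]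
  change σ.toForm (f z) _ = _
  congr 1
  ext i
  fin_cases i <;> rfl

/-- Smoothness and closedness of σ are known for its chart expressions only. Factoring `f` through
the chart centred at `f z₀` turns the pull-back from `M` into a pull-back between normed spaces. -/
theorem SymplecticForm.pullback_eventuallyEq [IsManifold (𝓡 (2 * n)) ∞ M] (σ : SymplecticForm n M) {f : N → M} {z₀ : N}
    (hf : ContMDiffAt 𝓘(ℝ, N) (𝓡 (2 * n)) 2 f z₀) :
    σ.pullback f =ᶠ[𝓝 z₀] fun z =>
      (chartForm σ.toForm (f z₀) (extChartAt (𝓡 (2 * n)) (f z₀) (f z))).compContinuousLinearMap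
        (fderiv ℝ (fun z => extChartAt (𝓡 (2 * n)) (f z₀) (f z)) z) := by
  have hd : ∀ᶠ z in 𝓝 z₀, ContMDiffAt 𝓘(ℝ, N) (𝓡 (2 * n)) 2 f z :=
    (contMDiffAt_iff_contMDiffAt_nhds (by decide)).1 hf
  have hs : ∀ᶠ z in 𝓝 z₀, f z ∈ (chartAt (EuclideanSpace ℝ (Fin (2 * n))) (f z₀)).source :=
    hf.continuousAt.preimage_mem_nhds (chart_source_mem_nhds _ _)
  filter_upwards [hd, hs, eventually_eventually_nhds.2 hs] with z hz hz' hz''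
  set φ := extChartAt (𝓡 (2 * n)) (f z₀) with hφ
  have hφs : f z ∈ φ.source := by rwa [hφ, extChartAt_source]
  have h1 : MDifferentiableAt 𝓘(ℝ, N) 𝓘(ℝ, EuclideanSpace ℝ (Fin (2 * n))) (fun z => φ (f z)) z :=
    (mdifferentiableAt_extChartAt hz').comp z (hz.mdifferentiableAt (by decide))
  have h2 : MDifferentiableAt 𝓘(ℝ, EuclideanSpace ℝ (Fin (2 * n))) (𝓡 (2 * n)) φ.symm (φ (f z)) := by
    exact ((contMDiffOn_extChartAt_symm (n := ∞) (f z₀)).contMDiffAt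
      ((isOpen_extChartAt_target _).mem_nhds (φ.map_source hφs))).mdifferentiableAt (by decide)
  have h3 : mfderiv 𝓘(ℝ, N) (𝓡 (2 * n)) f z =
      (mfderiv 𝓘(ℝ, EuclideanSpace ℝ (Fin (2 * n))) (𝓡 (2 * n)) φ.symm (φ (f z))) ∘L
        (mfderiv 𝓘(ℝ, N) 𝓘(ℝ, EuclideanSpace ℝ (Fin (2 * n))) (fun z => φ (f z)) z) := by
    rw [← mfderiv_comp z h2 h1]
    refine Filter.EventuallyEq.mfderiv_eq ?_
    filter_upwards [hz''] with w hw
    exact (φ.left_inv (by rwa [hφ, extChartAt_source])).symm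
  have h4 : mfderiv 𝓘(ℝ, N) 𝓘(ℝ, EuclideanSpace ℝ (Fin (2 * n))) (fun z => φ (f z)) z =
      fderiv ℝ (fun z => φ (f z)) z := mfderiv_eq_fderiv
  rw [h4] at h3
  -- All tangent spaces unfold to the model space. With this non-dependent type the base point can
  -- be rewritten along an equality; the same device recurs below.
  let τ : M → EuclideanSpace ℝ (Fin (2 * n)) [⋀^Fin 2]→L[ℝ] ℝ := σ.toForm
  have h5 : τ (φ.symm (φ (f z))) = τ (f z) := congrArg τ (φ.left_inv hφs)
  ext v
  refine Eq.trans ?_ (DFunLike.congr_fun h5 _).symm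
  change τ (f z) _ = τ (f z) _
  congr 1
  funext i
  exact DFunLike.congr_fun h3 (v i)

/-- The exterior derivative commutes with the pull-back under the local expression of `f`, so
closedness of the chart form is inherited. Second-order smoothness of `f` suffices. -/
theorem SymplecticForm.extDeriv_pullback [IsManifold (𝓡 (2 * n)) ∞ M] (σ : SymplecticForm n M) {f : N → M} {z₀ : N}
    (hf : ContMDiffAt 𝓘(ℝ, N) (𝓡 (2 * n)) 2 f z₀) :
    DifferentiableAt ℝ (σ.pullback f) z₀ ∧ extDeriv (σ.pullback f) z₀ = 0 := by
  have heq := σ.pullback_eventuallyEq hf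
  set h : N → EuclideanSpace ℝ (Fin (2 * n)) := fun z => extChartAt (𝓡 (2 * n)) (f z₀) (f z)
  have hh : ContDiffAt ℝ 2 h z₀ := by
    rw [← contMDiffAt_iff_contDiffAt]
    exact (contMDiffAt_extChartAt (I := 𝓡 (2 * n)) (n := 2) (x := f z₀)).comp z₀ hf
  have htgt : h z₀ ∈ (extChartAt (𝓡 (2 * n)) (f z₀)).target := mem_extChartAt_target _
  have hΩ : DifferentiableAt ℝ (chartForm σ.toForm (f z₀)) (h z₀) :=
    ((σ.smooth (f z₀)).contDiffAt ((isOpen_extChartAt_target _).mem_nhds htgt)).differentiableAt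
      (by decide)
  have hh' : DifferentiableAt ℝ (fderiv ℝ h) z₀ :=
    (hh.fderiv_right (m := 1) (by norm_num)).differentiableAt one_ne_zero
  constructor
  · refine DifferentiableAt.congr_of_eventuallyEq ?_ heq
    exact DifferentiableAt.continuousAlternatingMapCompContinuousLinearMap
      (DifferentiableAt.comp z₀ hΩ (hh.differentiableAt two_ne_zero)) hh'
  · rw [heq.extDeriv_eq, _root_.extDeriv_pullback hΩ hh (by simp), σ.closed _ _ htgt]
    rfl

end Pullback

/-! ### Hamiltonian flows -/

section Flow

namespace SymplecticForm.IsHamiltonianFlow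

variable {σ : SymplecticForm n M} {F : M → ℝ} {g : ℝ → M → M}

theorem contMDiff_map (hg : σ.IsHamiltonianFlow F g) (t : ℝ) :
    ContMDiff (𝓡 (2 * n)) (𝓡 (2 * n)) ∞ (g t) :=
  hg.smooth.comp (contMDiff_const.prodMk contMDiff_id)

theorem mfderiv_time (hg : σ.IsHamiltonianFlow F g) (m : M) (t : ℝ) :
    HasMFDerivAt 𝓘(ℝ, ℝ) (𝓡 (2 * n)) (fun t => g t m) t
      ((1 : ℝ →L[ℝ] ℝ).smulRight (σ.hamiltonianField F (g t m))) :=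
  hg.integralCurve m t

theorem mfderiv_uncurry (hg : σ.IsHamiltonianFlow F g) (t : ℝ) (m : M) (τ : ℝ)
    (u : TangentSpace (𝓡 (2 * n)) m) :
    mfderiv (𝓘(ℝ, ℝ).prod (𝓡 (2 * n))) (𝓡 (2 * n)) (fun p : ℝ × M => g p.1 p.2) (t, m) (τ, u) =
      τ • σ.hamiltonianField F (g t m) + mfderiv (𝓡 (2 * n)) (𝓡 (2 * n)) (g t) m u := by
  refine (mfderiv_prod_eq_add_apply (hg.smooth.mdifferentiableAt (by decide))).trans ?_
  change mfderiv 𝓘(ℝ, ℝ) (𝓡 (2 * n)) (fun t => g t m) t τ + _ = _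
  rw [(hg.mfderiv_time m t).mfderiv]
  rfl

/-- A function in involution with the Hamilton function is a first integral. -/
theorem comp_eq (hg : σ.IsHamiltonianFlow F g) {G : M → ℝ}
    (hG : ContMDiff (𝓡 (2 * n)) 𝓘(ℝ, ℝ) ∞ G) (hFG : ∀ m, σ.poisson F G m = 0) (t : ℝ) (m : M) :
    G (g t m) = G m := by
  have hd : ∀ s, HasDerivAt (fun s => G (g s m)) 0 s := by
    intro s
    have h1 := ((hG (g s m)).mdifferentiableAt (by decide)).hasMFDerivAt.comp s
      (hg.mfderiv_time m s)
    have h2 : differential G (g s m) (σ.hamiltonianField F (g s m)) = 0 := by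
      rw [← σ.bilin_J]
      exact hFG _
    convert! (hasMFDerivAt_iff_hasFDerivAt.1 h1).hasDerivAt using 1
    refine (Eq.trans ?_ h2).symm
    change mfderiv (𝓡 (2 * n)) 𝓘(ℝ, ℝ) G (g s m) ((1 : ℝ) • σ.hamiltonianField F (g s m)) = _
    rw [one_smul]
    rfl
  have := is_const_of_deriv_eq_zero (fun s => (hd s).differentiableAt) (fun s => (hd s).deriv) t 0
  rw [hg.zero] at this
  exact this

variable [IsManifold (𝓡 (2 * n)) ∞ M]

/-- The field at m is the tangent map of (t, m) ↦ g_t m applied to the vector (∂_t, 0) at time 0, so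
it inherits smoothness from the flow. Uniqueness of integral curves needs this. -/
theorem contMDiff_field (hg : σ.IsHamiltonianFlow F g) :
    ContMDiff (𝓡 (2 * n)) (𝓡 (2 * n)).tangent ∞
      (fun m => (⟨m, σ.hamiltonianField F m⟩ : TangentBundle (𝓡 (2 * n)) M)) := by
  have h1 := hg.smooth.contMDiff_tangentMap (m := ∞) (by decide)
  have h2 : ContMDiff (𝓡 (2 * n)) ((𝓘(ℝ, ℝ).prod (𝓡 (2 * n))).tangent) ∞
      (fun m : M => (equivTangentBundleProd 𝓘(ℝ, ℝ) ℝ (𝓡 (2 * n)) M).symm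
        ((⟨0, 1⟩ : TangentBundle 𝓘(ℝ, ℝ) ℝ), (⟨m, 0⟩ : TangentBundle (𝓡 (2 * n)) M))) :=
    contMDiff_equivTangentBundleProd_symm.comp (contMDiff_const.prodMk
      (Bundle.contMDiff_zeroSection ℝ (TangentSpace (𝓡 (2 * n)) : M → Type _)))
  refine (h1.comp h2).congr fun m => ?_
  have h3 : (⟨g 0 m, σ.hamiltonianField F (g 0 m)⟩ : TangentBundle (𝓡 (2 * n)) M) =
      ⟨m, σ.hamiltonianField F m⟩ :=
    congrArg (fun m => (⟨m, σ.hamiltonianField F m⟩ : TangentBundle (𝓡 (2 * n)) M)) (hg.zero m)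
  rw [← h3]
  change _ = (⟨g 0 m, mfderiv (𝓘(ℝ, ℝ).prod (𝓡 (2 * n))) (𝓡 (2 * n))
    (fun p : ℝ × M => g p.1 p.2) (0, m) ((1 : ℝ), (0 : TangentSpace (𝓡 (2 * n)) m))⟩ :
      TangentBundle (𝓡 (2 * n)) M)
  rw [hg.mfderiv_uncurry, one_smul, map_zero, add_zero]

theorem eq_of_integralCurve [T2Space M] (hg : σ.IsHamiltonianFlow F g) {γ : ℝ → M}
    (hγ : IsMIntegralCurve (I := 𝓡 (2 * n)) γ (σ.hamiltonianField F)) (t : ℝ) :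
    γ t = g t (γ 0) := by
  have := isMIntegralCurve_Ioo_eq_of_contMDiff_boundaryless (t₀ := 0)
    (hg.contMDiff_field.of_le (by decide)) hγ (hg.integralCurve (γ 0)) (hg.zero _).symm
  exact congrFun this t

/-- The group law is not part of the notion of flow used here; it follows from uniqueness of
integral curves, which is where the Hausdorff property enters. -/
theorem add [T2Space M] (hg : σ.IsHamiltonianFlow F g) (s t : ℝ) (m : M) :
    g (s + t) m = g s (g t m) := by
  have := hg.eq_of_integralCurve ((hg.integralCurve m).comp_add t) s
  simpa using this

end SymplecticForm.IsHamiltonianFlow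
end Flow

theorem SymplecticForm.bilin_self (σ : SymplecticForm n M) (m : M)
    (x : TangentSpace (𝓡 (2 * n)) m) : σ.bilin m x x = 0 :=
  (σ.toForm m).map_eq_zero_of_eq ![x, x] (i := 0) (j := 1) rfl (by decide)

theorem SymplecticForm.bilin_swap (σ : SymplecticForm n M) (m : M)
    (x y : TangentSpace (𝓡 (2 * n)) m) : σ.bilin m x y = -σ.bilin m y x :=
  (LinearMap.IsAlt.neg (B := σ.bilin m) (σ.bilin_self m) y x).symm

theorem surjective_mfderiv_extChartAt_symm [IsManifold (𝓡 (2 * n)) ∞ M] (m : M) :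
    Function.Surjective (mfderiv 𝓘(ℝ, EuclideanSpace ℝ (Fin (2 * n))) (𝓡 (2 * n))
      (extChartAt (𝓡 (2 * n)) m).symm (extChartAt (𝓡 (2 * n)) m m)) := by
  have h := isInvertible_mfderivWithin_extChartAt_symm (I := 𝓡 (2 * n))
    (mem_extChartAt_target (I := 𝓡 (2 * n)) m)
  rw [ModelWithCorners.range_eq_univ, mfderivWithin_univ] at h
  exact h.surjective

/-! ### Symplecticity and commutation of the flows -/

namespace SymplecticForm.IsHamiltonianFlow

variable [IsManifold (𝓡 (2 * n)) ∞ M] {σ : SymplecticForm n M} {F : M → ℝ} {g : ℝ → M → M}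

/-- Reading the initial point in a chart makes the flow a map from a normed space, to which forms
can be pulled back and there differentiated in time. -/
theorem contMDiffAt_chart (hg : σ.IsHamiltonianFlow F g) (m : M) (s : ℝ)
    {y : EuclideanSpace ℝ (Fin (2 * n))} (hy : y ∈ (extChartAt (𝓡 (2 * n)) m).target) :
    ContMDiffAt 𝓘(ℝ, ℝ × EuclideanSpace ℝ (Fin (2 * n))) (𝓡 (2 * n)) ∞
      (fun p => g p.1 ((extChartAt (𝓡 (2 * n)) m).symm p.2)) (s, y) := by
  have h1 := (contMDiffOn_extChartAt_symm (I := 𝓡 (2 * n)) (n := ∞) m).contMDiffAt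
    ((isOpen_extChartAt_target _).mem_nhds hy)
  have h2 : ContMDiffAt 𝓘(ℝ, ℝ × EuclideanSpace ℝ (Fin (2 * n))) (𝓡 (2 * n)) ∞
      (fun p : ℝ × EuclideanSpace ℝ (Fin (2 * n)) => (extChartAt (𝓡 (2 * n)) m).symm p.2) (s, y) :=
    ContMDiffAt.comp (s, y) (by exact h1) contDiff_snd.contMDiff.contMDiffAt
  exact (hg.smooth.contMDiffAt (x := (s, (extChartAt (𝓡 (2 * n)) m).symm y))).comp (s, y)
    (ContMDiffAt.prodMk (contDiff_fst.contMDiff.contMDiffAt) h2)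

theorem mfderiv_chart_time (hg : σ.IsHamiltonianFlow F g) (m : M) (s : ℝ)
    {y : EuclideanSpace ℝ (Fin (2 * n))} (hy : y ∈ (extChartAt (𝓡 (2 * n)) m).target) :
    mfderiv 𝓘(ℝ, ℝ × EuclideanSpace ℝ (Fin (2 * n))) (𝓡 (2 * n))
      (fun p => g p.1 ((extChartAt (𝓡 (2 * n)) m).symm p.2)) (s, y)
      ((1 : ℝ), (0 : EuclideanSpace ℝ (Fin (2 * n)))) =
    σ.hamiltonianField F (g s ((extChartAt (𝓡 (2 * n)) m).symm y)) := by
  have h1 := ((hg.contMDiffAt_chart m s hy).mdifferentiableAt (by decide)).hasMFDerivAt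
  have h2 : HasFDerivAt (fun s : ℝ => (s, y))
      (ContinuousLinearMap.inl ℝ ℝ (EuclideanSpace ℝ (Fin (2 * n)))) s :=
    hasFDerivAt_prodMk_left s y
  have h3 := h1.comp s h2.hasMFDerivAt
  have h4 := hasMFDerivAt_unique h3 (hg.mfderiv_time ((extChartAt (𝓡 (2 * n)) m).symm y) s)
  have h5 := DFunLike.congr_fun h4 (1 : ℝ)
  refine h5.trans ?_
  exact one_smul ℝ _

theorem mfderiv_chart_space (hg : σ.IsHamiltonianFlow F g) (m : M) (s : ℝ)
    {y : EuclideanSpace ℝ (Fin (2 * n))} (hy : y ∈ (extChartAt (𝓡 (2 * n)) m).target)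
    (w : EuclideanSpace ℝ (Fin (2 * n))) :
    mfderiv 𝓘(ℝ, ℝ × EuclideanSpace ℝ (Fin (2 * n))) (𝓡 (2 * n))
      (fun p => g p.1 ((extChartAt (𝓡 (2 * n)) m).symm p.2)) (s, y) ((0 : ℝ), w) =
    mfderiv (𝓡 (2 * n)) (𝓡 (2 * n)) (g s) ((extChartAt (𝓡 (2 * n)) m).symm y)
      (mfderiv 𝓘(ℝ, EuclideanSpace ℝ (Fin (2 * n))) (𝓡 (2 * n))
        (extChartAt (𝓡 (2 * n)) m).symm y w) := by
  have h1 := ((hg.contMDiffAt_chart m s hy).mdifferentiableAt (by decide)).hasMFDerivAt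
  have h2 : HasFDerivAt (fun y : EuclideanSpace ℝ (Fin (2 * n)) => (s, y))
      (ContinuousLinearMap.inr ℝ ℝ (EuclideanSpace ℝ (Fin (2 * n)))) y :=
    hasFDerivAt_prodMk_right s y
  have h3 := h1.comp y h2.hasMFDerivAt
  have h6 := (((contMDiffOn_extChartAt_symm (I := 𝓡 (2 * n)) (n := ∞) m).contMDiffAt
    ((isOpen_extChartAt_target _).mem_nhds hy)).mdifferentiableAt (by decide)).hasMFDerivAt
  have h7 := ((hg.contMDiff_map s).mdifferentiableAt (by decide)
    (x := (extChartAt (𝓡 (2 * n)) m).symm y)).hasMFDerivAt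
  exact DFunLike.congr_fun (hasMFDerivAt_unique h3 (h7.comp y h6)) w

/-- The flow of a Hamiltonian system consists of symplectic maps. -/
theorem bilin_mfderiv (hg : σ.IsHamiltonianFlow F g) (hF : ContMDiff (𝓡 (2 * n)) 𝓘(ℝ, ℝ) ∞ F)
    (t : ℝ) (m : M) (u v : TangentSpace (𝓡 (2 * n)) m) :
    σ.bilin (g t m) (mfderiv (𝓡 (2 * n)) (𝓡 (2 * n)) (g t) m u)
      (mfderiv (𝓡 (2 * n)) (𝓡 (2 * n)) (g t) m v) = σ.bilin m u v := by
  set φ := extChartAt (𝓡 (2 * n)) m with hφ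
  set y := φ m with hy
  have hyt : y ∈ φ.target := mem_extChartAt_target m
  set f : ℝ × EuclideanSpace ℝ (Fin (2 * n)) → M := fun p => g p.1 (φ.symm p.2) with hf
  -- Cartan's argument in coordinates. Evaluate d(f*σ) = 0 on ∂_s, (0, a), (0, b). One term is the
  -- required time derivative. As f*σ(∂_s, ·) = -d(F ∘ f) on spatial vectors, the other two are
  -- second derivatives of F ∘ f in the directions a and b, which cancel by symmetry.
  have key : ∀ (a b : EuclideanSpace ℝ (Fin (2 * n))) (s : ℝ),
      HasDerivAt (fun s => σ.pullback f (s, y) ![(0, a), (0, b)]) 0 s := by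
    intro a b s
    have hfs : ContMDiffAt 𝓘(ℝ, ℝ × EuclideanSpace ℝ (Fin (2 * n))) (𝓡 (2 * n)) ∞ f (s, y) :=
      hg.contMDiffAt_chart m s hyt
    obtain ⟨hd, hclosed⟩ := σ.extDeriv_pullback (hfs.of_le (by decide))
    have hG : ContDiffAt ℝ ∞ (F ∘ f) (s, y) :=
      contMDiffAt_iff_contDiffAt.1 ((hF (f (s, y))).comp (s, y) hfs)
    have hmem : ∀ᶠ z : ℝ × EuclideanSpace ℝ (Fin (2 * n)) in 𝓝 (s, y), z.2 ∈ φ.target :=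
      continuousAt_snd.preimage_mem_nhds ((isOpen_extChartAt_target _).mem_nhds hyt)
    have hform : ∀ c : EuclideanSpace ℝ (Fin (2 * n)),
        (fun z => σ.pullback f z ![(1, 0), (0, c)]) =ᶠ[𝓝 (s, y)]
          fun z => -(fderiv ℝ (F ∘ f) z (0, c)) := by
      intro c
      filter_upwards [hmem] with z hz
      obtain ⟨z1, z2⟩ := z
      have hfz : ContMDiffAt 𝓘(ℝ, ℝ × EuclideanSpace ℝ (Fin (2 * n))) (𝓡 (2 * n)) ∞ f (z1, z2) :=
        hg.contMDiffAt_chart m z1 hz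
      rw [σ.pullback_apply, σ.bilin_swap]
      refine congrArg Neg.neg ?_
      have h1 : mfderiv 𝓘(ℝ, ℝ × EuclideanSpace ℝ (Fin (2 * n))) (𝓡 (2 * n)) f (z1, z2)
          ((1 : ℝ), (0 : EuclideanSpace ℝ (Fin (2 * n)))) = σ.hamiltonianField F (f (z1, z2)) :=
        hg.mfderiv_chart_time m z1 hz
      have h2 : mfderiv 𝓘(ℝ, ℝ × EuclideanSpace ℝ (Fin (2 * n))) 𝓘(ℝ, ℝ) (F ∘ f) (z1, z2) =
          fderiv ℝ (F ∘ f) (z1, z2) := mfderiv_eq_fderiv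
      rw [mfderiv_comp (z1, z2) ((hF _).mdifferentiableAt (by decide))
        (hfz.mdifferentiableAt (by decide))] at h2
      rw [← h2]
      refine (congrArg _ h1).trans ?_
      exact σ.bilin_J _ _ _
    have hsymm := (hG.of_le (m := 2) (by decide)).isSymmSndFDerivAt (by simp)
    have hG' : DifferentiableAt ℝ (fderiv ℝ (F ∘ f)) (s, y) :=
      ((hG.of_le (m := 2) (by decide)).fderiv_right (m := 1) (by norm_num)).differentiableAt
        one_ne_zero
    have hsnd : ∀ c c' : EuclideanSpace ℝ (Fin (2 * n)),
        fderiv ℝ (fun z => σ.pullback f z ![(1, 0), (0, c)]) (s, y) (0, c') =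
          -(fderiv ℝ (fderiv ℝ (F ∘ f)) (s, y) (0, c') (0, c)) := by
      intro c c'
      rw [(hform c).fderiv_eq, fderiv_fun_neg, fderiv_clm_apply hG' (by fun_prop)]
      simp
    have h0 : fderiv ℝ (fun z => σ.pullback f z ![(0, a), (0, b)]) (s, y) (1, 0) = 0 := by
      have h := extDeriv_apply hd ![((1 : ℝ), (0 : EuclideanSpace ℝ (Fin (2 * n)))), (0, a), (0, b)]
      rw [hclosed, Fin.sum_univ_three] at h
      have e0 : (0 : Fin 3).removeNth
          ![((1 : ℝ), (0 : EuclideanSpace ℝ (Fin (2 * n)))), (0, a), (0, b)] = ![(0, a), (0, b)] := by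
        ext i <;> fin_cases i <;> rfl
      have e1 : (1 : Fin 3).removeNth
          ![((1 : ℝ), (0 : EuclideanSpace ℝ (Fin (2 * n)))), (0, a), (0, b)] = ![(1, 0), (0, b)] := by
        ext i <;> fin_cases i <;> rfl
      have e2 : (2 : Fin 3).removeNth
          ![((1 : ℝ), (0 : EuclideanSpace ℝ (Fin (2 * n)))), (0, a), (0, b)] = ![(1, 0), (0, a)] := by
        ext i <;> fin_cases i <;> rfl
      simp only [e0, e1, e2, Matrix.cons_val_zero, Matrix.cons_val_one, Matrix.cons_val, hsnd] at h
      have hs := hsymm (0, a) (0, b)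
      rw [hs] at h
      simpa using h.symm
    have h1 := (hd.hasFDerivAt.continuousAlternatingMap_apply_const ![(0, a), (0, b)])
    have h2 := h1.comp_hasDerivAt s ((hasDerivAt_id s).prodMk (hasDerivAt_const s y))
    rw [h1.fderiv] at h0
    rw [h0] at h2
    exact h2
  have hconst : ∀ a b s, σ.pullback f (s, y) ![(0, a), (0, b)] =
      σ.pullback f (0, y) ![(0, a), (0, b)] := fun a b s =>
    is_const_of_deriv_eq_zero (fun s => (key a b s).differentiableAt) (fun s => (key a b s).deriv) s 0
  let Q : ℝ → M → EuclideanSpace ℝ (Fin (2 * n)) → EuclideanSpace ℝ (Fin (2 * n)) → ℝ :=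
    fun s m u v => σ.bilin (g s m) (mfderiv (𝓡 (2 * n)) (𝓡 (2 * n)) (g s) m u)
      (mfderiv (𝓡 (2 * n)) (𝓡 (2 * n)) (g s) m v)
  have hQ : ∀ (s : ℝ) (a b : EuclideanSpace ℝ (Fin (2 * n))),
      σ.pullback f (s, y) ![(0, a), (0, b)] =
      Q s (φ.symm y)
        (mfderiv 𝓘(ℝ, EuclideanSpace ℝ (Fin (2 * n))) (𝓡 (2 * n)) φ.symm y a)
        (mfderiv 𝓘(ℝ, EuclideanSpace ℝ (Fin (2 * n))) (𝓡 (2 * n)) φ.symm y b) := by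
    intro s a b
    rw [σ.pullback_apply]
    exact congrArg₂ (fun u v => σ.bilin (f (s, y)) u v) (hg.mfderiv_chart_space m s hyt a)
      (hg.mfderiv_chart_space m s hyt b)
  have hψ : φ.symm y = m := extChartAt_to_inv m
  have hQ0 : Q 0 m u v = σ.bilin m u v := by
    have : ∀ h : M → M, h = id → σ.bilin (h m) (mfderiv (𝓡 (2 * n)) (𝓡 (2 * n)) h m u)
        (mfderiv (𝓡 (2 * n)) (𝓡 (2 * n)) h m v) = σ.bilin m u v := by
      rintro _ rfl
      rw [mfderiv_id]
      rfl
    exact this (g 0) (funext hg.zero)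
  obtain ⟨a, ha⟩ := surjective_mfderiv_extChartAt_symm m u
  obtain ⟨b, hb⟩ := surjective_mfderiv_extChartAt_symm m v
  have hs : ∀ s, Q s m u v = σ.pullback f (s, y) ![(0, a), (0, b)] := by
    intro s
    refine ((hQ s a b).trans ?_).symm
    refine (congrArg₂ (fun u v => Q s (φ.symm y) u v) ha hb).trans ?_
    exact congrArg (fun m => Q s m u v) hψ
  change Q t m u v = _
  rw [← hQ0, hs, hs]
  exact hconst a b t

/-- A Hamiltonian flow preserves the Hamiltonian field of a first integral. -/
theorem mfderiv_hamiltonianField (hg : σ.IsHamiltonianFlow F g)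
    (hF : ContMDiff (𝓡 (2 * n)) 𝓘(ℝ, ℝ) ∞ F) {G : M → ℝ}
    (hG : ContMDiff (𝓡 (2 * n)) 𝓘(ℝ, ℝ) ∞ G) (hFG : ∀ m, σ.poisson F G m = 0) (t : ℝ) (m : M) :
    mfderiv (𝓡 (2 * n)) (𝓡 (2 * n)) (g t) m (σ.hamiltonianField G m) =
      σ.hamiltonianField G (g t m) := by
  have hdG : ∀ x, differential G (g t m) (mfderiv (𝓡 (2 * n)) (𝓡 (2 * n)) (g t) m x) =
      differential G m x := by
    intro x
    have h1 : G ∘ g t = G := funext fun m => hg.comp_eq hG hFG t m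
    have h2 := mfderiv_comp m ((hG (g t m)).mdifferentiableAt (by decide))
      ((hg.contMDiff_map t).mdifferentiableAt (by decide) (x := m))
    rw [h1] at h2
    exact (DFunLike.congr_fun h2 x).symm
  have hinj : Function.Injective (mfderiv (𝓡 (2 * n)) (𝓡 (2 * n)) (g t) m).toLinearMap := by
    refine (injective_iff_map_eq_zero _).2 fun x hx => ?_
    refine σ.nondegenerate m x fun y => ?_
    rw [← σ.bilin_apply, ← hg.bilin_mfderiv hF t]
    exact (congrArg _ hx).trans (map_zero _)
  have hsurj : Function.Surjective (mfderiv (𝓡 (2 * n)) (𝓡 (2 * n)) (g t) m).toLinearMap :=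
    (LinearMap.injective_iff_surjective_of_finrank_eq_finrank (by rfl)).1 hinj
  -- Test against nondegeneracy: every vector at the image point is the image of some x, and both
  -- sides pair with it to dG(x), because G is constant along the flow and the flow is symplectic.
  rw [← sub_eq_zero]
  refine σ.nondegenerate (g t m) _ fun y => ?_
  obtain ⟨x, rfl⟩ := hsurj y
  rw [← σ.bilin_apply, map_sub]
  rw [sub_eq_zero]
  refine (hg.bilin_mfderiv hF t m _ _).trans ?_
  exact (σ.bilin_J _ _ _).trans ((hdG x).symm.trans (σ.bilin_J _ _ _).symm)

/-- The flows of functions in involution commute. -/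
theorem comm [T2Space M] (hg : σ.IsHamiltonianFlow F g)
    (hF : ContMDiff (𝓡 (2 * n)) 𝓘(ℝ, ℝ) ∞ F) {G : M → ℝ} {h : ℝ → M → M}
    (hh : σ.IsHamiltonianFlow G h)
    (hG : ContMDiff (𝓡 (2 * n)) 𝓘(ℝ, ℝ) ∞ G) (hFG : ∀ m, σ.poisson F G m = 0) (s t : ℝ) (m : M) :
    g s (h t m) = h t (g s m) := by
  -- Since `g s` preserves the field of `G`, it maps integral curves of that field to integral
  -- curves; uniqueness identifies this one with the curve through `g s m`.
  have hc : IsMIntegralCurve (I := 𝓡 (2 * n)) (fun t => g s (h t m)) (σ.hamiltonianField G) := by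
    intro t
    have h1 := ((hg.contMDiff_map s).mdifferentiableAt (by decide) (x := h t m)).hasMFDerivAt
    have h2 := h1.comp t (hh.mfderiv_time m t)
    have h3 : (1 : ℝ →L[ℝ] ℝ).smulRight (σ.hamiltonianField G (g s (h t m))) =
        (mfderiv (𝓡 (2 * n)) (𝓡 (2 * n)) (g s) (h t m)).comp
          ((1 : ℝ →L[ℝ] ℝ).smulRight (σ.hamiltonianField G (h t m))) := ?_
    · exact h3 ▸ h2
    ext
    change (1 : ℝ) • _ = mfderiv (𝓡 (2 * n)) (𝓡 (2 * n)) (g s) (h t m) ((1 : ℝ) • _)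
    rw [one_smul, one_smul, hg.mfderiv_hamiltonianField hF hG hFG]
  have := hh.eq_of_integralCurve hc t
  simpa only [hh.zero] using this

end SymplecticForm.IsHamiltonianFlow

/-! ### The action of the vector group -/

theorem multiFlow_zero_apply {N : Type*} (g : Fin 0 → ℝ → N → N) (t : Fin 0 → ℝ) (m : N) :
    multiFlow g t m = m := by
  simp [multiFlow]

theorem multiFlow_succ {N : Type*} (g : Fin (k + 1) → ℝ → N → N) (t : Fin (k + 1) → ℝ) (m : N) :
    multiFlow g t m = g 0 (t 0) (multiFlow (fun j => g j.succ) (fun j => t j.succ) m) := by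
  simp [multiFlow, List.ofFn_succ]

/-- Properties stable under composition (differentiable and symplectic, field-preserving, commuting
with a given map) pass from the single flows to the joint action. -/
theorem multiFlow_induction {N : Type*} {P : (N → N) → Prop} (hid : P id)
    (hcomp : ∀ f h, P f → P h → P (f ∘ h)) {g : Fin k → ℝ → N → N} (hg : ∀ j s, P (g j s))
    (t : Fin k → ℝ) : P (multiFlow g t) := by
  induction k with
  | zero =>
    have : multiFlow g t = id := funext (multiFlow_zero_apply g t)
    rwa [this]
  | succ k ih =>
    have : multiFlow g t = g 0 (t 0) ∘ multiFlow (fun j => g j.succ) (fun j => t j.succ) :=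
      funext (multiFlow_succ g t)
    rw [this]
    exact hcomp _ _ (hg 0 _) (ih (fun j => hg j.succ) _)

theorem multiFlow_comm {N : Type*} {g : Fin k → ℝ → N → N} {f : N → N}
    (h : ∀ j s m, f (g j s m) = g j s (f m)) (t : Fin k → ℝ) (m : N) :
    f (multiFlow g t m) = multiFlow g t (f m) :=
  multiFlow_induction (P := fun q => ∀ m, f (q m) = q (f m)) (fun _ => rfl)
    (fun q q' hq hq' m => by simp [hq, hq']) h t m

theorem multiFlow_zero {N : Type*} {g : Fin k → ℝ → N → N} (h0 : ∀ j m, g j 0 m = m) (m : N) :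
    multiFlow g 0 m = m := by
  induction k with
  | zero => exact multiFlow_zero_apply g _ m
  | succ k ih =>
    rw [multiFlow_succ]
    exact (h0 0 _).trans (ih (fun j => h0 j.succ))

/-- Commutation moves the first factor of the flow for t past the remaining factors of the flow for
s, after which the one-parameter group laws apply. -/
theorem multiFlow_add {N : Type*} {g : Fin k → ℝ → N → N}
    (hadd : ∀ j s t m, g j (s + t) m = g j s (g j t m))
    (hcomm : ∀ i j s t m, g i s (g j t m) = g j t (g i s m)) (s t : Fin k → ℝ) (m : N) :
    multiFlow g (s + t) m = multiFlow g s (multiFlow g t m) := by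
  induction k with
  | zero => simp only [multiFlow_zero_apply]
  | succ k ih =>
    rw [multiFlow_succ, multiFlow_succ, multiFlow_succ g t]
    rw [← multiFlow_comm (f := g 0 (t 0)) (fun j s m => hcomm 0 j.succ (t 0) s m)]
    rw [Pi.add_apply, hadd]
    have := ih (g := fun j => g j.succ) (fun j => hadd j.succ) (fun i j => hcomm i.succ j.succ)
      (fun j => s j.succ) (fun j => t j.succ)
    rw [← this]
    rfl

theorem multiFlow_single {N : Type*} {g : Fin k → ℝ → N → N} (h0 : ∀ j m, g j 0 m = m)
    (j : Fin k) (s : ℝ) (m : N) : multiFlow g (Pi.single j s) m = g j s m := by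
  induction k with
  | zero => exact j.elim0
  | succ k ih =>
    rw [multiFlow_succ]
    refine Fin.cases ?_ (fun i => ?_) j
    · have : (fun i : Fin k => (Pi.single (0 : Fin (k + 1)) s : Fin (k + 1) → ℝ) i.succ) = 0 := by
        ext i; simp
      rw [this, multiFlow_zero fun j => h0 j.succ]
      simp
    · have : (fun l : Fin k => (Pi.single i.succ s : Fin (k + 1) → ℝ) l.succ) = Pi.single i s := by
        ext l; simp [Pi.single_apply]
      rw [this, ih (g := fun j => g j.succ) (fun j => h0 j.succ)]
      simp [h0]

theorem contMDiff_multiFlow {g : Fin k → ℝ → M → M}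
    (hg : ∀ j, ContMDiff (𝓘(ℝ, ℝ).prod (𝓡 (2 * n))) (𝓡 (2 * n)) ∞
      fun p : ℝ × M => g j p.1 p.2) :
    ContMDiff (𝓘(ℝ, Fin k → ℝ).prod (𝓡 (2 * n))) (𝓡 (2 * n)) ∞
      fun p : (Fin k → ℝ) × M => multiFlow g p.1 p.2 := by
  induction k with
  | zero => exact contMDiff_snd.congr fun p => multiFlow_zero_apply g _ _
  | succ k ih =>
    have h1 := ih (g := fun j => g j.succ) fun j => hg j.succ
    have h2 : ContMDiff (𝓘(ℝ, Fin (k + 1) → ℝ).prod (𝓡 (2 * n)))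
        (𝓘(ℝ, Fin k → ℝ).prod (𝓡 (2 * n))) ∞
        fun p : (Fin (k + 1) → ℝ) × M => ((fun j : Fin k => p.1 j.succ), p.2) := by
      refine ContMDiff.prodMk ?_ contMDiff_snd
      have : ContDiff ℝ ∞ fun t : Fin (k + 1) → ℝ => fun j : Fin k => t j.succ := by fun_prop
      exact this.contMDiff.comp contMDiff_fst
    have h3 : ContMDiff (𝓘(ℝ, Fin (k + 1) → ℝ).prod (𝓡 (2 * n))) 𝓘(ℝ, ℝ) ∞
        fun p : (Fin (k + 1) → ℝ) × M => p.1 0 := by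
      have : ContDiff ℝ ∞ fun t : Fin (k + 1) → ℝ => t 0 := by fun_prop
      exact this.contMDiff.comp contMDiff_fst
    exact ((hg 0).comp (h3.prodMk (h1.comp h2))).congr fun p => multiFlow_succ g _ _

/-- A smooth symplectic action of the vector group `ℝᵏ` generated by the Hamiltonian fields of the
functions `F j`, which it preserves. -/
structure SymplecticForm.IsHamiltonianAction (σ : SymplecticForm n M) (F : Fin k → M → ℝ)
    (φ : (Fin k → ℝ) → M → M) : Prop where
  smooth : ContMDiff (𝓘(ℝ, Fin k → ℝ).prod (𝓡 (2 * n))) (𝓡 (2 * n)) ∞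
    fun p : (Fin k → ℝ) × M => φ p.1 p.2
  zero : ∀ m, φ 0 m = m
  add : ∀ s t m, φ (s + t) m = φ s (φ t m)
  mfderiv_time : ∀ t m (τ : Fin k → ℝ), mfderiv 𝓘(ℝ, Fin k → ℝ) (𝓡 (2 * n)) (fun t => φ t m) t τ =
    ∑ j, τ j • σ.hamiltonianField (F j) (φ t m)
  symplectic : ∀ t m (u v : TangentSpace (𝓡 (2 * n)) m),
    σ.bilin (φ t m) (mfderiv (𝓡 (2 * n)) (𝓡 (2 * n)) (φ t) m u)
      (mfderiv (𝓡 (2 * n)) (𝓡 (2 * n)) (φ t) m v) = σ.bilin m u v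
  field : ∀ j t m, mfderiv (𝓡 (2 * n)) (𝓡 (2 * n)) (φ t) m (σ.hamiltonianField (F j) m) =
    σ.hamiltonianField (F j) (φ t m)

theorem SymplecticForm.isHamiltonianAction_multiFlow [T2Space M] [IsManifold (𝓡 (2 * n)) ∞ M]
    {σ : SymplecticForm n M} {F : Fin k → M → ℝ}
    (hF : ∀ j, ContMDiff (𝓡 (2 * n)) 𝓘(ℝ, ℝ) ∞ (F j))
    (hinv : ∀ i j m, σ.poisson (F i) (F j) m = 0) {g : Fin k → ℝ → M → M}
    (hg : ∀ j, σ.IsHamiltonianFlow (F j) (g j)) :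
    σ.IsHamiltonianAction F (multiFlow g) := by
  have hsmooth := contMDiff_multiFlow (n := n) fun j => (hg j).smooth
  have h0 : ∀ j m, g j 0 m = m := fun j => (hg j).zero
  have hadd : ∀ s t m, multiFlow g (s + t) m = multiFlow g s (multiFlow g t m) :=
    multiFlow_add (fun j => (hg j).add)
      (fun i j => (hg i).comm (hF i) (hg j) (hF j) (hinv i j))
  refine ⟨hsmooth, multiFlow_zero h0, hadd, fun t m τ => ?_, fun t => ?_, fun j => ?_⟩
  · have hd : MDifferentiableAt 𝓘(ℝ, Fin k → ℝ) (𝓡 (2 * n)) (fun t => multiFlow g t m) t :=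
      (hsmooth.comp (contMDiff_id.prodMk contMDiff_const)).mdifferentiableAt (by decide)
    -- By the group law, the orbit map along t + s e_j is s ↦ g_j^s(g^t m), whose velocity at s = 0
    -- is the j-th field.
    have hj : ∀ j, mfderiv 𝓘(ℝ, Fin k → ℝ) (𝓡 (2 * n)) (fun t => multiFlow g t m) t
        (Pi.single j (1 : ℝ) : Fin k → ℝ) = σ.hamiltonianField (F j) (multiFlow g t m) := by
      intro j
      have h1 : HasFDerivAt (fun s : ℝ => t + Pi.single j s)
          (ContinuousLinearMap.single ℝ (fun _ : Fin k => ℝ) j) 0 :=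
        (ContinuousLinearMap.single ℝ (fun _ : Fin k => ℝ) j).hasFDerivAt.const_add t
      have hd' : MDifferentiableAt 𝓘(ℝ, Fin k → ℝ) (𝓡 (2 * n)) (fun t => multiFlow g t m)
          (t + Pi.single j (0 : ℝ)) := by simpa using hd
      have h2 := hd'.hasMFDerivAt.comp (0 : ℝ) h1.hasMFDerivAt
      have h3 : ((fun t => multiFlow g t m) ∘ fun s : ℝ => t + Pi.single j s) =
          fun s => g j s (multiFlow g t m) := by
        funext s
        rw [Function.comp_apply, add_comm, hadd, multiFlow_single h0]
      rw [h3] at h2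
      have h4 := DFunLike.congr_fun (hasMFDerivAt_unique h2 ((hg j).mfderiv_time _ 0)) (1 : ℝ)
      let q : (Fin k → ℝ) → EuclideanSpace ℝ (Fin (2 * n)) := fun p =>
        mfderiv 𝓘(ℝ, Fin k → ℝ) (𝓡 (2 * n)) (fun t => multiFlow g t m) p
          (Pi.single j (1 : ℝ) : Fin k → ℝ)
      let q' : M → EuclideanSpace ℝ (Fin (2 * n)) := σ.hamiltonianField (F j)
      have e1 : q (t + Pi.single j (0 : ℝ)) = q t := congrArg q (by simp)
      have e2 : q' (g j 0 (multiFlow g t m)) = q' (multiFlow g t m) := congrArg q' (h0 j _)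
      exact e1.symm.trans (h4.trans ((one_smul ℝ _).trans e2))
    have hτ : τ = ∑ j, τ j • (Pi.single j (1 : ℝ) : Fin k → ℝ) := by
      ext i
      simp [Finset.sum_apply, Pi.single_apply]
    refine (congrArg _ hτ).trans ((map_sum _ _ _).trans (Finset.sum_congr rfl fun j _ => ?_))
    exact (map_smul _ _ _).trans (congrArg _ (hj j))
  · refine (multiFlow_induction (P := fun q => MDifferentiable (𝓡 (2 * n)) (𝓡 (2 * n)) q ∧
      ∀ m (u v : TangentSpace (𝓡 (2 * n)) m), σ.bilin (q m) (mfderiv (𝓡 (2 * n)) (𝓡 (2 * n)) q m u)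
      (mfderiv (𝓡 (2 * n)) (𝓡 (2 * n)) q m v) = σ.bilin m u v) ?_ ?_ ?_ t).2
    · refine ⟨mdifferentiable_id, fun m u v => ?_⟩
      rw [mfderiv_id]
      rfl
    · rintro q q' ⟨hq, hq2⟩ ⟨hq', hq2'⟩
      refine ⟨hq.comp hq', fun m u v => ?_⟩
      rw [mfderiv_comp m (hq _) (hq' _)]
      exact (hq2 _ _ _).trans (hq2' _ _ _)
    · exact fun j s => ⟨((hg j).contMDiff_map s).mdifferentiable (by decide),
        (hg j).bilin_mfderiv (hF j) s⟩
  · intro t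
    refine (multiFlow_induction (P := fun q => MDifferentiable (𝓡 (2 * n)) (𝓡 (2 * n)) q ∧
      ∀ m, mfderiv (𝓡 (2 * n)) (𝓡 (2 * n)) q m (σ.hamiltonianField (F j) m) =
        σ.hamiltonianField (F j) (q m)) ?_ ?_ ?_ t).2
    · refine ⟨mdifferentiable_id, fun m => ?_⟩
      rw [mfderiv_id]
      rfl
    · rintro q q' ⟨hq, hq2⟩ ⟨hq', hq2'⟩
      refine ⟨hq.comp hq', fun m => ?_⟩
      rw [mfderiv_comp m (hq _) (hq' _)]
      exact (congrArg _ (hq2' m)).trans (hq2 _)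
    · exact fun i s => ⟨((hg i).contMDiff_map s).mdifferentiable (by decide),
        (hg i).mfderiv_hamiltonianField (hF i) (hF j) (hinv i j) s⟩

namespace SymplecticForm.IsHamiltonianAction

variable {σ : SymplecticForm n M} {F : Fin k → M → ℝ} {φ : (Fin k → ℝ) → M → M}

theorem contMDiff_map (hφ : σ.IsHamiltonianAction F φ) (t : Fin k → ℝ) :
    ContMDiff (𝓡 (2 * n)) (𝓡 (2 * n)) ∞ (φ t) :=
  hφ.smooth.comp (contMDiff_const.prodMk contMDiff_id)

theorem contMDiff_orbit (hφ : σ.IsHamiltonianAction F φ) (m : M) :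
    ContMDiff 𝓘(ℝ, Fin k → ℝ) (𝓡 (2 * n)) ∞ (fun t => φ t m) :=
  hφ.smooth.comp (contMDiff_id.prodMk contMDiff_const)

theorem continuous (hφ : σ.IsHamiltonianAction F φ) :
    Continuous fun p : (Fin k → ℝ) × M => φ p.1 p.2 :=
  hφ.smooth.continuous

theorem neg_apply (hφ : σ.IsHamiltonianAction F φ) (t : Fin k → ℝ) (m : M) :
    φ (-t) (φ t m) = m := by
  rw [← hφ.add, neg_add_cancel, hφ.zero]

theorem mfderiv_add (hφ : σ.IsHamiltonianAction F φ) (s t : Fin k → ℝ) (m : M)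
    (u : TangentSpace (𝓡 (2 * n)) m) :
    mfderiv (𝓡 (2 * n)) (𝓡 (2 * n)) (φ (s + t)) m u =
      mfderiv (𝓡 (2 * n)) (𝓡 (2 * n)) (φ s) (φ t m) (mfderiv (𝓡 (2 * n)) (𝓡 (2 * n)) (φ t) m u) := by
  have h : φ (s + t) = φ s ∘ φ t := funext (hφ.add s t)
  have h2 := mfderiv_comp m ((hφ.contMDiff_map s).mdifferentiableAt (by decide) (x := φ t m))
      ((hφ.contMDiff_map t).mdifferentiableAt (by decide) (x := m))
  rw [← h] at h2
  exact DFunLike.congr_fun h2 u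

end SymplecticForm.IsHamiltonianAction

/-! ### Flow boxes -/

theorem SymplecticForm.linearIndependent_hamiltonianField (σ : SymplecticForm n M)
    {F : Fin k → M → ℝ} {m : M}
    (hind : LinearIndependent ℝ fun j => differential (n := n) (F j) m) :
    LinearIndependent ℝ fun j => σ.hamiltonianField (F j) m :=
  hind.map' (σ.J m).toLinearMap (σ.J m).ker

namespace SymplecticForm.IsHamiltonianAction

variable [IsManifold (𝓡 (2 * n)) ∞ M]
  {σ : SymplecticForm n M} {F : Fin k → M → ℝ} {φ : (Fin k → ℝ) → M → M}

theorem contMDiffAt_box (hφ : σ.IsHamiltonianAction F φ)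
    (N : Submodule ℝ (EuclideanSpace ℝ (Fin (2 * n)))) (m : M) {p : (Fin k → ℝ) × N}
    (hp : extChartAt (𝓡 (2 * n)) m m + p.2 ∈ (extChartAt (𝓡 (2 * n)) m).target) :
    ContMDiffAt 𝓘(ℝ, (Fin k → ℝ) × N) (𝓡 (2 * n)) ∞
      (fun p => φ p.1 ((extChartAt (𝓡 (2 * n)) m).symm (extChartAt (𝓡 (2 * n)) m m + p.2))) p := by
  have h1 := (contMDiffOn_extChartAt_symm (I := 𝓡 (2 * n)) (n := ∞) m).contMDiffAt
    ((isOpen_extChartAt_target _).mem_nhds hp)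
  have h3 : ContDiff ℝ ∞ fun p : (Fin k → ℝ) × N =>
      extChartAt (𝓡 (2 * n)) m m + (p.2 : EuclideanSpace ℝ (Fin (2 * n))) :=
    contDiff_const.add (N.subtypeL.contDiff.comp contDiff_snd)
  have h2 : ContMDiffAt 𝓘(ℝ, (Fin k → ℝ) × N) (𝓡 (2 * n)) ∞
      (fun p : (Fin k → ℝ) × N =>
        (extChartAt (𝓡 (2 * n)) m).symm (extChartAt (𝓡 (2 * n)) m m + p.2)) p :=
    ContMDiffAt.comp p (by exact h1) h3.contMDiff.contMDiffAt
  exact (hφ.smooth.contMDiffAt (x := (p.1, (extChartAt (𝓡 (2 * n)) m).symm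
    (extChartAt (𝓡 (2 * n)) m m + p.2)))).comp p
    (ContMDiffAt.prodMk (contDiff_fst.contMDiff.contMDiffAt) h2)

/-- Take `N` complementary, in the chart at m, to the span of the fields, and flow the slice κ(m) +
`N` for time t. At 0 the derivative of (t, z) ↦ φ_t(κ⁻¹(κ(m) + z)) is the identity on `N` and an
isomorphism of `ℝᵏ` onto the span of the fields, so the inverse function theorem applies. In these
coordinates the Hamiltonian fields are the coordinate fields of t. -/
theorem exists_flowBox (hφ : σ.IsHamiltonianAction F φ)
    (hind : ∀ m, LinearIndependent ℝ fun j => σ.hamiltonianField (F j) m) (m : M) :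
    ∃ (N : Submodule ℝ (EuclideanSpace ℝ (Fin (2 * n)))) (H : (Fin k → ℝ) × N → M)
      (e : OpenPartialHomeomorph ((Fin k → ℝ) × N) (EuclideanSpace ℝ (Fin (2 * n)))),
      0 ∈ e.source ∧ (∀ t, H (t, 0) = φ t m) ∧ ∀ p ∈ e.source,
        H p ∈ (extChartAt (𝓡 (2 * n)) m).source ∧ e p = extChartAt (𝓡 (2 * n)) m (H p) ∧
        ContDiffAt ℝ ∞ e p ∧
        (∃ L : ((Fin k → ℝ) × N) ≃L[ℝ] EuclideanSpace ℝ (Fin (2 * n)), HasFDerivAt e L.toContinuousLinearMap p) ∧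
        ∀ τ : Fin k → ℝ, fderiv ℝ e p (τ, 0) =
          mfderiv (𝓡 (2 * n)) 𝓘(ℝ, EuclideanSpace ℝ (Fin (2 * n))) (extChartAt (𝓡 (2 * n)) m) (H p)
            (∑ j, τ j • σ.hamiltonianField (F j) (H p)) := by
  set κ := extChartAt (𝓡 (2 * n)) m with hκ
  have hmt : κ m ∈ κ.target := mem_extChartAt_target m
  let A : (Fin k → ℝ) →ₗ[ℝ] EuclideanSpace ℝ (Fin (2 * n)) :=
    (mfderiv (𝓡 (2 * n)) 𝓘(ℝ, EuclideanSpace ℝ (Fin (2 * n))) κ m).toLinearMap ∘ₗ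
      Fintype.linearCombination ℝ (fun j => σ.hamiltonianField (F j) m)
  have hAinj : Function.Injective A := by
    have h1 : Function.Injective (mfderiv (𝓡 (2 * n)) 𝓘(ℝ, EuclideanSpace ℝ (Fin (2 * n))) κ m) :=
      (isInvertible_mfderiv_extChartAt (I := 𝓡 (2 * n)) (mem_extChartAt_source m)).injective
    exact h1.comp (hind m).fintypeLinearCombination_injective
  obtain ⟨N, hN⟩ := Submodule.exists_isCompl (LinearMap.range A)
  let H : (Fin k → ℝ) × N → M := fun p => φ p.1 (κ.symm (κ m + p.2))
  let h : (Fin k → ℝ) × N → EuclideanSpace ℝ (Fin (2 * n)) := fun p => κ (H p)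
  have hH0 : ∀ t, H (t, 0) = φ t m := by
    intro t
    simp only [H, ZeroMemClass.coe_zero, add_zero]
    rw [hκ, extChartAt_to_inv]
  let good : (Fin k → ℝ) × N → Prop := fun p => κ m + p.2 ∈ κ.target ∧ H p ∈ κ.source
  have hsm : ∀ p, good p → ContMDiffAt 𝓘(ℝ, (Fin k → ℝ) × N) (𝓡 (2 * n)) ∞ H p :=
    fun p hp => hφ.contMDiffAt_box N m hp.1
  have hκd : ∀ q ∈ κ.source, MDifferentiableAt (𝓡 (2 * n)) 𝓘(ℝ, EuclideanSpace ℝ (Fin (2 * n))) κ q :=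
    fun q hq => mdifferentiableAt_extChartAt (by rwa [← extChartAt_source (𝓡 (2 * n))])
  have hh : ∀ p, good p → ContDiffAt ℝ ∞ h p := by
    intro p hp
    have h1 : ContMDiffAt (𝓡 (2 * n)) 𝓘(ℝ, EuclideanSpace ℝ (Fin (2 * n))) ∞ κ (H p) :=
      contMDiffAt_extChartAt' (by rw [← extChartAt_source (𝓡 (2 * n))]; exact hp.2)
    exact contMDiffAt_iff_contDiffAt.1 (h1.comp p (hsm p hp))
  have hτ : ∀ p, good p → ∀ τ : Fin k → ℝ, fderiv ℝ h p (τ, 0) =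
      mfderiv (𝓡 (2 * n)) 𝓘(ℝ, EuclideanSpace ℝ (Fin (2 * n))) κ (H p)
        (∑ j, τ j • σ.hamiltonianField (F j) (H p)) := by
    rintro ⟨t, z⟩ hp τ
    have h1 := ((hh _ hp).differentiableAt (by decide)).hasFDerivAt
    have h2 : HasFDerivAt (fun t : Fin k → ℝ => (t, z))
      (ContinuousLinearMap.inl ℝ (Fin k → ℝ) N) t := hasFDerivAt_prodMk_left t z
    have h3 := (h1.comp t h2).hasMFDerivAt
    have h4 := (hκd _ hp.2).hasMFDerivAt.comp t
      (((hφ.contMDiff_orbit (κ.symm (κ m + z))).mdifferentiableAt (by decide) (x := t)).hasMFDerivAt)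
    have h5 := DFunLike.congr_fun (hasMFDerivAt_unique h3 h4) τ
    refine h5.trans ?_
    exact congrArg _ (hφ.mfderiv_time t (κ.symm (κ m + z)) τ)
  have hgood0 : good 0 := by
    refine ⟨by rw [Prod.snd_zero, ZeroMemClass.coe_zero, add_zero]; exact hmt, ?_⟩
    rw [show (0 : (Fin k → ℝ) × N) = (0, 0) from rfl, hH0, hφ.zero]
    exact mem_extChartAt_source m
  have hgood : ∀ᶠ p in 𝓝 (0 : (Fin k → ℝ) × N), good p := by
    have h1 : ContinuousAt (fun p : (Fin k → ℝ) × N => κ m + p.2) 0 := by fun_prop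
    refine Filter.Eventually.and
      (h1.preimage_mem_nhds ((isOpen_extChartAt_target m).mem_nhds hgood0.1)) ?_
    exact (hsm 0 hgood0).continuousAt.preimage_mem_nhds
      ((isOpen_extChartAt_source m).mem_nhds hgood0.2)
  have hz : ∀ z : N, fderiv ℝ h 0 (0, z) = z := by
    intro z
    have h1 := ((hh _ hgood0).differentiableAt (by decide)).hasFDerivAt
    have h2 : HasFDerivAt (fun z : N => ((0 : Fin k → ℝ), z))
      (ContinuousLinearMap.inr ℝ (Fin k → ℝ) N) 0 := hasFDerivAt_prodMk_right 0 0
    have h3 := HasFDerivAt.comp (g := h) (0 : N) h1 h2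
    have h4 : HasFDerivAt (fun z : N => κ m + (z : EuclideanSpace ℝ (Fin (2 * n)))) N.subtypeL 0 :=
      N.subtypeL.hasFDerivAt.const_add _
    have h5 : (fun z : N => h (0, z)) =ᶠ[𝓝 0]
        fun z : N => κ m + (z : EuclideanSpace ℝ (Fin (2 * n))) := by
      have h6 : ContinuousAt (fun z : N => κ m + (z : EuclideanSpace ℝ (Fin (2 * n)))) 0 := by
        fun_prop
      filter_upwards [h6.preimage_mem_nhds ((isOpen_extChartAt_target m).mem_nhds
        (by rw [ZeroMemClass.coe_zero, add_zero]; exact hmt))] with z hz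
      simp only [h, H, hφ.zero]
      exact κ.right_inv hz
    exact DFunLike.congr_fun (h3.unique (h4.congr_of_eventuallyEq h5)) z
  have hA : ∀ τ, fderiv ℝ h 0 (τ, 0) = A τ := by
    intro τ
    rw [hτ 0 hgood0]
    have h1 : H 0 = m := (hH0 0).trans (hφ.zero m)
    let q : M → EuclideanSpace ℝ (Fin (2 * n)) := fun p =>
      mfderiv (𝓡 (2 * n)) 𝓘(ℝ, EuclideanSpace ℝ (Fin (2 * n))) κ p
        (∑ j, τ j • σ.hamiltonianField (F j) p)
    exact congrArg q h1
  have hdec : ∀ p : (Fin k → ℝ) × N, fderiv ℝ h 0 p = A p.1 + p.2 := by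
    rintro ⟨τ, z⟩
    rw [← hA, ← hz z, ← map_add, Prod.mk_add_mk, add_zero, zero_add]
  have hinj : Function.Injective (fderiv ℝ h 0) := by
    refine (injective_iff_map_eq_zero _).2 fun p hp => ?_
    rw [hdec] at hp
    have h1 : A p.1 ∈ LinearMap.range A ⊓ N :=
      ⟨⟨p.1, rfl⟩, by rw [eq_neg_of_add_eq_zero_left hp]; exact N.neg_mem p.2.2⟩
    rw [hN.inf_eq_bot, Submodule.mem_bot] at h1
    rw [h1, zero_add] at hp
    exact Prod.ext (hAinj (by rw [h1, Prod.fst_zero, map_zero])) (Subtype.ext hp)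
  have hsurj : Function.Surjective (fderiv ℝ h 0) := by
    intro y
    have : y ∈ LinearMap.range A ⊔ N := by rw [hN.sup_eq_top]; trivial
    obtain ⟨_, ⟨τ, rfl⟩, z, hz, rfl⟩ := Submodule.mem_sup.1 this
    exact ⟨(τ, ⟨z, hz⟩), hdec _⟩
  let L₀ : ((Fin k → ℝ) × N) ≃L[ℝ] EuclideanSpace ℝ (Fin (2 * n)) :=
    (LinearEquiv.ofBijective (fderiv ℝ h 0).toLinearMap ⟨hinj, hsurj⟩).toContinuousLinearEquiv
  have hL₀ : L₀.toContinuousLinearMap = fderiv ℝ h 0 :=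
    ContinuousLinearMap.ext fun _ => rfl
  have hd0 : HasFDerivAt h L₀.toContinuousLinearMap 0 := by
    rw [hL₀]
    exact ((hh _ hgood0).differentiableAt (by decide)).hasFDerivAt
  let e := (hh 0 hgood0).toOpenPartialHomeomorph h hd0 (by decide)
  -- The box is shrunk so that the derivative is invertible throughout, not only at 0; this makes
  -- the inverse smooth on the whole target.
  have hinv : ∀ᶠ p in 𝓝 (0 : (Fin k → ℝ) × N),
      ∃ L : ((Fin k → ℝ) × N) ≃L[ℝ] EuclideanSpace ℝ (Fin (2 * n)),
        L.toContinuousLinearMap = fderiv ℝ h p := by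
    have h1 : ContinuousAt (fderiv ℝ h) 0 :=
      ((hh 0 hgood0).fderiv_right (m := 0) (by decide)).continuousAt
    have h2 := L₀.nhds
    rw [hL₀] at h2
    exact h1.preimage_mem_nhds h2
  let s := {p | good p ∧ ∃ L : ((Fin k → ℝ) × N) ≃L[ℝ] EuclideanSpace ℝ (Fin (2 * n)),
        L.toContinuousLinearMap = fderiv ℝ h p}
  have hs : s ∈ 𝓝 (0 : (Fin k → ℝ) × N) := hgood.and hinv
  refine ⟨N, H, e.restr s, ?_, hH0, fun p hp => ?_⟩
  · rw [OpenPartialHomeomorph.restr_source]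
    exact ⟨ContDiffAt.mem_toOpenPartialHomeomorph_source _ _ _, mem_interior_iff_mem_nhds.2 hs⟩
  · rw [OpenPartialHomeomorph.restr_source] at hp
    obtain ⟨hp1, L, hL⟩ := interior_subset hp.2
    refine ⟨hp1.2, rfl, hh p hp1, ⟨L, ?_⟩, hτ p hp1⟩
    rw [hL]
    exact ((hh p hp1).differentiableAt (by decide)).hasFDerivAt

end SymplecticForm.IsHamiltonianAction

namespace SymplecticForm.IsHamiltonianAction

variable [IsManifold (𝓡 (2 * n)) ∞ M]
  {σ : SymplecticForm n M} {F : Fin k → M → ℝ} {φ : (Fin k → ℝ) → M → M}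

/-- An immersed manifold whose tangent spaces are spanned by the Hamiltonian fields is locally
contained in the orbits, and the time along the orbit is a smooth local coordinate system. -/
theorem exists_localTime (hφ : σ.IsHamiltonianAction F φ)
    (hind : ∀ m, LinearIndependent ℝ fun j => σ.hamiltonianField (F j) m)
    {E' H' B : Type*} [NormedAddCommGroup E'] [NormedSpace ℝ E'] [FiniteDimensional ℝ E']
    [TopologicalSpace H'] {I' : ModelWithCorners ℝ E' H'} [I'.Boundaryless] [TopologicalSpace B]
    [ChartedSpace H' B] [IsManifold I' ∞ B] {f : B → M} (hf : ContMDiff I' (𝓡 (2 * n)) ∞ f)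
    (hrank : Module.finrank ℝ E' = k)
    (hinj : ∀ b, Function.Injective (mfderiv I' (𝓡 (2 * n)) f b))
    (htan : ∀ b v, ∃ c : Fin k → ℝ,
      mfderiv I' (𝓡 (2 * n)) f b v = ∑ j, c j • σ.hamiltonianField (F j) (f b)) (b₀ : B) :
    ∃ U ∈ 𝓝 b₀, ∃ τ : B → Fin k → ℝ, ContMDiffOn I' 𝓘(ℝ, Fin k → ℝ) ∞ τ U ∧ τ b₀ = 0 ∧
      (∀ b ∈ U, f b = φ (τ b) (f b₀)) ∧ Filter.map τ (𝓝 b₀) = 𝓝 0 := by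
  obtain ⟨N, H, e, h0, hH0, he⟩ := hφ.exists_flowBox hind (f b₀)
  set κ := extChartAt (𝓡 (2 * n)) (f b₀) with hκ
  set χ := extChartAt I' b₀ with hχ
  set u₀ := χ b₀ with hu₀
  let q : E' → EuclideanSpace ℝ (Fin (2 * n)) := fun u => κ (f (χ.symm u))
  have hχ0 : χ.symm u₀ = b₀ := extChartAt_to_inv b₀
  have he0 : e 0 = κ (f b₀) := by
    rw [(he 0 h0).2.1, show (0 : (Fin k → ℝ) × N) = (0, 0) from rfl, hH0, hφ.zero]
  let good : E' → Prop := fun u => u ∈ χ.target ∧ f (χ.symm u) ∈ κ.source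
  have hχt : χ.target ∈ 𝓝 u₀ := (isOpen_extChartAt_target b₀).mem_nhds (mem_extChartAt_target b₀)
  have hχs : ∀ u ∈ χ.target, ContMDiffAt 𝓘(ℝ, E') I' ∞ χ.symm u := fun u hu =>
    (contMDiffOn_extChartAt_symm b₀).contMDiffAt ((isOpen_extChartAt_target b₀).mem_nhds hu)
  have hfχ : ∀ u ∈ χ.target, ContMDiffAt 𝓘(ℝ, E') (𝓡 (2 * n)) ∞ (fun u => f (χ.symm u)) u :=
    fun u hu => (hf _).comp u (hχs u hu)
  have hκs : ∀ p ∈ κ.source, ContMDiffAt (𝓡 (2 * n)) 𝓘(ℝ, EuclideanSpace ℝ (Fin (2 * n))) ∞ κ p :=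
    fun p hp => contMDiffAt_extChartAt' (by rwa [← extChartAt_source (𝓡 (2 * n))])
  have hq : ∀ u, good u → ContDiffAt ℝ ∞ q u := fun u hu =>
    contMDiffAt_iff_contDiffAt.1 ((hκs _ hu.2).comp u (hfχ u hu.1))
  have hgood0 : good u₀ := ⟨mem_of_mem_nhds hχt, by rw [hχ0]; exact mem_extChartAt_source _⟩
  have hq0 : q u₀ = e 0 := by rw [he0]; exact congrArg (fun b => κ (f b)) hχ0
  have hev : ∀ᶠ u in 𝓝 u₀, good u ∧ q u ∈ e.target := by
    refine Filter.Eventually.and (Filter.Eventually.and hχt ?_) ?_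
    · exact (hfχ u₀ hgood0.1).continuousAt.preimage_mem_nhds
        ((isOpen_extChartAt_source _).mem_nhds hgood0.2)
    · refine (hq u₀ hgood0).continuousAt.preimage_mem_nhds (e.open_target.mem_nhds ?_)
      rw [hq0]
      exact e.map_source h0
  obtain ⟨ε, hε, hball⟩ := Metric.mem_nhds_iff.1 hev
  have hb : ∀ u ∈ Metric.ball u₀ ε, good u ∧ q u ∈ e.target := fun u hu => hball hu
  -- The map `f` in flow-box coordinates: the first component is the sought time, the second the
  -- position transverse to the orbit.
  let w : E' → (Fin k → ℝ) × N := fun u => e.symm (q u)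
  have hw : ∀ u ∈ Metric.ball u₀ ε, ContDiffAt ℝ ∞ w u := by
    intro u hu
    obtain ⟨hg, ht⟩ := hb u hu
    obtain ⟨-, -, hc, ⟨L, hL⟩, -⟩ := he _ (e.map_target ht)
    exact (e.contDiffAt_symm ht hL hc).comp u (hq u hg)
  have hw0 : w u₀ = 0 := by
    simp only [w, hq0]
    exact e.left_inv h0
  have hHw : ∀ u ∈ Metric.ball u₀ ε, H (w u) = f (χ.symm u) := by
    intro u hu
    obtain ⟨hg, ht⟩ := hb u hu
    obtain ⟨h1, h2, -⟩ := he _ (e.map_target ht)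
    refine κ.injOn h1 hg.2 ?_
    rw [← h2]
    exact e.right_inv ht
  have hcomp : ∀ u ∈ Metric.ball u₀ ε, ∀ v, fderiv ℝ e (w u) (fderiv ℝ w u v) = fderiv ℝ q u v := by
    intro u hu v
    obtain ⟨hg, ht⟩ := hb u hu
    have h1 : DifferentiableAt ℝ e (w u) :=
      (he _ (e.map_target ht)).2.2.1.differentiableAt (by decide)
    have h2 : (fun u => e (w u)) =ᶠ[𝓝 u] q := by
      filter_upwards [Metric.isOpen_ball.mem_nhds hu] with u' hu'
      exact e.right_inv (hb u' hu').2
    have h3 := fderiv_comp u h1 ((hw u hu).differentiableAt (by decide))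
    have h4 := h2.fderiv_eq (𝕜 := ℝ)
    exact DFunLike.congr_fun (h3.symm.trans h4) v
  have hqd : ∀ u, good u → ∀ v : E', fderiv ℝ q u v =
      mfderiv (𝓡 (2 * n)) 𝓘(ℝ, EuclideanSpace ℝ (Fin (2 * n))) κ (f (χ.symm u))
        (mfderiv I' (𝓡 (2 * n)) f (χ.symm u) (mfderiv 𝓘(ℝ, E') I' χ.symm u v)) := by
    intro u hu v
    have h1 := ((hχs u hu.1).mdifferentiableAt (by decide)).hasMFDerivAt
    have h2 := ((hf (χ.symm u)).mdifferentiableAt (by decide)).hasMFDerivAt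
    have h3 := ((hκs _ hu.2).mdifferentiableAt (by decide)).hasMFDerivAt
    have h4 := ((hq u hu).differentiableAt (by decide)).hasFDerivAt.hasMFDerivAt
    exact DFunLike.congr_fun (hasMFDerivAt_unique h4 (h3.comp u (h2.comp u h1))) v
  -- Tangent vectors of the immersed manifold are combinations of the fields, which have no
  -- transverse component in the box. The transverse coordinate is thus constant on the ball, equal
  -- to its value 0 at the centre.
  have hwd : ∀ u ∈ Metric.ball u₀ ε, ∀ v, (fderiv ℝ w u v).2 = 0 := by
    intro u hu v
    obtain ⟨hg, ht⟩ := hb u hu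
    obtain ⟨-, -, -, ⟨L, hL⟩, hτ⟩ := he _ (e.map_target ht)
    obtain ⟨c, hc⟩ := htan (χ.symm u) (mfderiv 𝓘(ℝ, E') I' χ.symm u v)
    have h1 : fderiv ℝ e (w u) (fderiv ℝ w u v) = fderiv ℝ e (w u) (c, 0) := by
      rw [hcomp u hu, hqd u hg, hτ]
      refine (congrArg _ hc).trans ?_
      let r : M → EuclideanSpace ℝ (Fin (2 * n)) := fun p =>
        mfderiv (𝓡 (2 * n)) 𝓘(ℝ, EuclideanSpace ℝ (Fin (2 * n))) κ p
          (∑ j, c j • σ.hamiltonianField (F j) p)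
      exact congrArg r (hHw u hu).symm
    rw [hL.fderiv] at h1
    rw [L.injective h1]
  have hw2 : ∀ u ∈ Metric.ball u₀ ε, w u = ((w u).1, 0) := by
    intro u hu
    have h1 : (w u).2 = (w u₀).2 := by
      refine Metric.isOpen_ball.is_const_of_fderiv_eq_zero (𝕜 := ℝ) (f := fun u => (w u).2)
        (convex_ball u₀ ε).isPreconnected
        (fun u hu => (((hw u hu).differentiableAt (by decide)).snd).differentiableWithinAt)
        (fun u hu => ?_) hu (Metric.mem_ball_self hε)
      have h2 := ((hw u hu).differentiableAt (by decide)).hasFDerivAt.snd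
      rw [h2.fderiv]
      exact ContinuousLinearMap.ext fun v => hwd u hu v
    exact Prod.ext rfl (h1.trans (by rw [hw0]; rfl))
  have hχc : ContinuousAt χ b₀ := continuousAt_extChartAt b₀
  have hU : χ.source ∩ χ ⁻¹' Metric.ball u₀ ε ∈ 𝓝 b₀ :=
    Filter.inter_mem (extChartAt_source_mem_nhds b₀)
      (hχc.preimage_mem_nhds (Metric.ball_mem_nhds _ hε))
  refine ⟨_, hU, fun b => (w (χ b)).1, fun b hb => ?_, ?_, fun b hb => ?_, ?_⟩
  · have h1 : ContMDiffAt I' 𝓘(ℝ, E') ∞ χ b :=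
      contMDiffAt_extChartAt' (by rw [← extChartAt_source I']; exact hb.1)
    have h2 : ContDiffAt ℝ ∞ (fun u => (w u).1) (χ b) := (hw _ hb.2).fst
    exact (h2.contMDiffAt.comp b h1).contMDiffWithinAt
  · change (w u₀).1 = 0
    rw [hw0]
    rfl
  · have h1 := hHw _ hb.2
    rw [hw2 _ hb.2, hH0, χ.left_inv hb.1] at h1
    exact h1.symm
  · have h1 : ContDiffAt ℝ ∞ (fun u => (w u).1) u₀ := (hw _ (Metric.mem_ball_self hε)).fst
    have h2 := ((hw _ (Metric.mem_ball_self hε)).differentiableAt (by decide)).hasFDerivAt.fst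
    -- With the transverse part zero, injectivity of the derivative of `f` passes to the time
    -- component. Both sides have dimension k, so the time is locally open.
    have hinj' : Function.Injective (((ContinuousLinearMap.fst ℝ (Fin k → ℝ) N).comp
        (fderiv ℝ w u₀)).toLinearMap) := by
      refine (injective_iff_map_eq_zero _).2 fun v hv => ?_
      have h3 : fderiv ℝ w u₀ v = 0 := Prod.ext hv (hwd u₀ (Metric.mem_ball_self hε) v)
      have h4 := hcomp u₀ (Metric.mem_ball_self hε) v
      rw [h3, map_zero, hqd u₀ hgood0] at h4
      have i1 : Function.Injective (mfderiv (𝓡 (2 * n)) 𝓘(ℝ, EuclideanSpace ℝ (Fin (2 * n))) κ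
        (f (χ.symm u₀))) := (isInvertible_mfderiv_extChartAt hgood0.2).injective
      have i2 : Function.Injective (mfderiv 𝓘(ℝ, E') I' χ.symm u₀) := by
        have h := isInvertible_mfderivWithin_extChartAt_symm (I := I') hgood0.1
        rw [ModelWithCorners.range_eq_univ, mfderivWithin_univ] at h
        exact h.injective
      exact (i1.comp ((hinj _).comp i2)) (h4.symm.trans
        (((congrArg _ ((congrArg _ (map_zero _)).trans (map_zero _))).trans (map_zero _)).symm))
    have hsurj := (LinearMap.injective_iff_surjective_of_finrank_eq_finrank
      (by rw [hrank, Module.finrank_fin_fun])).1 hinj'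
    have h3 := (h1.hasStrictFDerivAt' h2 (by decide)).map_nhds_eq_of_surj
      (LinearMap.range_eq_top.2 hsurj)
    have h4 : Filter.map χ (𝓝 b₀) = 𝓝 u₀ := map_extChartAt_nhds_of_boundaryless b₀
    change Filter.map ((fun u => (w u).1) ∘ χ) _ = _
    rw [← Filter.map_map, h4, h3, hw0]
    rfl

end SymplecticForm.IsHamiltonianAction

/-! ### The torus -/

/-- Transition maps between product charts act factor by factor, through transition maps of the
circle. -/
theorem isManifold_torus (k : ℕ) : IsManifold (torusModel k) ∞ (Torus k) := by
  refine isManifold_of_contDiffOn _ _ _ ?_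
  rintro _ _ ⟨e, he, rfl⟩ ⟨e', he', rfl⟩
  rw [contDiffOn_pi]
  intro i
  have h1 : ContDiffOn ℝ ∞ ((𝓡 1) ∘ ((e i).symm ≫ₕ e' i) ∘ (𝓡 1).symm)
      ((𝓡 1).symm ⁻¹' ((e i).symm ≫ₕ e' i).source ∩ range (𝓡 1)) :=
    (contDiffGroupoid ∞ (𝓡 1)).compatible (M := Circle) (he i trivial) (he' i trivial) |>.1
  refine h1.comp (f := fun x : Fin k → EuclideanSpace ℝ (Fin 1) => x i)
    (contDiff_apply ℝ _ i).contDiffOn fun x hx => ?_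
  refine ⟨⟨?_, ?_⟩, by simp⟩
  · exact hx.1.1 i trivial
  · exact hx.1.2 i trivial

instance (k : ℕ) : (torusModel k).Boundaryless where
  range_eq_univ := by
    refine eq_univ_of_forall fun x => ⟨x, rfl⟩

/-! ### Compact orbits and their period lattices -/

section Orbits

variable {X B : Type*} [TopologicalSpace B] {φ : (Fin k → ℝ) → X → X}
  {f : B → X}

/-- Near each point, the map `f` into a space with an action of `ℝᵏ` runs over a neighbourhood in
the orbit of that point, and the time along the orbit is continuous. -/
def IsLocallyOrbital (φ : (Fin k → ℝ) → X → X) (f : B → X) : Prop :=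
  ∀ b₀, ∃ U ∈ 𝓝 b₀, ∃ τ : B → Fin k → ℝ, (∀ b ∈ U, f b = φ (τ b) (f b₀)) ∧
    Filter.map τ (𝓝 b₀) = 𝓝 0

/-- The times at which the orbit lies in the image of `f` form a closed set, the image being
compact, and an open one, since local times fill a neighbourhood of 0. As `ℝᵏ` is connected, these
are all times. -/
theorem IsLocallyOrbital.exists_eq_apply [TopologicalSpace X] [T2Space X] [CompactSpace B] (hl : IsLocallyOrbital φ f)
    (hφ : Continuous fun p : (Fin k → ℝ) × X => φ p.1 p.2) (h0 : ∀ x, φ 0 x = x)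
    (hadd : ∀ s t x, φ (s + t) x = φ s (φ t x)) (hf : Continuous f) (b : B) (t : Fin k → ℝ) :
    ∃ b', f b' = φ t (f b) := by
  have hc : IsClopen {t : Fin k → ℝ | φ t (f b) ∈ range f} := by
    refine ⟨(isCompact_range hf).isClosed.preimage
      (hφ.comp (continuous_id.prodMk continuous_const)), isOpen_iff_mem_nhds.2 ?_⟩
    rintro t ⟨b', hb'⟩
    obtain ⟨U, hU, τ, hτ, hmap⟩ := hl b'
    have h1 : τ '' U ∈ 𝓝 (0 : Fin k → ℝ) := hmap ▸ Filter.image_mem_map hU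
    have h2 : Filter.Tendsto (fun s : Fin k → ℝ => s - t) (𝓝 t) (𝓝 0) := by
      have : Continuous fun s : Fin k → ℝ => s - t := by fun_prop
      simpa using this.tendsto t
    filter_upwards [h2 h1] with s hs
    obtain ⟨b'', hb'', hs⟩ := hs
    refine ⟨b'', ?_⟩
    rw [hτ b'' hb'', hs, hb', ← hadd, sub_add_cancel]
  have := hc.eq_univ ⟨0, b, (h0 _).symm⟩
  exact (this ▸ mem_univ t : t ∈ {t : Fin k → ℝ | φ t (f b) ∈ range f})

/-- Lying on the orbit of `f b` is an open condition on the point of `B`, and so is its negation;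
connectedness leaves one orbit. -/
theorem IsLocallyOrbital.exists_apply_eq [PreconnectedSpace B] (hl : IsLocallyOrbital φ f)
    (h0 : ∀ x, φ 0 x = x) (hadd : ∀ s t x, φ (s + t) x = φ s (φ t x)) (b b' : B) :
    ∃ t, f b' = φ t (f b) := by
  have hc : IsClopen {b' | ∃ t, f b' = φ t (f b)} := by
    refine ⟨⟨isOpen_iff_mem_nhds.2 fun b₁ hb₁ => ?_⟩, isOpen_iff_mem_nhds.2 ?_⟩
    · obtain ⟨U, hU, τ, hτ, -⟩ := hl b₁
      filter_upwards [hU] with b₂ hb₂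
      rintro ⟨t, ht⟩
      refine hb₁ ⟨-τ b₂ + t, ?_⟩
      rw [hadd, ← ht, hτ b₂ hb₂, ← hadd, neg_add_cancel, h0]
    · rintro b₁ ⟨t, ht⟩
      obtain ⟨U, hU, τ, hτ, -⟩ := hl b₁
      filter_upwards [hU] with b₂ hb₂
      exact ⟨τ b₂ + t, by rw [hτ b₂ hb₂, ht, hadd]⟩
  have := hc.eq_univ ⟨b, 0, (h0 _).symm⟩
  exact (this ▸ mem_univ b' : b' ∈ {b' | ∃ t, f b' = φ t (f b)})

/-- The periods of a point. -/
def periodLattice (φ : (Fin k → ℝ) → X → X) (h0 : ∀ x, φ 0 x = x)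
    (hadd : ∀ s t x, φ (s + t) x = φ s (φ t x)) (x : X) : AddSubgroup (Fin k → ℝ) where
  carrier := {t | φ t x = x}
  add_mem' {s t} hs ht := by
    change φ (s + t) x = x
    rw [hadd, show φ t x = x from ht, show φ s x = x from hs]
  zero_mem' := h0 x
  neg_mem' {t} ht := by
    change φ (-t) x = x
    nth_rw 1 [← show φ t x = x from ht]
    rw [← hadd, neg_add_cancel, h0]

/-- The periods of a point of a compact orbit span the space of times. -/
theorem IsLocallyOrbital.span_periods_eq_top [TopologicalSpace X] [T2Space X] [CompactSpace B] [PreconnectedSpace B]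
    (hl : IsLocallyOrbital φ f) (hφ : Continuous fun p : (Fin k → ℝ) × X => φ p.1 p.2)
    (h0 : ∀ x, φ 0 x = x) (hadd : ∀ s t x, φ (s + t) x = φ s (φ t x)) (hf : Continuous f) (b : B) :
    Submodule.span ℝ {t | φ t (f b) = f b} = ⊤ := by
  by_contra hne
  -- Otherwise a nonzero functional ℓ kills all periods and becomes a function of the endpoint
  -- alone. The times `T` are chosen arbitrarily, yet ℓ ∘ `T` is well defined and continuous, hence
  -- bounded on a compact space. But the orbit runs through all times, so ℓ would be bounded on
  -- `ℝᵏ`.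
  obtain ⟨ℓ, hℓ, hle⟩ := Submodule.exists_le_ker_of_lt_top _ (lt_top_iff_ne_top.2 hne)
  choose T hT using fun b' => hl.exists_apply_eq h0 hadd b b'
  have hper : ∀ s t, φ s (f b) = φ t (f b) → ℓ s = ℓ t := by
    intro s t h
    have h1 : t - s ∈ {t | φ t (f b) = f b} := by
      change φ (t - s) (f b) = f b
      rw [sub_eq_neg_add, hadd, ← h, ← hadd, neg_add_cancel, h0]
    have h2 : ℓ (t - s) = 0 := hle (Submodule.subset_span h1)
    rw [map_sub] at h2
    linarith
  have hcont : Continuous fun b' => ℓ (T b') := by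
    refine continuous_iff_continuousAt.2 fun b₁ => ?_
    obtain ⟨U, hU, τ, hτ, hmap⟩ := hl b₁
    have h1 : Filter.Tendsto (fun b₂ => ℓ (τ b₂) + ℓ (T b₁)) (𝓝 b₁) (𝓝 (ℓ (T b₁))) := by
      have hℓc : Continuous ℓ := ℓ.continuous_of_finiteDimensional
      have h2 : Filter.Tendsto (fun b₂ => ℓ (τ b₂)) (𝓝 b₁) (𝓝 (ℓ 0)) :=
        (hℓc.tendsto 0).comp (Filter.tendsto_iff_comap.2 (Filter.map_le_iff_le_comap.1 hmap.le))
      simpa using h2.add_const (ℓ (T b₁))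
    refine h1.congr' ?_
    filter_upwards [hU] with b₂ hb₂
    rw [← map_add]
    refine hper _ _ ?_
    rw [hadd, ← hT b₁, ← hT b₂, hτ b₂ hb₂]
  obtain ⟨C, hC⟩ := (isCompact_range hcont).bddAbove
  obtain ⟨v, hv⟩ := LinearMap.surjective hℓ (C + 1)
  obtain ⟨b', hb'⟩ := hl.exists_eq_apply hφ h0 hadd hf b v
  have h1 := hper (T b') v (by rw [← hT, hb'])
  have h2 := hC ⟨b', rfl⟩
  simp only [h1, hv] at h2
  linarith

/-- A discrete subgroup spanning the space is a full lattice, so a basis of it over ℤ is also a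
basis of the space over ℝ. -/
theorem exists_basis_of_discrete_addSubgroup (L : AddSubgroup (Fin k → ℝ))
    (hdisc : ∀ᶠ t in 𝓝 (0 : Fin k → ℝ), t ∈ L → t = 0)
    (hspan : Submodule.span ℝ (L : Set (Fin k → ℝ)) = ⊤) :
    ∃ T : Fin k → Fin k → ℝ, LinearIndependent ℝ T ∧ AddSubgroup.closure (range T) = L := by
  set L' : Submodule ℤ (Fin k → ℝ) := AddSubgroup.toIntSubmodule L with hL'
  have : DiscreteTopology L' := by
    refine discreteTopology_of_isOpen_singleton_zero ?_
    rw [isOpen_singleton_iff_nhds_eq_pure, nhds_subtype_eq_comap]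
    refine le_antisymm (fun s hs => ?_) (Filter.le_def.2 fun s hs => ?_)
    · rw [Filter.mem_comap]
      exact ⟨_, hdisc, fun x hx => by
        have : x = 0 := Subtype.ext (hx x.2)
        rw [this]; exact hs⟩
    · rw [Filter.mem_comap] at hs
      obtain ⟨t, ht, hts⟩ := hs
      exact hts (mem_of_mem_nhds (x := ((0 : L') : Fin k → ℝ)) ht)
  have : IsZLattice ℝ L' := ⟨hspan⟩
  let b := IsZLattice.basis L'
  refine ⟨b.ofZLatticeBasis ℝ L', (b.ofZLatticeBasis ℝ L').linearIndependent, ?_⟩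
  have h := b.ofZLatticeBasis_span ℝ L'
  have h2 := congrArg Submodule.toAddSubgroup h
  rwa [Submodule.span_int_eq_addSubgroupClosure] at h2

end Orbits

/-! ### The invariant torus as an orbit -/

section Torus

variable {σ : SymplecticForm n M} {F : Fin k → M → ℝ}
  {φ : (Fin k → ℝ) → M → M} {ι : Torus k → M}

theorem finrank_torusModel (k : ℕ) :
    Module.finrank ℝ (Fin k → EuclideanSpace ℝ (Fin 1)) = k := by
  simp [Module.finrank_pi_fintype]

/-- Invariance places k independent vectors in the image of a k-dimensional space, which they must
exhaust. -/
theorem span_hamiltonianField_eq (hind : ∀ m, LinearIndependent ℝ fun j => σ.hamiltonianField (F j) m)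
    (hΛ : ∀ j, IsInvariantTorus σ (F j) ι) (θ : Torus k) :
    Submodule.span ℝ (range fun j => σ.hamiltonianField (F j) (ι θ)) =
      torusTangent (n := n) ι θ := by
  refine Submodule.eq_of_le_of_finrank_le (Submodule.span_le.2 ?_) ?_
  · rintro _ ⟨j, rfl⟩
    exact hΛ j θ
  · rw [finrank_span_eq_card (hind _), Fintype.card_fin]
    have : FiniteDimensional ℝ (TangentSpace (torusModel k) θ) :=
      inferInstanceAs (FiniteDimensional ℝ (Fin k → EuclideanSpace ℝ (Fin 1)))
    refine (LinearMap.finrank_range_le (mfderiv (torusModel k) (𝓡 (2 * n)) ι θ).toLinearMap).trans ?_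
    exact (finrank_torusModel k).le

/-- The image of the derivative contains k independent fields, so its rank is k and its kernel is
zero. -/
theorem injective_mfderiv_torus
    (hind : ∀ m, LinearIndependent ℝ fun j => σ.hamiltonianField (F j) m)
    (hΛ : ∀ j, IsInvariantTorus σ (F j) ι) (θ : Torus k) :
    Function.Injective (mfderiv (torusModel k) (𝓡 (2 * n)) ι θ) := by
  have h1 : Module.finrank ℝ (torusTangent (n := n) ι θ) = k := by
    rw [← span_hamiltonianField_eq hind hΛ θ, finrank_span_eq_card (hind _), Fintype.card_fin]
  have : FiniteDimensional ℝ (TangentSpace (torusModel k) θ) :=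
    inferInstanceAs (FiniteDimensional ℝ (Fin k → EuclideanSpace ℝ (Fin 1)))
  have h2 := LinearMap.finrank_range_add_finrank_ker (V := TangentSpace (torusModel k) θ)
    (mfderiv (torusModel k) (𝓡 (2 * n)) ι θ).toLinearMap
  have h3 : Module.finrank ℝ (TangentSpace (torusModel k) θ) = k := finrank_torusModel k
  have h4 : Module.finrank ℝ
    (LinearMap.ker (mfderiv (torusModel k) (𝓡 (2 * n)) ι θ).toLinearMap) = 0 := by
    have h5 : Module.finrank ℝ
      (LinearMap.range (mfderiv (torusModel k) (𝓡 (2 * n)) ι θ).toLinearMap) = k := h1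
    omega
  exact LinearMap.ker_eq_bot.1 (Submodule.finrank_eq_zero.1 h4)

variable [IsManifold (𝓡 (2 * n)) ∞ M]

theorem SymplecticForm.IsHamiltonianAction.exists_localTime_torus (hφ : σ.IsHamiltonianAction F φ)
    (hind : ∀ m, LinearIndependent ℝ fun j => σ.hamiltonianField (F j) m)
    (hι : ContMDiff (torusModel k) (𝓡 (2 * n)) ∞ ι)
    (hΛ : ∀ j, IsInvariantTorus σ (F j) ι) (θ : Torus k) :
    ∃ U ∈ 𝓝 θ, ∃ τ : Torus k → Fin k → ℝ, ContMDiffOn (torusModel k) 𝓘(ℝ, Fin k → ℝ) ∞ τ U ∧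
      τ θ = 0 ∧ (∀ θ' ∈ U, ι θ' = φ (τ θ') (ι θ)) ∧ Filter.map τ (𝓝 θ) = 𝓝 0 := by
  have := isManifold_torus k
  refine hφ.exists_localTime hind hι (finrank_torusModel k) (injective_mfderiv_torus hind hΛ)
    (fun θ v => ?_) θ
  have h : mfderiv (torusModel k) (𝓡 (2 * n)) ι θ v ∈ torusTangent (n := n) ι θ := ⟨v, rfl⟩
  rw [← span_hamiltonianField_eq hind hΛ θ, Submodule.mem_span_range_iff_exists_fun] at h
  obtain ⟨c, hc⟩ := h
  exact ⟨c, hc.symm⟩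

/-- The action is locally free. -/
theorem SymplecticForm.IsHamiltonianAction.eventually_eq_zero (hφ : σ.IsHamiltonianAction F φ)
    (hind : ∀ m, LinearIndependent ℝ fun j => σ.hamiltonianField (F j) m) (m : M) :
    ∀ᶠ t in 𝓝 (0 : Fin k → ℝ), φ t m = m → t = 0 := by
  obtain ⟨N, H, e, h0, hH0, he⟩ := hφ.exists_flowBox hind m
  have hc : ContinuousAt (fun t : Fin k → ℝ => ((t, 0) : (Fin k → ℝ) × N)) 0 := by fun_prop
  filter_upwards [hc.preimage_mem_nhds (e.open_source.mem_nhds h0)] with t ht hm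
  have h1 : e (t, 0) = e 0 := by
    rw [(he _ ht).2.1, (he _ h0).2.1, hH0, hm]
    congr 1
    exact (hφ.zero m).symm.trans (hH0 0).symm
  exact congrArg Prod.fst (e.injOn ht h0 h1)

theorem exists_isPeriodBasis [T2Space M] {g : Fin k → ℝ → M → M}
    (hφ : σ.IsHamiltonianAction F (multiFlow g))
    (hind : ∀ m, LinearIndependent ℝ fun j => σ.hamiltonianField (F j) m)
    (hl : IsLocallyOrbital (multiFlow g) ι) (hι : Continuous ι) (θ : Torus k) :
    ∃ T, IsPeriodBasis g (ι θ) T := by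
  obtain ⟨T, hT, hT'⟩ := exists_basis_of_discrete_addSubgroup
    (periodLattice (multiFlow g) hφ.zero hφ.add (ι θ))
    (hφ.eventually_eq_zero hind (ι θ))
    (hl.span_periods_eq_top hφ.continuous hφ.zero hφ.add hι θ)
  exact ⟨T, hT, by rw [hT']; rfl⟩

end Torus

/-! ### Complexified vector spaces -/

section Complexification

variable {V V' : Type*} [AddCommGroup V] [Module ℝ V] [AddCommGroup V'] [Module ℝ V']

variable (V) in
/-- The real part `u` of `u + i v`. -/
def tensorRe : ℂ ⊗[ℝ] V →ₗ[ℝ] V :=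
  (TensorProduct.lid ℝ V).toLinearMap ∘ₗ LinearMap.rTensor V Complex.reLm

variable (V) in
/-- The imaginary part `v` of `u + i v`. -/
def tensorIm : ℂ ⊗[ℝ] V →ₗ[ℝ] V :=
  (TensorProduct.lid ℝ V).toLinearMap ∘ₗ LinearMap.rTensor V Complex.imLm

@[simp]
theorem tensorRe_tmul (c : ℂ) (v : V) : tensorRe V (c ⊗ₜ v) = c.re • v := by
  simp [tensorRe]

@[simp]
theorem tensorIm_tmul (c : ℂ) (v : V) : tensorIm V (c ⊗ₜ v) = c.im • v := by
  simp [tensorIm]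

theorem tmul_re_add_tmul_im (z : ℂ ⊗[ℝ] V) :
    (1 : ℂ) ⊗ₜ[ℝ] tensorRe V z + Complex.I ⊗ₜ[ℝ] tensorIm V z = z := by
  induction z with
  | zero => simp
  | tmul c v =>
    rw [tensorRe_tmul, tensorIm_tmul, ← TensorProduct.smul_tmul, ← TensorProduct.smul_tmul,
      ← TensorProduct.add_tmul]
    congr 1
    rw [Complex.real_smul, Complex.real_smul, mul_one]
    exact Complex.re_add_im c
  | add x y hx hy =>
    rw [map_add, map_add, TensorProduct.tmul_add, TensorProduct.tmul_add]
    nth_rw 3 [← hx]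
    nth_rw 3 [← hy]
    abel

theorem tensor_ext {z z' : ℂ ⊗[ℝ] V} (hre : tensorRe V z = tensorRe V z')
    (him : tensorIm V z = tensorIm V z') : z = z' := by
  rw [← tmul_re_add_tmul_im z, hre, him, tmul_re_add_tmul_im]

theorem tensorRe_smul (c : ℂ) (z : ℂ ⊗[ℝ] V) :
    tensorRe V (c • z) = c.re • tensorRe V z - c.im • tensorIm V z := by
  induction z with
  | zero => simp
  | tmul a v => simp [TensorProduct.smul_tmul', sub_smul, mul_smul]
  | add x y hx hy => rw [smul_add, map_add, hx, hy, map_add, map_add, smul_add, smul_add]; abel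

theorem tensorIm_smul (c : ℂ) (z : ℂ ⊗[ℝ] V) :
    tensorIm V (c • z) = c.re • tensorIm V z + c.im • tensorRe V z := by
  induction z with
  | zero => simp
  | tmul a v => simp [TensorProduct.smul_tmul', add_smul, mul_smul]
  | add x y hx hy => rw [smul_add, map_add, hx, hy, map_add, map_add, smul_add, smul_add]; abel

theorem tensorRe_baseChange (G : V →ₗ[ℝ] V') (z : ℂ ⊗[ℝ] V) :
    tensorRe V' (G.baseChange ℂ z) = G (tensorRe V z) := by
  induction z with
  | zero => simp
  | tmul a v => simp
  | add x y hx hy => rw [map_add, map_add, hx, hy, map_add, map_add]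

theorem tensorIm_baseChange (G : V →ₗ[ℝ] V') (z : ℂ ⊗[ℝ] V) :
    tensorIm V' (G.baseChange ℂ z) = G (tensorIm V z) := by
  induction z with
  | zero => simp
  | tmul a v => simp
  | add x y hx hy => rw [map_add, map_add, hx, hy, map_add, map_add]

theorem mem_baseChange_iff (L : Submodule ℝ V) (z : ℂ ⊗[ℝ] V) :
    z ∈ L.baseChange ℂ ↔ tensorRe V z ∈ L ∧ tensorIm V z ∈ L := by
  refine ⟨fun hz => ?_, fun ⟨h1, h2⟩ => ?_⟩
  · rw [Submodule.baseChange_eq_span] at hz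
    induction hz using Submodule.span_induction with
    | mem x hx =>
      obtain ⟨v, hv, rfl⟩ := hx
      simpa using hv
    | zero => simp
    | add x y _ _ hx hy => exact ⟨by rw [map_add]; exact L.add_mem hx.1 hy.1,
        by rw [map_add]; exact L.add_mem hx.2 hy.2⟩
    | smul a x _ hx =>
      rw [tensorRe_smul, tensorIm_smul]
      exact ⟨L.sub_mem (L.smul_mem _ hx.1) (L.smul_mem _ hx.2),
        L.add_mem (L.smul_mem _ hx.2) (L.smul_mem _ hx.1)⟩
  · rw [← tmul_re_add_tmul_im z]
    exact add_mem (Submodule.tmul_mem_baseChange_of_mem _ h1)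
      (Submodule.tmul_mem_baseChange_of_mem _ h2)

theorem baseChange_bilin_apply (σ : LinearMap.BilinForm ℝ V) (z z' : ℂ ⊗[ℝ] V) :
    LinearMap.BilinForm.baseChange ℂ σ z z' =
      ((σ (tensorRe V z) (tensorRe V z') - σ (tensorIm V z) (tensorIm V z') : ℝ) : ℂ) +
      ((σ (tensorRe V z) (tensorIm V z') + σ (tensorIm V z) (tensorRe V z') : ℝ) : ℂ) *
        Complex.I := by
  conv_lhs => rw [← tmul_re_add_tmul_im z, ← tmul_re_add_tmul_im z']
  simp only [map_add, LinearMap.add_apply, LinearMap.BilinForm.baseChange_tmul]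
  apply Complex.ext <;> simp <;> ring

theorem bijective_baseChange {G : V →ₗ[ℝ] V'} (hG : Function.Bijective G) :
    Function.Bijective (G.baseChange ℂ) := by
  refine ⟨fun z z' h => ?_, fun z => ?_⟩
  · refine tensor_ext (hG.1 ?_) (hG.1 ?_)
    · rw [← tensorRe_baseChange, h, tensorRe_baseChange]
    · rw [← tensorIm_baseChange, h, tensorIm_baseChange]
  · obtain ⟨u, hu⟩ := hG.2 (tensorRe V' z)
    obtain ⟨v, hv⟩ := hG.2 (tensorIm V' z)
    refine ⟨(1 : ℂ) ⊗ₜ u + Complex.I ⊗ₜ v, ?_⟩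
    refine tensor_ext ?_ ?_
    · rw [tensorRe_baseChange]; simp [hu]
    · rw [tensorIm_baseChange]; simp [hv]

end Complexification

/-! ### Positive Lagrangian subspaces from complex structures on the reduced space -/

section Reduction

open Module

variable {V : Type*} [AddCommGroup V] [Module ℝ V] {σ : LinearMap.BilinForm ℝ V}
  {L W : Submodule ℝ V}

/-- An endomorphism preserving `W` and `L` induces a unique endomorphism of `W / L`. -/
theorem existsUnique_reduction {G : V →ₗ[ℝ] V} (hW : ∀ v ∈ W, G v ∈ W) (hL : ∀ v ∈ L, G v ∈ L) :
    ∃! Ξ : (W ⧸ L.submoduleOf W) →ₗ[ℝ] (W ⧸ L.submoduleOf W),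
      ∀ v : W, ∃ w : W, (w : V) = G v ∧
        Ξ (Submodule.Quotient.mk v) = Submodule.Quotient.mk w := by
  refine ⟨(L.submoduleOf W).mapQ (L.submoduleOf W) (G.restrict hW) fun v hv => ?_, fun v => ?_,
    fun Ξ hΞ => ?_⟩
  · exact hL _ hv
  · exact ⟨G.restrict hW v, rfl, rfl⟩
  · refine LinearMap.ext fun x => ?_
    obtain ⟨v, rfl⟩ := Submodule.Quotient.mk_surjective _ x
    obtain ⟨w, hw, h⟩ := hΞ v
    refine h.trans (congrArg Submodule.Quotient.mk ?_)
    exact Subtype.ext hw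

/-- The form induced on the reduced space `W / L`. -/
theorem exists_reducedForm (hσ : ∀ x ∈ W, ∀ y ∈ L, σ x y = 0) (hσ' : ∀ x ∈ L, ∀ y ∈ W, σ x y = 0) :
    ∃ β : LinearMap.BilinForm ℝ (W ⧸ L.submoduleOf W), ∀ x y : W,
      β (Submodule.Quotient.mk x) (Submodule.Quotient.mk y) = σ x y := by
  -- The form is evaluated on representatives picked by a linear section. Two representatives differ
  -- by an element of `L`, which pairs to zero with `W`, so the section does not matter.
  obtain ⟨s, hs⟩ := (L.submoduleOf W).mkQ.exists_rightInverse_of_surjective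
    (Submodule.range_mkQ _)
  refine ⟨(σ.compl₁₂ (W.subtype ∘ₗ s) (W.subtype ∘ₗ s)), fun x y => ?_⟩
  have h : ∀ x : W, (s (Submodule.Quotient.mk x) : V) - x ∈ L := fun x =>
    (Submodule.Quotient.eq (L.submoduleOf W)).1 (LinearMap.congr_fun hs (Submodule.Quotient.mk x))
  have h1 := hσ' _ (h x) _ (s (Submodule.Quotient.mk y)).2
  have h2 := hσ _ x.2 _ (h y)
  simp only [map_sub, LinearMap.sub_apply, sub_eq_zero] at h1 h2
  exact h1.trans h2

/-- The space of the `u + i v` with `u, v ∈ W` and `[v] = -J [u]` in the reduced space. -/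
def positiveSubspace (L W : Submodule ℝ V)
    (J : (W ⧸ L.submoduleOf W) →ₗ[ℝ] (W ⧸ L.submoduleOf W)) (hJ : ∀ x, J (J x) = -x) :
    Submodule ℂ (ℂ ⊗[ℝ] V) where
  carrier := {z | ∃ u v : W, tensorRe V z = u ∧ tensorIm V z = v ∧
    (Submodule.Quotient.mk v : W ⧸ L.submoduleOf W) = -J (Submodule.Quotient.mk u)}
  zero_mem' := ⟨0, 0, by simp, by simp, by
    rw [Submodule.Quotient.mk_zero, map_zero, neg_zero]⟩
  add_mem' := by
    rintro z z' ⟨u, v, hu, hv, h⟩ ⟨u', v', hu', hv', h'⟩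
    refine ⟨u + u', v + v', by simp [hu, hu'], by simp [hv, hv'], ?_⟩
    rw [Submodule.Quotient.mk_add, Submodule.Quotient.mk_add, h, h', map_add, neg_add]
  smul_mem' := by
    rintro c z ⟨u, v, hu, hv, h⟩
    refine ⟨c.re • u - c.im • v, c.re • v + c.im • u, by simp [tensorRe_smul, hu, hv],
      by simp [tensorIm_smul, hu, hv], ?_⟩
    rw [Submodule.Quotient.mk_add, Submodule.Quotient.mk_sub, Submodule.Quotient.mk_smul,
      Submodule.Quotient.mk_smul, Submodule.Quotient.mk_smul, Submodule.Quotient.mk_smul, h]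
    simp only [map_sub, map_smul, map_neg, hJ, smul_neg, neg_neg, neg_sub]
    abel

variable {J : (W ⧸ L.submoduleOf W) →ₗ[ℝ] (W ⧸ L.submoduleOf W)} {hJ : ∀ x, J (J x) = -x}

/-- An element u + iv is determined by u in `W`, chosen freely, and by the difference in `L` between
v and a fixed lift of -J[u]. The sum of the two dimensions is the real dimension, twice the complex
one. -/
theorem finrank_positiveSubspace [FiniteDimensional ℝ V] (hLW : L ≤ W) :
    2 * finrank ℂ (positiveSubspace L W J hJ) = finrank ℝ W + finrank ℝ L := by
  obtain ⟨s, hs⟩ := (L.submoduleOf W).mkQ.exists_rightInverse_of_surjective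
    (Submodule.range_mkQ _)
  let f : W →ₗ[ℝ] V := -(W.subtype ∘ₗ s ∘ₗ J ∘ₗ (L.submoduleOf W).mkQ)
  let Φ : W × L →ₗ[ℝ] ℂ ⊗[ℝ] V :=
    (TensorProduct.mk ℝ ℂ V 1) ∘ₗ W.subtype ∘ₗ LinearMap.fst ℝ W L +
    (TensorProduct.mk ℝ ℂ V Complex.I) ∘ₗ (f ∘ₗ LinearMap.fst ℝ W L +
      L.subtype ∘ₗ LinearMap.snd ℝ W L)
  have hre : ∀ p, tensorRe V (Φ p) = p.1 := fun p => by simp [Φ]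
  have him : ∀ p, tensorIm V (Φ p) = f p.1 + p.2 := fun p => by simp [Φ]
  have hinj : Function.Injective Φ := by
    intro p p' h
    have h1 : p.1 = p'.1 := Subtype.ext (by rw [← hre, h, hre])
    have h2 : f p.1 + p.2 = f p'.1 + p'.2 := by rw [← him, h, him]
    rw [h1, add_right_inj] at h2
    exact Prod.ext h1 (Subtype.ext h2)
  have hrange : LinearMap.range Φ = (positiveSubspace L W J hJ).restrictScalars ℝ := by
    have hs' : ∀ x, (Submodule.Quotient.mk (s x) : W ⧸ L.submoduleOf W) = x := fun x =>
      LinearMap.congr_fun hs x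
    ext z
    refine ⟨?_, ?_⟩
    · rintro ⟨p, rfl⟩
      refine ⟨p.1, -(s (J (Submodule.Quotient.mk p.1))) + ⟨p.2, hLW p.2.2⟩, hre p,
        (him p).trans (by simp [f]), ?_⟩
      rw [Submodule.Quotient.mk_add, Submodule.Quotient.mk_neg, hs']
      have : (Submodule.Quotient.mk ⟨p.2, hLW p.2.2⟩ : W ⧸ L.submoduleOf W) = 0 :=
        (Submodule.Quotient.mk_eq_zero _).2 p.2.2
      rw [this, add_zero]
    · rintro ⟨u, v, hu, hv, h⟩
      have h1 : (v : V) - f u ∈ L := by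
        have h2 : (Submodule.Quotient.mk v : W ⧸ L.submoduleOf W) =
            Submodule.Quotient.mk (-s (J (Submodule.Quotient.mk u))) := by
          rw [h, Submodule.Quotient.mk_neg, hs']
        exact (Submodule.Quotient.eq (L.submoduleOf W)).1 h2
      refine ⟨(u, ⟨_, h1⟩), tensor_ext ?_ ?_⟩
      · rw [hre, hu]
      · rw [him, hv]
        simp
  have h1 := LinearMap.finrank_range_of_inj hinj
  rw [hrange, Module.finrank_prod] at h1
  rw [← h1, ← Complex.finrank_real_complex]
  exact Module.finrank_mul_finrank ℝ ℂ (positiveSubspace L W J hJ)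

theorem baseChange_le_positiveSubspace (hLW : L ≤ W) :
    L.baseChange ℂ ≤ positiveSubspace L W J hJ := by
  intro z hz
  rw [mem_baseChange_iff] at hz
  refine ⟨⟨_, hLW hz.1⟩, ⟨_, hLW hz.2⟩, rfl, rfl, ?_⟩
  have h1 : (Submodule.Quotient.mk ⟨_, hLW hz.1⟩ : W ⧸ L.submoduleOf W) = 0 :=
    (Submodule.Quotient.mk_eq_zero _).2 hz.1
  have h2 : (Submodule.Quotient.mk ⟨_, hLW hz.2⟩ : W ⧸ L.submoduleOf W) = 0 :=
    (Submodule.Quotient.mk_eq_zero _).2 hz.2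
  rw [h1, h2, map_zero, neg_zero]

/-- A maximal isotropic positive subspace invariant under commuting symplectic operators whose
reductions are stable. -/
theorem exists_invariant_positiveSubspace [TopologicalSpace V] [IsTopologicalAddGroup V]
    [ContinuousSMul ℝ V] [T2Space V] [FiniteDimensional ℝ V] (halt : ∀ x, σ x x = 0)
    (hnd : ∀ x, (∀ y, σ x y = 0) → x = 0) (hLW : L ≤ W)
    (hW : ∀ v, v ∈ W ↔ ∀ l ∈ L, σ v l = 0) {κ : Type*} [Finite κ] (G : κ → V →ₗ[ℝ] V)
    (hcomm : ∀ i j, Commute (G i) (G j)) (hG : ∀ i x y, σ (G i x) (G i y) = σ x y)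
    (Ξ : κ → (W ⧸ L.submoduleOf W) →ₗ[ℝ] (W ⧸ L.submoduleOf W))
    (hΞ : ∀ i, ∀ v : W, ∃ w : W, (w : V) = G i v ∧
        Ξ i (Submodule.Quotient.mk v) = Submodule.Quotient.mk w)
    (hS : ∀ i, IsStable (Ξ i)) :
    ∃ r : Submodule ℂ (ℂ ⊗[ℝ] V), 2 * finrank ℂ r = finrank ℝ V ∧
      (∀ z ∈ r, ∀ z' ∈ r, LinearMap.BilinForm.baseChange ℂ σ z z' = 0) ∧ L.baseChange ℂ ≤ r ∧
      (∀ z ∈ r, z ∉ L.baseChange ℂ → σ (tensorRe V z) (tensorIm V z) < 0) ∧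
      ∀ i, r.map ((G i).baseChange ℂ) = r := by
  have hskew : ∀ x y, σ y x = -σ x y := fun x y => by
    have := halt (x + y)
    simp only [map_add, LinearMap.add_apply, halt, zero_add, add_zero] at this
    linarith
  have hrefl : σ.IsRefl := fun x y h => by rw [hskew, h, neg_zero]
  have hnd' : σ.Nondegenerate := ⟨hnd, fun y hy => hnd y fun x => by rw [hskew, hy, neg_zero]⟩
  have hWo : W = σ.orthogonal L := by
    ext v
    rw [hW, LinearMap.BilinForm.mem_orthogonal_iff]
    exact forall₂_congr fun l _ => ⟨fun h => hrefl _ _ h, fun h => hrefl _ _ h⟩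
  -- The double symplectic complement of `L` is `L`; this is the nondegeneracy of the reduced form.
  have hLo : ∀ v, (∀ w ∈ W, σ v w = 0) → v ∈ L := by
    intro v hv
    rw [← LinearMap.BilinForm.orthogonal_orthogonal hnd' hrefl L, ← hWo]
    exact fun w hw => hrefl _ _ (hv w hw)
  have hdim : finrank ℝ W + finrank ℝ L = finrank ℝ V := by
    have h1 := LinearMap.BilinForm.finrank_orthogonal hnd' L
    rw [← hWo] at h1
    have h2 := L.finrank_le
    omega
  have hσWL : ∀ x ∈ W, ∀ y ∈ L, σ x y = 0 := fun x hx => (hW x).1 hx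
  obtain ⟨β, hβ⟩ := exists_reducedForm hσWL fun x hx y hy => hrefl _ _ (hσWL y hy x hx)
  -- Closedness of `L` makes the quotient Hausdorff, so that it is linearly homeomorphic to a
  -- Euclidean space.
  have : IsClosed ((L.submoduleOf W : Submodule ℝ W) : Set W) :=
    Submodule.closed_of_finiteDimensional _
  have : T3Space (W ⧸ L.submoduleOf W) := Submodule.t3_quotient_of_isClosed _
  have hmk := Submodule.Quotient.mk_surjective (L.submoduleOf W)
  obtain ⟨J, hJ, hJβ, hpos, hJΞ⟩ := exists_complexStructure β
    (fun x => by obtain ⟨x, rfl⟩ := hmk x; rw [hβ, halt])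
    (fun x hx => by
      obtain ⟨x, rfl⟩ := hmk x
      refine (Submodule.Quotient.mk_eq_zero _).2 (hLo _ fun w hw => ?_)
      have h := hx (Submodule.Quotient.mk ⟨w, hw⟩)
      rw [hβ] at h
      exact h) Ξ
    (fun i j => LinearMap.ext fun x => by
      obtain ⟨x, rfl⟩ := hmk x
      obtain ⟨xi, hi, hi'⟩ := hΞ i x
      obtain ⟨xj, hj, hj'⟩ := hΞ j x
      obtain ⟨xji, hji, hji'⟩ := hΞ j xi
      obtain ⟨xij, hij, hij'⟩ := hΞ i xj
      change Ξ i (Ξ j _) = Ξ j (Ξ i _)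
      rw [hi', hj', hij', hji']
      congr 1
      refine Subtype.ext ?_
      rw [hij, hji, hj, hi]
      exact LinearMap.congr_fun (hcomm i j).eq x.1)
    (fun i x y => by
      obtain ⟨x, rfl⟩ := hmk x
      obtain ⟨y, rfl⟩ := hmk y
      obtain ⟨x', hx, hx'⟩ := hΞ i x
      obtain ⟨y', hy, hy'⟩ := hΞ i y
      rw [hx', hy', hβ, hβ, hx, hy, hG])
    hS
  have hGbij : ∀ i, Function.Bijective (G i) := by
    intro i
    have h1 : Function.Injective (G i) := (injective_iff_map_eq_zero _).2 fun x hx =>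
      hnd x fun y => by rw [← hG i, hx, map_zero, LinearMap.zero_apply]
    exact ⟨h1, LinearMap.injective_iff_surjective.1 h1⟩
  refine ⟨positiveSubspace L W J hJ, ?_, ?_, baseChange_le_positiveSubspace hLW, ?_, fun i => ?_⟩
  · rw [finrank_positiveSubspace hLW, hdim]
  · rintro z ⟨u, v, hu, hv, h⟩ z' ⟨u', v', hu', hv', h'⟩
    rw [baseChange_bilin_apply, hu, hv, hu', hv', ← hβ, ← hβ, ← hβ, ← hβ, h, h']
    simp only [map_neg, LinearMap.neg_apply, neg_neg, hJβ]
    -- The real part β(u, u') - β(Ju, Ju') vanishes since `J` preserves β. For the imaginary part,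
    -- the same invariance with J² = -1 gives β(u, Ju') = -β(Ju, u').
    have h1 := hJβ (Submodule.Quotient.mk u) (J (Submodule.Quotient.mk u'))
    rw [hJ, map_neg] at h1
    rw [← h1]
    simp
  -- Here σ(u, v) = -β([u], J[u]) is negative unless [u] = 0; in that case [v] = 0 as well, and z
  -- lies in the complexification of `L`.
  · rintro z ⟨u, v, hu, hv, h⟩ hz
    rw [hu, hv, ← hβ, h, map_neg, neg_lt_zero]
    refine hpos _ fun h0 => hz ?_
    rw [h0, map_zero, neg_zero] at h
    rw [mem_baseChange_iff, hu, hv]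
    exact ⟨(Submodule.Quotient.mk_eq_zero (L.submoduleOf W)).1 h0,
      (Submodule.Quotient.mk_eq_zero (L.submoduleOf W)).1 h⟩
  · refine Submodule.eq_of_le_of_finrank_eq ?_ ?_
    · rintro _ ⟨z, ⟨u, v, hu, hv, h⟩, rfl⟩
      obtain ⟨u', h1, h2⟩ := hΞ i u
      obtain ⟨v', h3, h4⟩ := hΞ i v
      refine ⟨u', v', ?_, ?_, ?_⟩
      · rw [tensorRe_baseChange, hu, h1]
      · rw [tensorIm_baseChange, hv, h3]
      · rw [← h4, h, map_neg, ← hJΞ, h2]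
    · exact (LinearEquiv.ofBijective _ (bijective_baseChange (hGbij i))).finrank_map_eq _

end Reduction

/-! ### Transport of tangent vectors along the action -/

variable (n) in
/-- The derivative at `m` of the action of `t`, with values in the tangent space at a point `m'`
equal to the image of `m`. -/
def transport (φ : (Fin k → ℝ) → M → M) (t : Fin k → ℝ) {m m' : M} (h : φ t m = m') :
    TangentSpace (𝓡 (2 * n)) m →ₗ[ℝ] TangentSpace (𝓡 (2 * n)) m' :=
  tangentCast n h ∘ₗ (mfderiv (𝓡 (2 * n)) (𝓡 (2 * n)) (φ t) m).toLinearMap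

namespace SymplecticForm.IsHamiltonianAction

variable {σ : SymplecticForm n M} {F : Fin k → M → ℝ} {φ : (Fin k → ℝ) → M → M}

theorem transport_transport (hφ : σ.IsHamiltonianAction F φ) {s t : Fin k → ℝ} {m m' m'' : M}
    (h : φ t m = m') (h' : φ s m' = m'') (h'' : φ (s + t) m = m'')
    (v : TangentSpace (𝓡 (2 * n)) m) :
    transport n φ s h' (transport n φ t h v) = transport n φ (s + t) h'' v := by
  subst h h'
  -- The identification of tangent spaces at equal points is invisible in the model space, so the
  -- comparison with the plain derivative is made there.
  have h1 : ∀ {p : M} (hp : φ (s + t) m = p),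
      @Eq (EuclideanSpace ℝ (Fin (2 * n))) (transport n φ (s + t) hp v)
        (mfderiv (𝓡 (2 * n)) (𝓡 (2 * n)) (φ (s + t)) m v) := fun hp => by subst hp; rfl
  exact ((h1 h'').trans (hφ.mfderiv_add s t m v)).symm

theorem transport_zero (hφ : σ.IsHamiltonianAction F φ) {m : M} (h : φ 0 m = m) :
    transport n φ 0 h = LinearMap.id := by
  refine LinearMap.ext fun v => ?_
  have h1 : ∀ {p : M} (hp : φ 0 m = p),
      @Eq (EuclideanSpace ℝ (Fin (2 * n))) (transport n φ 0 hp v)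
        (mfderiv (𝓡 (2 * n)) (𝓡 (2 * n)) (φ 0) m v) := fun hp => by subst hp; rfl
  have h2 : φ 0 = id := funext hφ.zero
  let q : (M → M) → EuclideanSpace ℝ (Fin (2 * n)) := fun f =>
    mfderiv (𝓡 (2 * n)) (𝓡 (2 * n)) f m v
  refine (h1 h).trans ((congrArg q h2).trans ?_)
  change mfderiv (𝓡 (2 * n)) (𝓡 (2 * n)) id m v = v
  rw [mfderiv_id]
  rfl

theorem bilin_transport (hφ : σ.IsHamiltonianAction F φ) {t : Fin k → ℝ} {m m' : M}
    (h : φ t m = m') (u v : TangentSpace (𝓡 (2 * n)) m) :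
    σ.bilin m' (transport n φ t h u) (transport n φ t h v) = σ.bilin m u v := by
  subst h
  exact hφ.symplectic t m u v

theorem transport_field (hφ : σ.IsHamiltonianAction F φ) {t : Fin k → ℝ} {m m' : M}
    (h : φ t m = m') (j : Fin k) :
    transport n φ t h (σ.hamiltonianField (F j) m) = σ.hamiltonianField (F j) m' := by
  subst h
  exact hφ.field j t m

theorem bijective_transport (hφ : σ.IsHamiltonianAction F φ) {t : Fin k → ℝ} {m m' : M}
    (h : φ t m = m') : Function.Bijective (transport n φ t h) := by
  have h1 : φ (-t) m' = m := by rw [← h, hφ.neg_apply]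
  have h2 : ∀ v, transport n φ (-t) h1 (transport n φ t h v) = v := fun v => by
    have h3 : φ (-t + t) m = m := by rw [hφ.add, h, h1]
    rw [hφ.transport_transport h h1 h3]
    have h4 : ∀ (s : Fin k → ℝ) (hs : φ s m = m), s = 0 → transport n φ s hs v = v := by
      rintro s hs rfl
      rw [hφ.transport_zero]
      rfl
    exact h4 _ _ (neg_add_cancel t)
  have hinj : Function.Injective (transport n φ t h) := Function.LeftInverse.injective h2
  exact ⟨hinj, (LinearMap.injective_iff_surjective_of_finrank_eq_finrank rfl).1 hinj⟩

theorem mem_levelTangent_iff {m : M} {v : TangentSpace (𝓡 (2 * n)) m} :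
    v ∈ levelTangent (n := n) F m ↔ ∀ j, σ.bilin m v (σ.hamiltonianField (F j) m) = 0 := by
  simp only [levelTangent, Submodule.mem_iInf, LinearMap.mem_ker]
  exact forall_congr' fun j => by rw [hamiltonianField, σ.bilin_J]

/-- This is where TΣ is seen to be the symplectic complement of the span of the Hamiltonian fields:
ω(v, J dF_j) = dF_j(v). -/
theorem mem_levelTangent_iff_span {m : M} {v : TangentSpace (𝓡 (2 * n)) m} :
    v ∈ levelTangent (n := n) F m ↔
      ∀ l ∈ Submodule.span ℝ (range fun j => σ.hamiltonianField (F j) m), σ.bilin m v l = 0 := by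
  rw [mem_levelTangent_iff (σ := σ)]
  refine ⟨fun h l hl => ?_, fun h j => h _ (Submodule.subset_span ⟨j, rfl⟩)⟩
  have : Submodule.span ℝ (range fun j => σ.hamiltonianField (F j) m) ≤
      LinearMap.ker (σ.bilin m v) := by
    rw [Submodule.span_le]
    rintro _ ⟨j, rfl⟩
    exact h j
  exact this hl

theorem transport_mem_levelTangent (hφ : σ.IsHamiltonianAction F φ) {t : Fin k → ℝ} {m m' : M}
    (h : φ t m = m') {v : TangentSpace (𝓡 (2 * n)) m} (hv : v ∈ levelTangent (n := n) F m) :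
    transport n φ t h v ∈ levelTangent (n := n) F m' := by
  rw [mem_levelTangent_iff (σ := σ)] at hv ⊢
  intro j
  rw [← hφ.transport_field h j, hφ.bilin_transport]
  exact hv j

theorem map_transport_span (hφ : σ.IsHamiltonianAction F φ) {t : Fin k → ℝ} {m m' : M}
    (h : φ t m = m') :
    (Submodule.span ℝ (range fun j => σ.hamiltonianField (F j) m)).map (transport n φ t h) =
      Submodule.span ℝ (range fun j => σ.hamiltonianField (F j) m') := by
  rw [Submodule.map_span, ← range_comp]
  congr 2
  exact funext fun j => hφ.transport_field h j

theorem map_transport_map (hφ : σ.IsHamiltonianAction F φ) {s t : Fin k → ℝ} {m m' m'' : M}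
    (h : φ t m = m') (h' : φ s m' = m'') (h'' : φ (s + t) m = m'')
    (r : Submodule ℂ (ComplexTangent n m)) :
    (r.map ((transport n φ t h).baseChange ℂ)).map ((transport n φ s h').baseChange ℂ) =
      r.map ((transport n φ (s + t) h'').baseChange ℂ) := by
  rw [← Submodule.map_comp, ← LinearMap.baseChange_comp]
  congr 2
  exact LinearMap.ext fun v => hφ.transport_transport h h' h'' v

/-- A subspace invariant under generating periods is invariant under all periods. -/
theorem map_transport_eq_of_mem_closure (hφ : σ.IsHamiltonianAction F φ) {m : M}
    {r : Submodule ℂ (ComplexTangent n m)} {κ : Type*} {T : κ → Fin k → ℝ}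
    (hT : ∀ i, φ (T i) m = m) (hr : ∀ i, r.map ((transport n φ (T i) (hT i)).baseChange ℂ) = r)
    {t : Fin k → ℝ} (ht : t ∈ AddSubgroup.closure (range T)) (h : φ t m = m) :
    r.map ((transport n φ t h).baseChange ℂ) = r := by
  -- The transport depends on a proof that t is a period, so the induction over the generated
  -- subgroup must carry this fact along with the invariance.
  have key : ∃ h : φ t m = m, r.map ((transport n φ t h).baseChange ℂ) = r := by
    clear h
    have hzero : ∀ (s : Fin k → ℝ) (hs : φ s m = m), s = 0 →
        r.map ((transport n φ s hs).baseChange ℂ) = r := by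
      rintro s hs rfl
      rw [hφ.transport_zero, LinearMap.baseChange_id, Submodule.map_id]
    induction ht using AddSubgroup.closure_induction with
    | mem t ht =>
      obtain ⟨i, rfl⟩ := ht
      exact ⟨hT i, hr i⟩
    | zero => exact ⟨hφ.zero m, hzero 0 _ rfl⟩
    | add s t _ _ hs ht =>
      obtain ⟨h1, h2⟩ := hs
      obtain ⟨h3, h4⟩ := ht
      have h5 : φ (s + t) m = m := by rw [hφ.add, h3, h1]
      refine ⟨h5, ?_⟩
      rw [← hφ.map_transport_map h3 h1 h5, h4, h2]
    | neg t _ ht =>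
      obtain ⟨h1, h2⟩ := ht
      have h3 : φ (-t) m = m := by nth_rw 1 [← h1]; exact hφ.neg_apply t m
      refine ⟨h3, ?_⟩
      have h4 : φ (-t + t) m = m := by rw [hφ.add, h1, h3]
      nth_rw 1 [← h2]
      rw [hφ.map_transport_map h1 h3 h4]
      exact hzero _ _ (neg_add_cancel t)
  exact key.2

open Classical in
/-- The field of subspaces along the orbit of `m` obtained from a subspace at `m`. -/
theorem exists_transported_field (hφ : σ.IsHamiltonianAction F φ) {m : M}
    {r₀ : Submodule ℂ (ComplexTangent n m)}
    (hr : ∀ t (h : φ t m = m), r₀.map ((transport n φ t h).baseChange ℂ) = r₀) :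
    ∃ r : ∀ m' : M, Submodule ℂ (ComplexTangent n m'), ∀ t m' (h : φ t m = m'),
      r m' = r₀.map ((transport n φ t h).baseChange ℂ) := by
  -- Off the orbit the value is a mere default; on it, an arbitrary time is chosen.
  refine ⟨fun m' => if h : ∃ t, φ t m = m' then
    r₀.map ((transport n φ h.choose h.choose_spec).baseChange ℂ) else ⊥, fun t m' h => ?_⟩
  have hex : ∃ t, φ t m = m' := ⟨t, h⟩
  refine (dif_pos hex).trans ?_
  -- The chosen time differs from t by a period, which `r₀` absorbs; this gives independence of the
  -- time.
  have h1 : φ (-t + hex.choose) m = m := by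
    rw [hφ.add, hex.choose_spec, ← h, hφ.neg_apply]
  have h2 : φ (t + (-t + hex.choose)) m = m' := by rw [hφ.add, h1, h]
  nth_rw 2 [← hr _ h1]
  rw [hφ.map_transport_map h1 h h2]
  have h3 : ∀ (s s' : Fin k → ℝ) (hs : φ s m = m') (hs' : φ s' m = m'), s = s' →
      r₀.map ((transport n φ s hs).baseChange ℂ) = r₀.map ((transport n φ s' hs').baseChange ℂ) := by
    rintro s s' hs hs' rfl
    rfl
  exact h3 _ _ _ _ (add_neg_cancel_left t _).symm

end SymplecticForm.IsHamiltonianAction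

theorem baseChange_transport_eq (φ : (Fin k → ℝ) → M → M) (t : Fin k → ℝ) {m m' : M}
    (h : φ t m = m') (z : ComplexTangent n m) :
    (transport n φ t h).baseChange ℂ z =
      complexVector (transport n φ t h (tensorRe _ z)) (transport n φ t h (tensorIm _ z)) := by
  refine tensor_ext ?_ ?_
  · rw [tensorRe_baseChange]
    simp [complexVector]
  · rw [tensorIm_baseChange]
    simp [complexVector]

theorem tensorRe_conjugation {m : M} (z : ComplexTangent n m) :
    tensorRe _ (conjugation m z) = tensorRe _ z := by
  induction z using TensorProduct.induction_on with
  | zero => simp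
  | tmul a v => simp [conjugation]
  | add x y hx hy => rw [map_add, map_add, hx, hy, map_add]

theorem tensorIm_conjugation {m : M} (z : ComplexTangent n m) :
    tensorIm _ (conjugation m z) = -tensorIm _ z := by
  induction z using TensorProduct.induction_on with
  | zero => simp
  | tmul a v => simp [conjugation]
  | add x y hx hy => rw [map_add, map_add, hx, hy, map_add, neg_add]

section Germ

variable [IsManifold (𝓡 (2 * n)) ∞ M] {σ : SymplecticForm n M} {F : Fin k → M → ℝ}
  {φ : (Fin k → ℝ) → M → M}

/-- The transported vector is the tangent map of the joint action applied to the zero vector at `τ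
b` paired with the fixed vector `a`, so it depends smoothly on `b`. -/
theorem SymplecticForm.IsHamiltonianAction.contMDiffOn_transport (hφ : σ.IsHamiltonianAction F φ)
    {E' H' B : Type*} [NormedAddCommGroup E'] [NormedSpace ℝ E'] [TopologicalSpace H']
    {I' : ModelWithCorners ℝ E' H'} [TopologicalSpace B] [ChartedSpace H' B] {τ : B → Fin k → ℝ}
    {U : Set B} (hτ : ContMDiffOn I' 𝓘(ℝ, Fin k → ℝ) ∞ τ U) (m : M)
    (a : TangentSpace (𝓡 (2 * n)) m) :
    ContMDiffOn I' (𝓡 (2 * n)).tangent ∞ (fun b => (⟨φ (τ b) m,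
      mfderiv (𝓡 (2 * n)) (𝓡 (2 * n)) (φ (τ b)) m a⟩ : TangentBundle (𝓡 (2 * n)) M)) U := by
  have h1 := hφ.smooth.contMDiff_tangentMap (m := ∞) (by decide)
  have h0 : ContMDiffOn I' 𝓘(ℝ, Fin k → ℝ).tangent ∞
      (fun b => (⟨τ b, 0⟩ : TangentBundle 𝓘(ℝ, Fin k → ℝ) (Fin k → ℝ))) U :=
    (Bundle.contMDiff_zeroSection (n := ∞) ℝ
      (TangentSpace 𝓘(ℝ, Fin k → ℝ) : (Fin k → ℝ) → Type _)).comp_contMDiffOn hτ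
  have h2 : ContMDiffOn I' ((𝓘(ℝ, Fin k → ℝ).prod (𝓡 (2 * n))).tangent) ∞
      (fun b => (equivTangentBundleProd 𝓘(ℝ, Fin k → ℝ) (Fin k → ℝ) (𝓡 (2 * n)) M).symm
        ((⟨τ b, 0⟩ : TangentBundle 𝓘(ℝ, Fin k → ℝ) (Fin k → ℝ)),
          (⟨m, a⟩ : TangentBundle (𝓡 (2 * n)) M))) U :=
    contMDiff_equivTangentBundleProd_symm.comp_contMDiffOn (h0.prodMk contMDiffOn_const)
  refine (h1.comp_contMDiffOn h2).congr fun b hb => ?_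
  change _ = (⟨φ (τ b) m, mfderiv (𝓘(ℝ, Fin k → ℝ).prod (𝓡 (2 * n))) (𝓡 (2 * n))
    (fun p : (Fin k → ℝ) × M => φ p.1 p.2) (τ b, m)
      ((0 : Fin k → ℝ), a)⟩ : TangentBundle (𝓡 (2 * n)) M)
  congr 1
  refine Eq.trans ?_ (mfderiv_prod_eq_add_apply (hφ.smooth.mdifferentiableAt (by decide))).symm
  refine ((congrArg (· + _) (map_zero _)).trans (zero_add _)).symm

end Germ

/-! ### The germ -/

/-- On a subspace where `σ(u, v) < 0` for `u + i v`, the Hermitian form is positive. -/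
theorem SymplecticForm.pos_of_neg (σ : SymplecticForm n M) {m : M} {z : ComplexTangent n m}
    (hz : σ.bilin m (tensorRe _ z) (tensorIm _ z) < 0) :
    open scoped ComplexOrder in
    0 < 1 / (2 * Complex.I) * σ.complexBilin m z (conjugation m z) := by
  have h : 1 / (2 * Complex.I) * σ.complexBilin m z (conjugation m z) =
      ((-σ.bilin m (tensorRe _ z) (tensorIm _ z) : ℝ) : ℂ) := by
    rw [complexBilin, baseChange_bilin_apply, tensorRe_conjugation, tensorIm_conjugation, map_neg,
      map_neg, σ.bilin_self, σ.bilin_self, σ.bilin_swap m (tensorIm _ z) (tensorRe _ z)]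
    have hI := Complex.I_ne_zero
    push_cast
    field_simp
    ring
  rw [h]
  exact Complex.zero_lt_real.2 (neg_pos.2 hz)

variable {σ : SymplecticForm n M} {F : Fin k → M → ℝ}

/-- A monodromy is the transport along a period. It preserves the form and the Hamiltonian fields,
hence their span TΛ and its symplectic complement TΣ. -/
theorem existsUnique_isReduction {g : Fin k → ℝ → M → M} (hφ : σ.IsHamiltonianAction F (multiFlow g))
    (hind : ∀ m, LinearIndependent ℝ fun j => σ.hamiltonianField (F j) m) {ι : Torus k → M}
    (hΛ : ∀ j, IsInvariantTorus σ (F j) ι) {θ : Torus k} {t : Fin k → ℝ}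
    (ht : multiFlow g t (ι θ) = ι θ) :
    ∃! Ξ : ReducedSpace n F ι θ →ₗ[ℝ] ReducedSpace n F ι θ,
      IsReduction F ι θ (monodromy n g t ht) Ξ := by
  refine existsUnique_reduction (fun v hv => hφ.transport_mem_levelTangent ht hv) fun v hv => ?_
  rw [← span_hamiltonianField_eq hind hΛ θ] at hv ⊢
  conv => enter [1]; rw [← hφ.map_transport_span ht]
  exact Submodule.mem_map_of_mem hv

variable [IsManifold (𝓡 (2 * n)) ∞ M]

/-- A subspace at one point that satisfies the algebraic conditions and is fixed by all periods
spreads over the orbit. Transport is a symplectic isomorphism carrying fields to fields, so the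
conditions hold everywhere, and the group law gives invariance under the flows. -/
theorem exists_isComplexGerm {g : Fin k → ℝ → M → M}
    (hg : ∀ j, σ.IsHamiltonianFlow (F j) (g j)) (hφ : σ.IsHamiltonianAction F (multiFlow g))
    (hind : ∀ m, LinearIndependent ℝ fun j => σ.hamiltonianField (F j) m) {ι : Torus k → M}
    (hι : ContMDiff (torusModel k) (𝓡 (2 * n)) ∞ ι)
    (hΛ : ∀ j, IsInvariantTorus σ (F j) ι) {m : M}
    (hm : ∀ θ, ∃ t, multiFlow g t m = ι θ) {r₀ : Submodule ℂ (ComplexTangent n m)}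
    (hrank : Module.finrank ℂ r₀ = n)
    (hiso : ∀ z ∈ r₀, ∀ z' ∈ r₀, σ.complexBilin m z z' = 0)
    (hL : (Submodule.span ℝ (range fun j => σ.hamiltonianField (F j) m)).baseChange ℂ ≤ r₀)
    (hneg : ∀ z ∈ r₀,
      z ∉ (Submodule.span ℝ (range fun j => σ.hamiltonianField (F j) m)).baseChange ℂ →
        σ.bilin m (tensorRe _ z) (tensorIm _ z) < 0)
    (hper : ∀ t (h : multiFlow g t m = m),
      r₀.map ((transport n (multiFlow g) t h).baseChange ℂ) = r₀) :
    ∃ r : ∀ m : M, Submodule ℂ (ComplexTangent n m), IsComplexGerm σ ι g r := by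
  obtain ⟨r, hr⟩ := hφ.exists_transported_field hper
  have hmem : ∀ {t : Fin k → ℝ} {m' : M} (h : multiFlow g t m = m') (z : ComplexTangent n m),
      (transport n (multiFlow g) t h).baseChange ℂ z ∈
        (Submodule.span ℝ (range fun j => σ.hamiltonianField (F j) m')).baseChange ℂ ↔
      z ∈ (Submodule.span ℝ (range fun j => σ.hamiltonianField (F j) m)).baseChange ℂ := by
    intro t m' h z
    have hinj := (hφ.bijective_transport h).1
    rw [mem_baseChange_iff, mem_baseChange_iff, tensorRe_baseChange, tensorIm_baseChange,
      ← hφ.map_transport_span h]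
    exact and_congr (hinj.mem_set_image) (hinj.mem_set_image)
  refine ⟨r, ⟨fun θ₀ => ?_, fun θ => ?_, fun θ => ?_, fun θ => ?_, fun θ => ?_, fun θ j s => ?_⟩⟩
  · obtain ⟨U, hU, τ, hτ, -, hιτ, -⟩ := hφ.exists_localTime_torus hind hι hΛ θ₀
    obtain ⟨s, hs⟩ := hm θ₀
    let b := Module.finBasisOfFinrankEq ℂ r₀ hrank
    have hτs : ContMDiffOn (torusModel k) 𝓘(ℝ, Fin k → ℝ) ∞ (fun θ => τ θ + s) U :=
      hτ.add contMDiffOn_const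
    have hθ : ∀ θ ∈ U, multiFlow g (τ θ + s) m = ι θ := fun θ hθ => by
      rw [hφ.add, hs, ← hιτ θ hθ]
    -- Smooth local frame: a fixed basis of `r₀` is transported for the time `τ θ + s`, where s
    -- leads from m to the centre of the neighbourhood and `τ` is the smooth local time.
    let w : TangentSpace (𝓡 (2 * n)) m → ∀ θ : Torus k, TangentSpace (𝓡 (2 * n)) (ι θ) :=
      fun a θ => (mfderiv (𝓡 (2 * n)) (𝓡 (2 * n)) (multiFlow g (τ θ + s)) m a :
        EuclideanSpace ℝ (Fin (2 * n)))
    have hw : ∀ a, ContMDiffOn (torusModel k) (𝓡 (2 * n)).tangent ∞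
        (fun θ => (⟨ι θ, w a θ⟩ : TangentBundle (𝓡 (2 * n)) M)) U := by
      intro a
      refine (hφ.contMDiffOn_transport hτs m a).congr fun θ h => ?_
      exact congrArg (fun p : M => (⟨p, (mfderiv (𝓡 (2 * n)) (𝓡 (2 * n))
        (multiFlow g (τ θ + s)) m a : EuclideanSpace ℝ (Fin (2 * n)))⟩ :
          TangentBundle (𝓡 (2 * n)) M)) (hθ θ h).symm
    have hw' : ∀ a θ (h : θ ∈ U), w a θ = transport n (multiFlow g) (τ θ + s) (hθ θ h) a := by
      intro a θ h
      have h1 : ∀ {p : M} (hp : multiFlow g (τ θ + s) m = p),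
        @Eq (EuclideanSpace ℝ (Fin (2 * n)))
          (mfderiv (𝓡 (2 * n)) (𝓡 (2 * n)) (multiFlow g (τ θ + s)) m a)
          (transport n (multiFlow g) (τ θ + s) hp a) := fun hp => by subst hp; rfl
      exact h1 (hθ θ h)
    refine ⟨U, hU, fun j => w (tensorRe _ (b j : ComplexTangent n m)),
      fun j => w (tensorIm _ (b j : ComplexTangent n m)), fun j => hw _, fun j => hw _,
      fun θ h => ?_⟩
    have hspan : r₀ = Submodule.span ℂ (range fun j => (b j : ComplexTangent n m)) := by
      have h1 := congrArg (Submodule.map r₀.subtype) b.span_eq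
      rw [Submodule.map_span, Submodule.map_top, Submodule.range_subtype, ← range_comp] at h1
      exact h1.symm
    rw [hr _ _ (hθ θ h)]
    conv_lhs => rw [hspan]
    rw [Submodule.map_span, ← range_comp]
    congr 2
    funext j
    rw [Function.comp_apply, baseChange_transport_eq, ← hw' _ _ h, ← hw' _ _ h]
  · obtain ⟨t, ht⟩ := hm θ
    rw [hr _ _ ht]
    exact ((LinearEquiv.ofBijective _
      (bijective_baseChange (hφ.bijective_transport ht))).finrank_map_eq _).trans hrank
  · obtain ⟨t, ht⟩ := hm θ
    rw [hr _ _ ht]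
    rintro _ ⟨z, hz, rfl⟩ _ ⟨z', hz', rfl⟩
    rw [← hiso z hz z' hz', SymplecticForm.complexBilin, SymplecticForm.complexBilin,
      baseChange_bilin_apply, baseChange_bilin_apply]
    simp only [tensorRe_baseChange, tensorIm_baseChange, hφ.bilin_transport]
  · obtain ⟨t, ht⟩ := hm θ
    rw [hr _ _ ht, ← span_hamiltonianField_eq hind hΛ θ]
    intro z' hz'
    obtain ⟨z, rfl⟩ := (bijective_baseChange (hφ.bijective_transport ht)).2 z'
    exact ⟨z, hL ((hmem ht z).1 hz'), rfl⟩
  · obtain ⟨t, ht⟩ := hm θ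
    rw [hr _ _ ht, ← span_hamiltonianField_eq hind hΛ θ]
    rintro _ ⟨z, hz, rfl⟩ hz'
    refine σ.pos_of_neg ?_
    rw [tensorRe_baseChange, tensorIm_baseChange, hφ.bilin_transport]
    exact hneg z hz fun h => hz' ((hmem ht z).2 h)
  · obtain ⟨t, ht⟩ := hm θ
    -- A single flow is the joint action at a multiple of a basis vector, so flow invariance is the
    -- composition rule for transports.
    have hs : multiFlow g (Pi.single j s) = g j s :=
      funext fun p => multiFlow_single (fun j => (hg j).zero) j s p
    rw [← hs]
    have h2 : multiFlow g (Pi.single j s + t) m = multiFlow g (Pi.single j s) (ι θ) := by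
      rw [hφ.add, ht]
    rw [hr _ _ ht, hr _ _ h2]
    exact hφ.map_transport_map ht rfl h2 r₀

end ComplexGerm

end

/-! ### Existence of the invariant germ -/

theorem mainTheorem1 {n k : ℕ} (hkn : k < n)
    {M : Type*} [TopologicalSpace M] [T2Space M]
    [ChartedSpace (EuclideanSpace ℝ (Fin (2 * n))) M] [IsManifold (𝓡 (2 * n)) ∞ M]
    (σ : ComplexGerm.SymplecticForm n M)
    (F : Fin k → M → ℝ) (hF : ∀ j, ContMDiff (𝓡 (2 * n)) 𝓘(ℝ, ℝ) ∞ (F j))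
    (hinv : ∀ i j m, σ.poisson (F i) (F j) m = 0)
    (hind : ∀ m : M,
      LinearIndependent ℝ fun j => ComplexGerm.differential (n := n) (F j) m)
    (g : Fin k → ℝ → M → M) (hg : ∀ j, σ.IsHamiltonianFlow (F j) (g j))
    (ι : ComplexGerm.Torus k → M)
    (hι : Manifold.IsSmoothEmbedding (ComplexGerm.torusModel k) (𝓡 (2 * n)) ∞ ι)
    (hiso : ComplexGerm.IsIsotropicTorus σ ι)
    (hΛ : ∀ j, ComplexGerm.IsInvariantTorus σ (F j) ι)
    (θ : ComplexGerm.Torus k) :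
    (∃ T : Fin k → Fin k → ℝ, ComplexGerm.IsPeriodBasis g (ι θ) T) ∧
    ∀ (T : Fin k → Fin k → ℝ) (hT : ComplexGerm.IsPeriodBasis g (ι θ) T),
      (∀ j, ∃! Ξ : ComplexGerm.ReducedSpace n F ι θ →ₗ[ℝ] ComplexGerm.ReducedSpace n F ι θ,
        ComplexGerm.IsReduction F ι θ
          (ComplexGerm.monodromy n g (T j) (hT.multiFlow_eq j)) Ξ) ∧
      ∀ Ξ : Fin k → (ComplexGerm.ReducedSpace n F ι θ →ₗ[ℝ] ComplexGerm.ReducedSpace n F ι θ),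
        (∀ j, ComplexGerm.IsReduction F ι θ
          (ComplexGerm.monodromy n g (T j) (hT.multiFlow_eq j)) (Ξ j)) →
        (∀ j, ComplexGerm.IsStable (Ξ j)) →
        ∃ r : ∀ m : M, Submodule ℂ (ComplexGerm.ComplexTangent n m),
          ComplexGerm.IsComplexGerm σ ι g r := by
  have hX : ∀ m, LinearIndependent ℝ fun j => σ.hamiltonianField (F j) m := fun m =>
    σ.linearIndependent_hamiltonianField (hind m)
  have hφ := ComplexGerm.SymplecticForm.isHamiltonianAction_multiFlow hF hinv hg
  have hι' := hι.contMDiff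
  have hl : ComplexGerm.IsLocallyOrbital (ComplexGerm.multiFlow g) ι := fun θ => by
    obtain ⟨U, hU, τ, -, -, h1, h2⟩ := hφ.exists_localTime_torus hX hι' hΛ θ
    exact ⟨U, hU, τ, h1, h2⟩
  refine ⟨ComplexGerm.exists_isPeriodBasis hφ hX hl hι'.continuous θ, fun T hT =>
    ⟨fun j => ComplexGerm.existsUnique_isReduction hφ hX hΛ _, fun Ξ hΞ hS => ?_⟩⟩
  have hspan := ComplexGerm.span_hamiltonianField_eq hX hΛ θ
  have : T2Space (TangentSpace (𝓡 (2 * n)) (ι θ)) :=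
    inferInstanceAs (T2Space (EuclideanSpace ℝ (Fin (2 * n))))
  obtain ⟨r, hr, hr1, hr2, hr3, hr4⟩ := ComplexGerm.exists_invariant_positiveSubspace
    (σ := σ.bilin (ι θ)) (L := ComplexGerm.torusTangent (n := n) ι θ)
    (W := ComplexGerm.levelTangent (n := n) F (ι θ)) (σ.bilin_self (ι θ))
    (fun x hx => σ.nondegenerate _ x fun y => by
      have := hx y
      rw [σ.bilin_swap, neg_eq_zero] at this
      exact this)
    -- Isotropy of the torus, with the fields tangent to it, gives TΛ ⊆ TΣ.
    (fun v hv => ComplexGerm.SymplecticForm.IsHamiltonianAction.mem_levelTangent_iff (σ := σ).2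
      fun j => hiso θ v hv _ (hΛ j θ))
    (fun v => by
      rw [← hspan]
      exact ComplexGerm.SymplecticForm.IsHamiltonianAction.mem_levelTangent_iff_span)
    (fun j => ComplexGerm.monodromy n g (T j) (hT.multiFlow_eq j))
    -- Both composites of two monodromies are the transport along the sum of the two periods.
    (fun i j => LinearMap.ext fun v => by
      have h1 : ComplexGerm.multiFlow g (T i + T j) (ι θ) = ι θ := by
        rw [hφ.add, hT.multiFlow_eq, hT.multiFlow_eq]
      have h2 : ComplexGerm.multiFlow g (T j + T i) (ι θ) = ι θ := by
        rw [hφ.add, hT.multiFlow_eq, hT.multiFlow_eq]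
      refine (hφ.transport_transport (hT.multiFlow_eq j) (hT.multiFlow_eq i) h1 v).trans
        (Eq.trans ?_
          (hφ.transport_transport (hT.multiFlow_eq i) (hT.multiFlow_eq j) h2 v).symm)
      congr! 2
      exact add_comm _ _)
    (fun j => hφ.bilin_transport (hT.multiFlow_eq j)) Ξ hΞ hS
  refine ComplexGerm.exists_isComplexGerm hg hφ hX hι' hΛ (m := ι θ) (r₀ := r)
    (fun θ' => ?_) ?_ hr1 (hspan ▸ hr2) (hspan ▸ hr3) fun t ht => ?_
  · obtain ⟨t, ht⟩ := hl.exists_apply_eq hφ.zero hφ.add θ θ'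
    exact ⟨t, ht.symm⟩
  · have h : Module.finrank ℝ (TangentSpace (𝓡 (2 * n)) (ι θ)) = 2 * n :=
      finrank_euclideanSpace_fin
    exact Nat.eq_of_mul_eq_mul_left two_pos (hr.trans h)
  · have h : t ∈ (AddSubgroup.closure (Set.range T) : Set (Fin k → ℝ)) := by
      rw [hT.generates]
      exact ht
    exact hφ.map_transport_eq_of_mem_closure hT.multiFlow_eq hr4 h ht
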